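/- Write a tangent vector of $N=SL(2,\mathbb R)\times SL(2,\mathbb R)$ at $(A,B)$ as $(A\alpha,B\beta)$ with $\alpha,\beta$ trace-free real $2\times2$ matrices, and put $\langle\alpha,\gamma\rangle=\tfrac12\operatorname{tr}(\alpha\gamma)$ for trace-free $\alpha,\gamma$. The nearly Kähler structure $(g,J)$ on $N$ and the almost product structure $P$ are $$g\big((A\alpha,B\beta),(A\gamma,B\delta)\big)=\tfrac23\big(\langle\alpha,\gamma\rangle+\langle\beta,\delta\rangle\big)-\tfrac13\big(\langle\beta,\gamma\rangle+\langle\alpha,\delta\rangle\big),$$ $$J(A\alpha,B\beta)=\tfrac1{\sqrt3}\big(A(\alpha-2\beta),B(2\alpha-\beta)\big),\qquad P(A\alpha,B\beta)=(A\beta,B\alpha).$$ Let $M$ be a connected smooth surface and $F:M\to N$ a smooth immersion whose induced metric is nondegenerate and whose tangent planes are $J$-invariant (an almost complex surface). Let $h$ be its second fundamental form with respect to the Levi-Civita connection of $g$, and suppose that $h$ is parallel, $\nabla h=0$. Let $K$ be the Gaussian curvature of the induced metric. Then one of the following holds. (1) $P$ maps the tangent planes of $M$ into the normal spaces, and either $M$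 is totally geodesic ($h=0$) with constant Gaussian curvature $K=-\tfrac43$, or $M$ has constant Gaussian curvature $K=-\tfrac59$. (2) $P$ preserves the tangent planes of $M$, $K=0$, $M$ is totally geodesic, and $M$ is congruent to (an open part of) one of the following two surfaces $(s,t)\mapsto(A(s,t),B(s,t))$, where $x=\tfrac1{\sqrt2}(\sqrt3\,s-t)$ and $y=\tfrac1{\sqrt2}(\sqrt3\,s+t)$: $$A=\begin{pmatrix}e^{x}&0\\0&e^{-x}\end{pmatrix},\ B=\begin{pmatrix}e^{y}&0\\0&e^{-y}\end{pmatrix};\qquad\text{or}\qquad A=\begin{pmatrix}\cos x&\sin x\\-\sin x&\cos x\end{pmatrix},\ B=\begin{pmatrix}\cos y&\sin y\\-\sin y&\cos y\end{pmatrix}.$$ Here congruent means that there is an isometry $\Phi(p,q)=(apc,bqc)$ of $N$, with $a,b,c\in SL(2,\mathbb R)$, such that around every point of $M$ there are smooth coordinates $(s,t)$ in which $\Phi\circ F=(A(s,t),B(s,t))$, with the same one of the two surfaces at all points. -/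

import Mathlib

open scoped Manifold ContDiff

noncomputable section

namespace NKSL2

/-! ### The nearly Kähler structure of `SL(2,ℝ) × SL(2,ℝ)`

Every tangent vector at `(A, B)` is `(Aα, Bβ)` for a unique pair `(α, β)` of trace-free matrices.
We always write it as this pair.  The structures `g`, `J`, `P` are left invariant, so in this
description they do not depend on the base point. -/

/-- Real `2 × 2` matrices. -/
abbrev Mat2 : Type := Matrix (Fin 2) (Fin 2) ℝ

/-- The group `SL(2,ℝ)`. -/
abbrev SL2 : Type := Matrix.SpecialLinearGroup (Fin 2) ℝ

/-- The six-dimensional ambient space. -/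
abbrev Ambient : Type := SL2 × SL2

/-- A pair `(α, β)`, standing for the tangent vector `(Aα, Bβ)` at `(A, B)`.  The tangent vectors
are the pairs of trace-free matrices. -/
abbrev Vec : Type := Mat2 × Mat2

/-- The coordinates of the surfaces. -/
abbrev Plane : Type := EuclideanSpace ℝ (Fin 2)

/-- The indefinite inner product `⟨a, b⟩ = -(a₁b₄ - a₂b₃ - a₃b₂ + a₄b₁)/2` on `2 × 2` matrices. -/
def matInner (a b : Mat2) : ℝ := -(1 / 2) * (a.adjugate * b).trace

theorem matInner_eq (a b : Mat2) :
    matInner a b = -(1 / 2) * (a 0 0 * b 1 1 - a 0 1 * b 1 0 - a 1 0 * b 0 1 + a 1 1 * b 0 0) := by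
  simp only [matInner, Matrix.adjugate_fin_two, Matrix.trace, Matrix.diag_apply, Matrix.mul_apply,
    Fin.sum_univ_two, Matrix.of_apply, Matrix.cons_val', Matrix.cons_val_zero, Matrix.cons_val_one,
    Matrix.cons_val_fin_one]
  ring

/-- The inner product is invariant under left multiplication by `SL(2,ℝ)`. -/
theorem matInner_left_mul (A : SL2) (a b : Mat2) :
    matInner ((A : Mat2) * a) ((A : Mat2) * b) = matInner a b := by
  have h : (A : Mat2).adjugate * (A : Mat2) = 1 := by
    rw [Matrix.adjugate_mul, A.det_coe, one_smul]
  simp only [matInner, Matrix.adjugate_mul_distrib]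
  rw [Matrix.mul_assoc, ← Matrix.mul_assoc _ (A : Mat2) b, h, Matrix.one_mul]

/-- The product `α × β = (αβ - βα)/2`. -/
def cross (a b : Mat2) : Mat2 := (1 / 2 : ℝ) • (a * b - b * a)

/-- The nearly Kähler metric `g`. -/
def nkMetric (X Y : Vec) : ℝ :=
  (2 / 3) * (matInner X.1 Y.1 + matInner X.2 Y.2)
    - (1 / 3) * (matInner X.2 Y.1 + matInner X.1 Y.2)

/-- The almost complex structure `J`. -/
def nkJ (X : Vec) : Vec :=
  ((1 / √3) • (X.1 - (2 : ℝ) • X.2), (1 / √3) • ((2 : ℝ) • X.1 - X.2))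

/-- The almost product structure `P`. -/
def nkP (X : Vec) : Vec := (X.2, X.1)

/-- The Levi-Civita connection of `g` on left invariant vector fields: `∇̃_X Y` for the left
invariant fields through `X` and `Y`. -/
def leviCivita (X Y : Vec) : Vec :=
  (cross X.1 Y.1 - (1 / 3 : ℝ) • cross X.1 Y.2 + (1 / 3 : ℝ) • cross X.2 Y.1,
    cross X.2 Y.2 + (1 / 3 : ℝ) • cross X.1 Y.2 - (1 / 3 : ℝ) • cross X.2 Y.1)

/-- The connection is torsion free: `∇̃_X Y - ∇̃_Y X = [X, Y]`. -/
theorem leviCivita_torsionFree (X Y : Vec) :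
    leviCivita X Y - leviCivita Y X = (X.1 * Y.1 - Y.1 * X.1, X.2 * Y.2 - Y.2 * X.2) := by
  ext i j <;> simp [leviCivita, cross] <;> ring

/-- The connection is metric. -/
theorem leviCivita_metric (X Y Z : Vec) :
    nkMetric (leviCivita X Y) Z + nkMetric Y (leviCivita X Z) = 0 := by
  simp only [nkMetric, leviCivita, cross, matInner_eq, Matrix.add_apply, Matrix.sub_apply,
    Matrix.smul_apply, Matrix.mul_apply, Fin.sum_univ_two, smul_eq_mul]
  ring

/-- The isometry `(p, q) ↦ (a p c, b q c)` of the nearly Kähler space. -/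
def translation (a b c : SL2) (x : Ambient) : Ambient := (a * x.1 * c, b * x.2 * c)

/-- The differential of `translation a b c` sends `(α, β)` to `(c⁻¹ α c, c⁻¹ β c)`; this
preserves `g`. -/
theorem nkMetric_conj (c : SL2) (X Y : Vec) :
    nkMetric (((c⁻¹ : SL2) : Mat2) * X.1 * (c : Mat2), ((c⁻¹ : SL2) : Mat2) * X.2 * (c : Mat2))
      (((c⁻¹ : SL2) : Mat2) * Y.1 * (c : Mat2), ((c⁻¹ : SL2) : Mat2) * Y.2 * (c : Mat2))
      = nkMetric X Y := by
  have h : (c : Mat2) * (c : Mat2).adjugate = 1 := by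
    rw [Matrix.mul_adjugate, c.det_coe, one_smul]
  have key : ∀ a b : Mat2, matInner (((c⁻¹ : SL2) : Mat2) * a * (c : Mat2))
      (((c⁻¹ : SL2) : Mat2) * b * (c : Mat2)) = matInner a b := by
    intro a b
    rw [Matrix.mul_assoc, Matrix.mul_assoc, matInner_left_mul]
    simp only [matInner, Matrix.adjugate_mul_distrib]
    rw [Matrix.trace_mul_comm, Matrix.mul_assoc, ← Matrix.mul_assoc (c : Mat2), h,
      Matrix.one_mul, Matrix.trace_mul_comm]
  simp only [nkMetric, key]

/-! ### Local geometry of a map from the coordinate plane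

Here `f` is a surface written in coordinates `u = (u₀, u₁)`. -/

section Local

/-- Partial derivative `∂ᵢ` of a function. -/
def pd (i : Fin 2) (φ : Plane → ℝ) (u : Plane) : ℝ :=
  fderiv ℝ φ u (EuclideanSpace.single i 1)

/-- Partial derivative `∂ᵢ` of a matrix-valued function, taken entrywise. -/
def pdMat (i : Fin 2) (φ : Plane → Mat2) (u : Plane) : Mat2 :=
  Matrix.of fun a b => pd i (fun w => φ w a b) u

/-- The coordinate tangent vector `∂ᵢ f = (A_i, B_i) = (Aα, Bβ)`, as the pair `(α, β)`. -/
def frame (f : Plane → Ambient) (i : Fin 2) (u : Plane) : Vec :=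
  ((((f u).1⁻¹ : SL2) : Mat2) * pdMat i (fun w => ((f w).1 : Mat2)) u,
    (((f u).2⁻¹ : SL2) : Mat2) * pdMat i (fun w => ((f w).2 : Mat2)) u)

/-- The tangent plane of the surface. -/
def tangentPlane (f : Plane → Ambient) (u : Plane) : Submodule ℝ Vec :=
  Submodule.span ℝ (Set.range fun i => frame f i u)

/-- The induced metric `g_ij`. -/
def inducedMetric (f : Plane → Ambient) (u : Plane) : Matrix (Fin 2) (Fin 2) ℝ :=
  Matrix.of fun i j => nkMetric (frame f i u) (frame f j u)

/-- The covariant derivative `∇̃_{∂ᵢ} ξ` in the ambient space of a vector field `ξ` along `f`. -/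
def covDeriv (f : Plane → Ambient) (i : Fin 2) (ξ : Plane → Vec) (u : Plane) : Vec :=
  (pdMat i (fun w => (ξ w).1) u, pdMat i (fun w => (ξ w).2) u)
    + leviCivita (frame f i u) (ξ u)

/-- The coefficients in the coordinate frame of the tangential part of `X`. -/
def tangentCoeff (f : Plane → Ambient) (u : Plane) (X : Vec) : Fin 2 → ℝ :=
  (inducedMetric f u)⁻¹.mulVec fun l => nkMetric X (frame f l u)

/-- The normal part of `X`. -/
def normalPart (f : Plane → Ambient) (u : Plane) (X : Vec) : Vec :=
  X - ∑ k, tangentCoeff f u X k • frame f k u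

/-- The coefficient of `∂ₖ` in `∇_{∂ᵢ} ∂ⱼ`, for the induced connection
`∇_X Y = (∇̃_X Y)^⊤`, the Levi-Civita connection of the induced metric. -/
def christoffel (f : Plane → Ambient) (i j k : Fin 2) (u : Plane) : ℝ :=
  tangentCoeff f u (covDeriv f i (frame f j) u) k

/-- The second fundamental form `h(∂ᵢ, ∂ⱼ) = (∇̃_{∂ᵢ} ∂ⱼ)^⊥`. -/
def secondForm (f : Plane → Ambient) (i j : Fin 2) (u : Plane) : Vec :=
  normalPart f u (covDeriv f i (frame f j) u)

/-- The covariant derivative of the second fundamental form,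
`(∇h)(∂ₖ, ∂ᵢ, ∂ⱼ) = ∇^⊥_{∂ₖ} (h(∂ᵢ, ∂ⱼ)) - h(∇_{∂ₖ} ∂ᵢ, ∂ⱼ) - h(∂ᵢ, ∇_{∂ₖ} ∂ⱼ)`. -/
def covDerivSecondForm (f : Plane → Ambient) (k i j : Fin 2) (u : Plane) : Vec :=
  normalPart f u (covDeriv f k (secondForm f i j) u)
    - ∑ l, christoffel f k i l u • secondForm f l j u
    - ∑ l, christoffel f k j l u • secondForm f i l u

/-- The coefficient of `∂ₘ` in `R(∂₀, ∂₁) ∂₁ = ∇_{∂₀} ∇_{∂₁} ∂₁ - ∇_{∂₁} ∇_{∂₀} ∂₁`. -/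
def curvatureCoeff (f : Plane → Ambient) (m : Fin 2) (u : Plane) : ℝ :=
  pd 0 (christoffel f 1 1 m) u - pd 1 (christoffel f 0 1 m) u
    + ∑ l, (christoffel f 1 1 l u * christoffel f 0 l m u
        - christoffel f 0 1 l u * christoffel f 1 l m u)

/-- The Gaussian curvature `K = g(R(∂₀, ∂₁) ∂₁, ∂₀) / (g₀₀ g₁₁ - g₀₁²)`. -/
def gaussCurvature (f : Plane → Ambient) (u : Plane) : ℝ :=
  (∑ m, curvatureCoeff f m u * inducedMetric f u m 0) / (inducedMetric f u).det

end Local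

/-! ### Surfaces

A surface is a map `F` from a two-dimensional manifold `M`.  All notions are tensorial, and are
expressed in every chart of the maximal atlas. -/

section Surface

variable {M : Type*} [TopologicalSpace M] [ChartedSpace (EuclideanSpace ℝ (Fin 2)) M]

/-- `Q` holds for the coordinate expression of `F` at every point of every chart. -/
def InCharts (F : M → Ambient) (Q : (Plane → Ambient) → Plane → Prop) : Prop :=
  ∀ e ∈ IsManifold.maximalAtlas (𝓡 2) ∞ M, ∀ u ∈ e.target, Q (F ∘ e.symm) u

/-- Almost complex surfaces: smooth, with nondegenerate induced metric (in particular immersed),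
and with `J`-invariant tangent planes. -/
structure IsAlmostComplexSurface (F : M → Ambient) : Prop where
  smooth₁ : ∀ i j, ContMDiff (𝓡 2) 𝓘(ℝ, ℝ) ∞ fun p => ((F p).1 : Mat2) i j
  smooth₂ : ∀ i j, ContMDiff (𝓡 2) 𝓘(ℝ, ℝ) ∞ fun p => ((F p).2 : Mat2) i j
  nondegenerate : InCharts F fun f u => (inducedMetric f u).det ≠ 0
  almostComplex : InCharts F fun f u => ∀ X ∈ tangentPlane f u, nkJ X ∈ tangentPlane f u

/-- The second fundamental form is parallel: `∇h = 0`. -/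
def HasParallelSecondForm (F : M → Ambient) : Prop :=
  InCharts F fun f u => ∀ k i j, covDerivSecondForm f k i j u = 0

/-- The surface is totally geodesic: `h = 0`. -/
def IsTotallyGeodesic (F : M → Ambient) : Prop :=
  InCharts F fun f u => ∀ i j, secondForm f i j u = 0

/-- The Gaussian curvature is the constant `K`. -/
def HasConstantCurvature (F : M → Ambient) (K : ℝ) : Prop :=
  InCharts F fun f u => gaussCurvature f u = K

/-- `P` maps the tangent planes into the normal spaces. -/
def PMapsTangentToNormal (F : M → Ambient) : Prop :=
  InCharts F fun f u => ∀ X ∈ tangentPlane f u, ∀ Y ∈ tangentPlane f u, nkMetric (nkP X) Y = 0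

/-- `P` preserves the tangent planes. -/
def PPreservesTangent (F : M → Ambient) : Prop :=
  InCharts F fun f u => ∀ X ∈ tangentPlane f u, nkP X ∈ tangentPlane f u

/-- `F` is congruent to (an open part of) the surface `E(s, t)`: one isometry
`(p, q) ↦ (a p c, b q c)` carries `F` to a map which is `E(s, t)` in suitable coordinates `(s, t)`
around each point of `M`. -/
def IsCongruentTo (F : M → Ambient) (E : ℝ → ℝ → Ambient) : Prop :=
  ∃ a b c : SL2, ∀ p : M, ∃ e ∈ IsManifold.maximalAtlas (𝓡 2) ∞ M, p ∈ e.source ∧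
    ∀ q ∈ e.source, translation a b c (F q) = E (e q 0) (e q 1)

end Surface

/-! ### The two flat examples -/

/-- `diag(eˣ, e⁻ˣ)`. -/
def hyperbolicElt (x : ℝ) : SL2 :=
  ⟨!![Real.exp x, 0; 0, Real.exp (-x)], by
    rw [Matrix.det_fin_two_of, ← Real.exp_add]; simp⟩

/-- The rotation matrix with rows `(cos x, sin x)` and `(-sin x, cos x)`. -/
def ellipticElt (x : ℝ) : SL2 :=
  ⟨!![Real.cos x, Real.sin x; -Real.sin x, Real.cos x], by
    rw [Matrix.det_fin_two_of]; linarith [Real.cos_sq_add_sin_sq x]⟩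

/-- The flat example with positive definite induced metric. -/
def positiveExample (s t : ℝ) : Ambient :=
  (hyperbolicElt ((1 / √2) * (√3 * s - t)), hyperbolicElt ((1 / √2) * (√3 * s + t)))

/-- The flat example with negative definite induced metric. -/
def negativeExample (s t : ℝ) : Ambient :=
  (ellipticElt ((1 / √2) * (√3 * s - t)), ellipticElt ((1 / √2) * (√3 * s + t)))

end NKSL2

end

/-! All structures are left invariant, so a surface is studied through its Maurer-Cartan form:
tangent vectors are pairs of trace-free matrices, and the ambient covariant derivative along the
surface is a coordinate derivative plus an algebraic bilinear term. The ambient curvature is then a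
polynomial expression in `g`, `J`, `P` (`ambientCurvature_eq`), and the Gauss, Codazzi and Ricci
equations follow from commuting covariant derivatives.

Put X = ∂₁, E = g(X,X), η = h(X,X). The tensor G = ∇̃J is skew with G(X,JX) = 0, so it vanishes on
`J`-invariant planes. Hence h is complex linear and is determined by η (`exists_coeff`);
nondegeneracy of the metric amounts to E ≠ 0.

If ∇h = 0, the Codazzi equation says that R(JX,X)X is tangent. Its only part that can leave the
tangent plane is a multiple of q PX - p JPX, where p = g(PX,X) and q = g(JPX,X). Applying q + pJ
shows that (p² + q²)PX is tangent: either p = q = 0 and `P` maps tangent to normal, or `P` preserves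
the tangent plane. The two alternatives exclude each other and both are open conditions, so
connectedness selects one (`inCharts_or`).

In the normal case, differentiating g(P·,·) = 0 shows that η is orthogonal to PX and JPX, whence
R(JX,X)η = -(E/3)Jη. With N = g(η,η), the Ricci equation becomes (2KE - 2N/E + E/3)Jη = 0, while the
Gauss equation reads KE² = -(4/3)E² - 2N. If η ≠ 0, eliminating N gives K = -5/9; if η = 0, then K =
-4/3. The gap between these two values makes h = 0 an open condition, so one alternative holds on
all of M.

In the tangent case the tangent plane is {(sα, tα)} for one non-null matrix α, and the Maurer-Cartan
equation forces the line ℝα to be constant (`lineProd_parallel`). Multiples of α commute, so the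
surface is flat and totally geodesic. Since ⟨α,α⟩ ≠ 0, α is conjugate to a multiple of diag(1,-1) or
of the rotation generator. Each factor of F then lies in a translate of the corresponding
one-parameter group, and the group parameters x, y yield the coordinates s, t. -/

open scoped Manifold ContDiff

noncomputable section

namespace NKSL2

attribute [local instance] Matrix.normedAddCommGroup Matrix.normedSpace

/-! ### Bilinearity of the structures -/

/-- `g` as a bilinear form. -/
def nkMetricB : Vec →ₗ[ℝ] Vec →ₗ[ℝ] ℝ :=
  LinearMap.mk₂ ℝ nkMetric
    (fun X Y Z => by simp [nkMetric, matInner_eq]; ring)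
    (fun c X Y => by simp [nkMetric, matInner_eq]; ring)
    (fun X Y Z => by simp [nkMetric, matInner_eq]; ring)
    (fun c X Y => by simp [nkMetric, matInner_eq]; ring)

/-- The connection on left invariant fields as a bilinear map. -/
def leviCivitaB : Vec →ₗ[ℝ] Vec →ₗ[ℝ] Vec :=
  LinearMap.mk₂ ℝ leviCivita
    (fun X Y Z => by ext i j <;> simp [leviCivita, cross, add_mul, mul_add] <;> ring)
    (fun c X Y => by ext i j <;> simp [leviCivita, cross] <;> ring)
    (fun X Y Z => by ext i j <;> simp [leviCivita, cross, add_mul, mul_add] <;> ring)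
    (fun c X Y => by ext i j <;> simp [leviCivita, cross] <;> ring)

/-- `J` as a linear map. -/
def nkJL : Vec →ₗ[ℝ] Vec where
  toFun := nkJ
  map_add' X Y := by ext i j <;> simp [nkJ] <;> ring
  map_smul' c X := by ext i j <;> simp [nkJ] <;> ring

/-- `P` as a linear map. -/
def nkPL : Vec →ₗ[ℝ] Vec where
  toFun := nkP
  map_add' _ _ := rfl
  map_smul' _ _ := rfl

theorem nkMetricB_apply (X Y : Vec) : nkMetricB X Y = nkMetric X Y := rfl
theorem leviCivitaB_apply (X Y : Vec) : leviCivitaB X Y = leviCivita X Y := rfl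
theorem nkJL_apply (X : Vec) : nkJL X = nkJ X := rfl
theorem nkPL_apply (X : Vec) : nkPL X = nkP X := rfl

theorem nkMetric_add_left (X Y Z : Vec) : nkMetric (X + Y) Z = nkMetric X Z + nkMetric Y Z :=
  nkMetricB.map_add₂ X Y Z
theorem nkMetric_add_right (X Y Z : Vec) : nkMetric X (Y + Z) = nkMetric X Y + nkMetric X Z :=
  (nkMetricB X).map_add Y Z
theorem nkMetric_sub_left (X Y Z : Vec) : nkMetric (X - Y) Z = nkMetric X Z - nkMetric Y Z :=
  nkMetricB.map_sub₂ X Y Z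
theorem nkMetric_sub_right (X Y Z : Vec) : nkMetric X (Y - Z) = nkMetric X Y - nkMetric X Z :=
  (nkMetricB X).map_sub Y Z
theorem nkMetric_smul_left (c : ℝ) (X Y : Vec) : nkMetric (c • X) Y = c * nkMetric X Y :=
  nkMetricB.map_smul₂ c X Y
theorem nkMetric_smul_right (c : ℝ) (X Y : Vec) : nkMetric X (c • Y) = c * nkMetric X Y :=
  (nkMetricB X).map_smul c Y
theorem nkMetric_zero_left (X : Vec) : nkMetric 0 X = 0 := nkMetricB.map_zero₂ X
theorem nkMetric_zero_right (X : Vec) : nkMetric X 0 = 0 := (nkMetricB X).map_zero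
theorem nkMetric_neg_left (X Y : Vec) : nkMetric (-X) Y = -nkMetric X Y := nkMetricB.map_neg₂ X Y
theorem nkMetric_neg_right (X Y : Vec) : nkMetric X (-Y) = -nkMetric X Y := (nkMetricB X).map_neg Y

theorem nkMetric_comm (X Y : Vec) : nkMetric X Y = nkMetric Y X := by
  simp only [nkMetric, matInner_eq]; ring

theorem nkJ_add (X Y : Vec) : nkJ (X + Y) = nkJ X + nkJ Y := nkJL.map_add X Y
theorem nkJ_sub (X Y : Vec) : nkJ (X - Y) = nkJ X - nkJ Y := nkJL.map_sub X Y
theorem nkJ_smul (c : ℝ) (X : Vec) : nkJ (c • X) = c • nkJ X := nkJL.map_smul c X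
theorem nkJ_zero : nkJ 0 = 0 := nkJL.map_zero
theorem nkJ_neg (X : Vec) : nkJ (-X) = -nkJ X := nkJL.map_neg X
theorem nkP_add (X Y : Vec) : nkP (X + Y) = nkP X + nkP Y := rfl
theorem nkP_smul (c : ℝ) (X : Vec) : nkP (c • X) = c • nkP X := rfl

theorem leviCivita_add_left (X Y Z : Vec) :
    leviCivita (X + Y) Z = leviCivita X Z + leviCivita Y Z := leviCivitaB.map_add₂ X Y Z
theorem leviCivita_sub_left (X Y Z : Vec) :
    leviCivita (X - Y) Z = leviCivita X Z - leviCivita Y Z := leviCivitaB.map_sub₂ X Y Z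
theorem leviCivita_add_right (X Y Z : Vec) :
    leviCivita X (Y + Z) = leviCivita X Y + leviCivita X Z := (leviCivitaB X).map_add Y Z
theorem leviCivita_smul_left (c : ℝ) (X Y : Vec) :
    leviCivita (c • X) Y = c • leviCivita X Y := leviCivitaB.map_smul₂ c X Y
theorem leviCivita_smul_right (c : ℝ) (X Y : Vec) :
    leviCivita X (c • Y) = c • leviCivita X Y := (leviCivitaB X).map_smul c Y

/-! ### Algebraic identities -/

theorem inv_sqrt_three_mul_self : (1 / √3 : ℝ) * (1 / √3) = 1 / 3 := by
  rw [div_mul_div_comm, Real.mul_self_sqrt (by norm_num)]; norm_num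

theorem nkJ_nkJ (X : Vec) : nkJ (nkJ X) = -X := by
  have h := inv_sqrt_three_mul_self
  ext i j <;> simp only [nkJ, Prod.fst_neg, Prod.snd_neg, Matrix.smul_apply, Matrix.sub_apply,
    Matrix.neg_apply, smul_eq_mul]
  · linear_combination (-3 * X.1 i j) * h
  · linear_combination (-3 * X.2 i j) * h

theorem nkMetric_nkJ_nkJ (X Y : Vec) : nkMetric (nkJ X) (nkJ Y) = nkMetric X Y := by
  have h := inv_sqrt_three_mul_self
  simp only [nkJ, nkMetric, matInner_eq, Matrix.smul_apply, Matrix.sub_apply, smul_eq_mul]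
  -- The constant 1/√3 enters only through its square, so the identity is polynomial once s² = 1/3
  -- is substituted.
  generalize (1 / √3 : ℝ) = s at *
  have h' : s ^ 2 = 1 / 3 := by rw [sq, h]
  ring_nf
  rw [h']
  ring

theorem nkMetric_nkJ_left (X Y : Vec) : nkMetric (nkJ X) Y = -nkMetric X (nkJ Y) := by
  rw [← nkMetric_nkJ_nkJ X (nkJ Y), nkJ_nkJ, nkMetric_neg_right, neg_neg]

theorem nkMetric_nkJ_self (X : Vec) : nkMetric X (nkJ X) = 0 := by
  have h := nkMetric_nkJ_left X X
  rw [nkMetric_comm] at h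
  linarith

theorem nkJ_nkP (X : Vec) : nkJ (nkP X) = -nkP (nkJ X) := by
  ext i j <;> simp [nkJ, nkP] <;> ring

theorem nkP_nkP (X : Vec) : nkP (nkP X) = X := rfl

theorem nkMetric_nkP_left (X Y : Vec) : nkMetric (nkP X) Y = nkMetric X (nkP Y) := by
  simp only [nkMetric, nkP]; ring

/-- The covariant derivative `G = ∇̃ J`. -/
def covJ (X Y : Vec) : Vec := leviCivita X (nkJ Y) - nkJ (leviCivita X Y)

/-- The covariant derivative of `P`. -/
def covP (X Y : Vec) : Vec := leviCivita X (nkP Y) - nkP (leviCivita X Y)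

theorem covJ_add_left (X Y Z : Vec) : covJ (X + Y) Z = covJ X Z + covJ Y Z := by
  simp only [covJ, leviCivita_add_left, nkJ_add]; abel
theorem covJ_add_right (X Y Z : Vec) : covJ X (Y + Z) = covJ X Y + covJ X Z := by
  simp only [covJ, leviCivita_add_right, nkJ_add]; abel
theorem covJ_smul_right (c : ℝ) (X Y : Vec) : covJ X (c • Y) = c • covJ X Y := by
  simp only [covJ, leviCivita_smul_right, nkJ_smul, smul_sub]

/-- This is the nearly Kähler condition; polarisation turns it into the skew-symmetry `covJ_swap`.
-/
theorem covJ_self (X : Vec) : covJ X X = 0 := by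
  ext i j <;> fin_cases i <;> fin_cases j <;>
    simp [covJ, leviCivita, nkJ, cross, Matrix.mul_apply, Fin.sum_univ_two] <;> ring

theorem covJ_swap (X Y : Vec) : covJ X Y = -covJ Y X := by
  have h := covJ_self (X + Y)
  rw [covJ_add_left, covJ_add_right, covJ_add_right, covJ_self, covJ_self, zero_add, add_zero] at h
  exact eq_neg_of_add_eq_zero_left h

theorem covJ_nkJ_right (X Y : Vec) : covJ X (nkJ Y) = -nkJ (covJ X Y) := by
  simp only [covJ, nkJ_nkJ, nkJ_sub]
  have : leviCivita X (-Y) = -leviCivita X Y := (leviCivitaB X).map_neg Y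
  rw [this]; abel

/-- Together with skew-symmetry this makes G vanish on every `J`-invariant plane, so that `J` is
parallel along tangent vectors of an almost complex surface. -/
theorem covJ_nkJ_self (X : Vec) : covJ X (nkJ X) = 0 := by
  rw [covJ_nkJ_right, covJ_self, nkJ_zero, neg_zero]

theorem nkMetric_covJ (X Y Z : Vec) : nkMetric (covJ X Y) Z = -nkMetric Y (covJ X Z) := by
  have h1 := leviCivita_metric X (nkJ Y) Z
  have h2 := leviCivita_metric X Y (nkJ Z)
  simp only [covJ, nkMetric_sub_left, nkMetric_sub_right]
  rw [nkMetric_nkJ_left Y] at h1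
  rw [nkMetric_nkJ_left]
  linarith

/-- Reduces ∇̃P to G, so that its tangential components die on an almost complex surface as soon as
G does. -/
theorem covP_eq (X Y : Vec) :
    covP X Y = (1 / 2 : ℝ) • nkJ (covJ X (nkP Y) + nkP (covJ X Y)) := by
  have h := inv_sqrt_three_mul_self
  ext i j <;> fin_cases i <;> fin_cases j <;>
    simp only [covP, covJ, leviCivita, nkJ, nkP, cross, Matrix.mul_apply, Fin.sum_univ_two,
      Prod.fst_sub, Prod.snd_sub, Prod.fst_add, Prod.snd_add, Prod.smul_fst, Prod.smul_snd,
      Matrix.smul_apply, Matrix.sub_apply, Matrix.add_apply, smul_eq_mul] <;>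
    generalize (1 / √3 : ℝ) = s at * <;>
    (have h' : s ^ 2 = 1 / 3 := by rw [sq, h]) <;>
    ring_nf <;> rw [h'] <;> ring

/-- The bracket of left invariant fields. -/
def bracket (X Y : Vec) : Vec := (X.1 * Y.1 - Y.1 * X.1, X.2 * Y.2 - Y.2 * X.2)

/-- The curvature tensor of the ambient space on left invariant fields. -/
def ambientCurvature (X Y Z : Vec) : Vec :=
  leviCivita X (leviCivita Y Z) - leviCivita Y (leviCivita X Z) - leviCivita (bracket X Y) Z

/-- Pairs of trace-free matrices. -/
def TraceFree (X : Vec) : Prop := X.1 1 1 = -X.1 0 0 ∧ X.2 1 1 = -X.2 0 0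

/-- Both sides are polynomials in the matrix entries; trace-freeness removes one entry from each
matrix and the rest is a comparison of coefficients. The closed form shows that `P` is the only
source of curvature terms leaving a `J`-invariant plane. -/
theorem ambientCurvature_eq {X Y Z : Vec} (hX : TraceFree X) (hY : TraceFree Y)
    (hZ : TraceFree Z) :
    ambientCurvature X Y Z =
      -(5 / 6 : ℝ) • (nkMetric Y Z • X - nkMetric X Z • Y)
      - (1 / 6 : ℝ) • (nkMetric (nkJ Y) Z • nkJ X - nkMetric (nkJ X) Z • nkJ Y
          - (2 * nkMetric (nkJ X) Y) • nkJ Z)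
      - (2 / 3 : ℝ) • (nkMetric (nkP Y) Z • nkP X - nkMetric (nkP X) Z • nkP Y
          + nkMetric (nkJ (nkP Y)) Z • nkJ (nkP X) - nkMetric (nkJ (nkP X)) Z • nkJ (nkP Y)) := by
  have h := inv_sqrt_three_mul_self
  obtain ⟨hX1, hX2⟩ := hX
  obtain ⟨hY1, hY2⟩ := hY
  obtain ⟨hZ1, hZ2⟩ := hZ
  ext i j <;> fin_cases i <;> fin_cases j <;>
    simp only [ambientCurvature, bracket, leviCivita, nkJ, nkP, cross, nkMetric, matInner_eq,
      Matrix.mul_apply, Fin.sum_univ_two, Fin.zero_eta, Fin.mk_one,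
      Prod.fst_sub, Prod.snd_sub, Prod.fst_add, Prod.snd_add, Prod.smul_fst, Prod.smul_snd,
      Matrix.smul_apply, Matrix.sub_apply, Matrix.add_apply, smul_eq_mul, hX1, hX2, hY1, hY2,
      hZ1, hZ2] <;>
    generalize (1 / √3 : ℝ) = s at * <;>
    (have h' : s ^ 2 = 1 / 3 := by rw [sq, h]) <;>
    ring_nf <;> rw [h'] <;> ring

/-! ### Differentiation of vector-valued functions of the coordinates -/

section Calculus

open Filter Topology

variable {V W Z : Type*} [NormedAddCommGroup V] [NormedSpace ℝ V]
  [NormedAddCommGroup W] [NormedSpace ℝ W] [NormedAddCommGroup Z] [NormedSpace ℝ Z]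

/-- The partial derivative of a vector-valued function. -/
def pdV (i : Fin 2) (φ : Plane → V) (u : Plane) : V :=
  fderiv ℝ φ u (EuclideanSpace.single i 1)

/-- Smoothness at a point. -/
abbrev Sm (φ : Plane → V) (u : Plane) : Prop := ContDiffAt ℝ ∞ φ u

theorem Sm.diff {φ : Plane → V} {u : Plane} (h : Sm φ u) : DifferentiableAt ℝ φ u :=
  ContDiffAt.differentiableAt h (by simp)

theorem Sm.pdV {φ : Plane → V} {u : Plane} (h : Sm φ u) (i : Fin 2) : Sm (pdV i φ) u :=
  ContDiffAt.clm_apply (h.fderiv_right (m := ∞) (by simp)) contDiffAt_const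

theorem Sm.congr {φ ψ : Plane → V} {u : Plane} (h : Sm φ u) (e : ψ =ᶠ[𝓝 u] φ) : Sm ψ u :=
  ContDiffAt.congr_of_eventuallyEq h e

theorem pdV_congr {φ ψ : Plane → V} {u : Plane} (i : Fin 2) (e : φ =ᶠ[𝓝 u] ψ) :
    pdV i φ u = pdV i ψ u := by
  simp only [pdV, e.fderiv_eq]

theorem pdV_const (i : Fin 2) (c : V) (u : Plane) : pdV i (fun _ => c) u = 0 := by
  simp [pdV]

theorem pdV_add {φ ψ : Plane → V} {u : Plane} (i : Fin 2) (hφ : Sm φ u) (hψ : Sm ψ u) :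
    pdV i (fun w => φ w + ψ w) u = pdV i φ u + pdV i ψ u := by
  simp only [pdV, fderiv_fun_add hφ.diff hψ.diff, add_apply]

theorem Sm.fsmul {φ : Plane → ℝ} {ξ : Plane → V} {u : Plane} (hφ : Sm φ u) (hξ : Sm ξ u) :
    Sm (fun w => φ w • ξ w) u := ContDiffAt.smul hφ hξ

theorem pdV_comm {φ : Plane → V} {u : Plane} (h : Sm φ u) (i j : Fin 2) :
    pdV i (pdV j φ) u = pdV j (pdV i φ) u := by
  have hs : IsSymmSndFDerivAt ℝ φ u :=
    ContDiffAt.isSymmSndFDerivAt h (by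
      rw [minSmoothness_of_isRCLikeNormedField]; exact WithTop.coe_le_coe.2 le_top)
  have hd : DifferentiableAt ℝ (fderiv ℝ φ) u :=
    (h.fderiv_right (m := ∞) (by simp)).differentiableAt (by simp)
  have key : ∀ k l : Fin 2, pdV k (pdV l φ) u
      = fderiv ℝ (fderiv ℝ φ) u (EuclideanSpace.single k 1) (EuclideanSpace.single l 1) := by
    intro k l
    unfold pdV
    rw [fderiv_clm_apply hd (differentiableAt_const _)]
    simp
  rw [key, key]
  exact hs _ _

theorem Sm.linear [FiniteDimensional ℝ V] (L : V →ₗ[ℝ] W) {φ : Plane → V} {u : Plane}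
    (h : Sm φ u) : Sm (fun w => L (φ w)) u :=
  (LinearMap.toContinuousLinearMap L).contDiff.contDiffAt.comp u h

theorem pdV_linear [FiniteDimensional ℝ V] (L : V →ₗ[ℝ] W) {φ : Plane → V} {u : Plane}
    (i : Fin 2) (h : Sm φ u) : pdV i (fun w => L (φ w)) u = L (pdV i φ u) := by
  have := ((LinearMap.toContinuousLinearMap L).hasFDerivAt.comp u h.diff.hasFDerivAt).fderiv
  change fderiv ℝ (⇑(LinearMap.toContinuousLinearMap L) ∘ φ) u _ = _
  rw [this]; rfl

variable [FiniteDimensional ℝ V] [FiniteDimensional ℝ W]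

theorem Sm.bilin (B : V →ₗ[ℝ] W →ₗ[ℝ] Z) {φ : Plane → V} {ψ : Plane → W} {u : Plane}
    (hφ : Sm φ u) (hψ : Sm ψ u) : Sm (fun w => B (φ w) (ψ w)) u :=
  ContDiffAt.clm_apply (B.toContinuousBilinearMap.contDiff.contDiffAt.comp u hφ) hψ

theorem pdV_bilin (B : V →ₗ[ℝ] W →ₗ[ℝ] Z) {φ : Plane → V} {ψ : Plane → W} {u : Plane}
    (i : Fin 2) (hφ : Sm φ u) (hψ : Sm ψ u) :
    pdV i (fun w => B (φ w) (ψ w)) u = B (pdV i φ u) (ψ u) + B (φ u) (pdV i ψ u) := by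
  have := (B.toContinuousBilinearMap.hasFDerivAt_of_bilinear
    hφ.diff.hasFDerivAt hψ.diff.hasFDerivAt).fderiv
  change fderiv ℝ (fun w => B.toContinuousBilinearMap (φ w) (ψ w)) u _ = _
  rw [this]
  simp [pdV, add_comm]

omit [FiniteDimensional ℝ V] in
theorem pdV_smul {φ : Plane → ℝ} {ξ : Plane → V} {u : Plane} (i : Fin 2)
    (hφ : Sm φ u) (hξ : Sm ξ u) :
    pdV i (fun w => φ w • ξ w) u = pdV i φ u • ξ u + φ u • pdV i ξ u := by
  simp [pdV, fderiv_fun_smul hφ.diff hξ.diff, add_comm]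

end Calculus

/-! ### Entrywise derivatives and the Maurer-Cartan form. -/

theorem pd_eq_pdV (i : Fin 2) (φ : Plane → ℝ) (u : Plane) : pd i φ u = pdV i φ u := rfl

/-- The entry of a matrix as a linear map. -/
def entryL (a b : Fin 2) : Mat2 →ₗ[ℝ] ℝ where
  toFun m := m a b
  map_add' _ _ := rfl
  map_smul' _ _ := rfl

/-- Smoothness matters: a non-differentiable map has Fréchet derivative zero by default, while some
of its entries may still have nonzero derivatives. -/
theorem pdMat_eq_pdV {φ : Plane → Mat2} {u : Plane} (i : Fin 2) (h : Sm φ u) :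
    pdMat i φ u = pdV i φ u := by
  ext a b
  exact pdV_linear (entryL a b) i h

theorem pdVec_eq_pdV {ξ : Plane → Vec} {u : Plane} (i : Fin 2) (h : Sm ξ u) :
    (pdMat i (fun w => (ξ w).1) u, pdMat i (fun w => (ξ w).2) u) = pdV i ξ u := by
  have h1 := pdV_linear (LinearMap.fst ℝ Mat2 Mat2) i h
  have h2 := pdV_linear (LinearMap.snd ℝ Mat2 Mat2) i h
  refine Prod.ext ?_ ?_
  · exact (pdMat_eq_pdV i (h.linear (LinearMap.fst ℝ Mat2 Mat2))).trans h1
  · exact (pdMat_eq_pdV i (h.linear (LinearMap.snd ℝ Mat2 Mat2))).trans h2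

/-- The adjugate as a linear map. -/
def adjL : Mat2 →ₗ[ℝ] Mat2 where
  toFun m := m.adjugate
  map_add' a b := by ext i j; fin_cases i <;> fin_cases j <;> simp [Matrix.adjugate_fin_two, add_comm]
  map_smul' c a := by ext i j; fin_cases i <;> fin_cases j <;> simp [Matrix.adjugate_fin_two]

theorem coe_inv_eq_adjL (A : SL2) : ((A⁻¹ : SL2) : Mat2) = adjL (A : Mat2) :=
  Matrix.SpecialLinearGroup.coe_inv A

theorem adjL_mul_coe (A : SL2) : adjL (A : Mat2) * (A : Mat2) = 1 := by
  change (A : Mat2).adjugate * _ = 1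
  rw [Matrix.adjugate_mul, A.det_coe, one_smul]

theorem coe_mul_adjL (A : SL2) : (A : Mat2) * adjL (A : Mat2) = 1 := by
  change _ * (A : Mat2).adjugate = 1
  rw [Matrix.mul_adjugate, A.det_coe, one_smul]

/-- Matrix multiplication as a bilinear map. -/
abbrev mulB : Mat2 →ₗ[ℝ] Mat2 →ₗ[ℝ] Mat2 := LinearMap.mul ℝ Mat2

/-- The Maurer-Cartan form of a curve of group elements. -/
def maurer (C : Plane → SL2) (i : Fin 2) (u : Plane) : Mat2 :=
  adjL (C u : Mat2) * pdV i (fun w => (C w : Mat2)) u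

section Maurer

variable {C : Plane → SL2} {u : Plane}

theorem Sm.maurer (h : Sm (fun w => (C w : Mat2)) u) (i : Fin 2) : Sm (maurer C i) u :=
  (h.linear adjL).bilin mulB (h.pdV i)

/-- On SL(2) the inverse is the adjugate, which is linear in the entries and hence smooth; the
formula comes from differentiating C⁻¹C = 1. -/
theorem pdV_adjL (h : Sm (fun w => (C w : Mat2)) u) (i : Fin 2) :
    pdV i (fun w => adjL (C w : Mat2)) u = -(maurer C i u * adjL (C u : Mat2)) := by
  have h1 := pdV_bilin mulB i (h.linear adjL) h
  simp only [LinearMap.mul_apply', adjL_mul_coe, pdV_const] at h1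
  have h2 := congrArg (· * adjL (C u : Mat2)) h1
  simp only [zero_mul, add_mul, mul_assoc, coe_mul_adjL, mul_one] at h2
  rw [maurer, mul_assoc]
  exact eq_neg_of_add_eq_zero_left h2.symm

/-- The Maurer-Cartan equation: the second derivatives of C are symmetric and cancel, leaving the
products that come from differentiating C⁻¹. -/
theorem maurer_structure (h : Sm (fun w => (C w : Mat2)) u) (i j : Fin 2) :
    pdV i (maurer C j) u - pdV j (maurer C i) u
      = maurer C j u * maurer C i u - maurer C i u * maurer C j u := by
  have key : ∀ k l, pdV k (maurer C l) u = -(maurer C k u * maurer C l u)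
      + adjL (C u : Mat2) * pdV k (pdV l fun w => (C w : Mat2)) u := by
    intro k l
    have := pdV_bilin mulB k (h.linear adjL) (h.pdV l)
    rw [pdV_adjL h] at this
    refine this.trans ?_
    simp [maurer, mul_assoc]
  rw [key, key, pdV_comm h i j]
  abel

/-- Differentiating det C = 1 gives tr(C⁻¹ ∂C) = 0. -/
theorem maurer_traceFree (h : Sm (fun w => (C w : Mat2)) u) (i : Fin 2) :
    maurer C i u 1 1 = -maurer C i u 0 0 := by
  have e : ∀ a b, Sm (fun w => (C w : Mat2) a b) u := fun a b => h.linear (entryL a b)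
  have hd : (fun w => (C w : Mat2) 0 0 * (C w : Mat2) 1 1 - (C w : Mat2) 0 1 * (C w : Mat2) 1 0)
      = fun _ => 1 := by
    funext w
    rw [← Matrix.det_fin_two, (C w).det_coe]
  have h1 := pdV_const i (1 : ℝ) u
  rw [← hd] at h1
  have hp : ∀ a b, pdV i (fun w => (C w : Mat2)) u a b = pdV i (fun w => (C w : Mat2) a b) u :=
    fun a b => (pdV_linear (entryL a b) i h).symm
  have m : ∀ a b c d, pdV i (fun w => (C w : Mat2) a b * (C w : Mat2) c d) u
      = pdV i (fun w => (C w : Mat2) a b) u * (C u : Mat2) c d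
        + (C u : Mat2) a b * pdV i (fun w => (C w : Mat2) c d) u := fun a b c d =>
    pdV_bilin (LinearMap.mul ℝ ℝ) i (e a b) (e c d)
  simp only [sub_eq_add_neg] at h1
  rw [pdV_add i ((e 0 0).mul (e 1 1)) ((e 0 1).mul (e 1 0)).neg, m] at h1
  have n : pdV i (fun w => -((C w : Mat2) 0 1 * (C w : Mat2) 1 0)) u
      = -pdV i (fun w => ((C w : Mat2) 0 1 * (C w : Mat2) 1 0)) u := by
    simp [pdV]
  rw [n, m] at h1
  simp only [maurer, Matrix.mul_apply, Fin.sum_univ_two, hp, adjL, LinearMap.coe_mk, AddHom.coe_mk,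
    Matrix.adjugate_fin_two, Matrix.of_apply, Matrix.cons_val', Matrix.cons_val_zero,
    Matrix.cons_val_one, Matrix.cons_val_fin_one]
  linarith

end Maurer

/-! ### The ambient connection along a surface -/

/-- Smoothness of a surface on an open part of the coordinate plane. -/
structure SmoothOn (f : Plane → Ambient) (U : Set Plane) : Prop where
  isOpen : IsOpen U
  fst : ∀ u ∈ U, Sm (fun w => ((f w).1 : Mat2)) u
  snd : ∀ u ∈ U, Sm (fun w => ((f w).2 : Mat2)) u

section Connection

open Filter Topology

variable {f : Plane → Ambient} {U : Set Plane} {u : Plane}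

namespace SmoothOn

theorem frame_eq (hf : SmoothOn f U) (hu : u ∈ U) (i : Fin 2) :
    frame f i u = (maurer (fun w => (f w).1) i u, maurer (fun w => (f w).2) i u) := by
  simp only [frame, coe_inv_eq_adjL, pdMat_eq_pdV i (hf.fst u hu), pdMat_eq_pdV i (hf.snd u hu)]
  rfl

theorem eventuallyEq (hf : SmoothOn f U) (hu : u ∈ U) {V : Type*} {φ ψ : Plane → V}
    (h : ∀ w ∈ U, φ w = ψ w) : φ =ᶠ[𝓝 u] ψ :=
  eventually_of_mem (hf.isOpen.mem_nhds hu) h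

theorem frame_eventuallyEq (hf : SmoothOn f U) (hu : u ∈ U) (i : Fin 2) : frame f i =ᶠ[𝓝 u]
    fun u => (maurer (fun w => (f w).1) i u, maurer (fun w => (f w).2) i u) :=
  hf.eventuallyEq hu fun _ hw => hf.frame_eq hw i

theorem frame_traceFree (hf : SmoothOn f U) (hu : u ∈ U) (i : Fin 2) :
    TraceFree (frame f i u) := by
  rw [hf.frame_eq hu]
  exact ⟨maurer_traceFree (hf.fst u hu) i, maurer_traceFree (hf.snd u hu) i⟩

theorem sm_frame (hf : SmoothOn f U) (hu : u ∈ U) (i : Fin 2) : Sm (frame f i) u :=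
  Sm.congr (ContDiffAt.prodMk ((hf.fst u hu).maurer i) ((hf.snd u hu).maurer i))
    (hf.frame_eventuallyEq hu i)

theorem pdV_frame (hf : SmoothOn f U) (hu : u ∈ U) (i j : Fin 2) :
    pdV i (frame f j) u
      = (pdV i (maurer (fun w => (f w).1) j) u, pdV i (maurer (fun w => (f w).2) j) u) := by
  have h1 := (hf.fst u hu).maurer j
  have h2 := (hf.snd u hu).maurer j
  rw [pdV_congr i (hf.frame_eventuallyEq hu j)]
  have h := ContDiffAt.prodMk h1 h2
  refine Prod.ext ?_ ?_
  · exact (pdV_linear (LinearMap.fst ℝ Mat2 Mat2) i h).symm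
  · exact (pdV_linear (LinearMap.snd ℝ Mat2 Mat2) i h).symm

theorem frame_structure (hf : SmoothOn f U) (hu : u ∈ U) (i j : Fin 2) :
    pdV i (frame f j) u - pdV j (frame f i) u = -bracket (frame f i u) (frame f j u) := by
  rw [hf.pdV_frame hu, hf.pdV_frame hu, hf.frame_eq hu, hf.frame_eq hu, Prod.mk_sub_mk,
    maurer_structure (hf.fst u hu), maurer_structure (hf.snd u hu)]
  simp [bracket]

end SmoothOn

theorem covDeriv_eq {ξ : Plane → Vec} (h : Sm ξ u) (i : Fin 2) :
    covDeriv f i ξ u = pdV i ξ u + leviCivita (frame f i u) (ξ u) := by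
  rw [covDeriv, pdVec_eq_pdV i h]

theorem covDeriv_congr {ξ ζ : Plane → Vec} (h : Sm ζ u) (e : ξ =ᶠ[𝓝 u] ζ) (i : Fin 2) :
    covDeriv f i ξ u = covDeriv f i ζ u := by
  rw [covDeriv_eq h, covDeriv_eq (h.congr e), pdV_congr i e, e.self_of_nhds]

theorem covDeriv_add {ξ ζ : Plane → Vec} (hξ : Sm ξ u) (hζ : Sm ζ u) (i : Fin 2) :
    covDeriv f i (fun w => ξ w + ζ w) u = covDeriv f i ξ u + covDeriv f i ζ u := by
  rw [covDeriv_eq hξ, covDeriv_eq hζ, covDeriv_eq (hξ.add hζ), pdV_add i hξ hζ,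
    leviCivita_add_right]
  abel

theorem covDeriv_smul {φ : Plane → ℝ} {ξ : Plane → Vec} (hφ : Sm φ u) (hξ : Sm ξ u) (i : Fin 2) :
    covDeriv f i (fun w => φ w • ξ w) u = pd i φ u • ξ u + φ u • covDeriv f i ξ u := by
  rw [covDeriv_eq hξ, covDeriv_eq (hφ.fsmul hξ), pdV_smul i hφ hξ, leviCivita_smul_right,
    pd_eq_pdV, smul_add, add_assoc]

theorem covDeriv_nkJ {ξ : Plane → Vec} (hξ : Sm ξ u) (i : Fin 2) :
    covDeriv f i (fun w => nkJ (ξ w)) u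
      = nkJ (covDeriv f i ξ u) + covJ (frame f i u) (ξ u) := by
  have h : Sm (fun w => nkJ (ξ w)) u := hξ.linear nkJL
  have e := pdV_linear nkJL i hξ
  simp only [nkJL_apply] at e
  rw [covDeriv_eq hξ, covDeriv_eq h, e, covJ, nkJ_add]
  abel

theorem covDeriv_nkP {ξ : Plane → Vec} (hξ : Sm ξ u) (i : Fin 2) :
    covDeriv f i (fun w => nkP (ξ w)) u
      = nkP (covDeriv f i ξ u) + covP (frame f i u) (ξ u) := by
  have h : Sm (fun w => nkP (ξ w)) u := hξ.linear nkPL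
  have e := pdV_linear nkPL i hξ
  simp only [nkPL_apply] at e
  rw [covDeriv_eq hξ, covDeriv_eq h, e, covP, nkP_add]
  abel

theorem pd_nkMetric {ξ ζ : Plane → Vec} (hξ : Sm ξ u) (hζ : Sm ζ u) (i : Fin 2) :
    pd i (fun w => nkMetric (ξ w) (ζ w)) u
      = nkMetric (covDeriv f i ξ u) (ζ u) + nkMetric (ξ u) (covDeriv f i ζ u) := by
  have e := pdV_bilin nkMetricB i hξ hζ
  simp only [nkMetricB_apply] at e
  have m := leviCivita_metric (frame f i u) (ξ u) (ζ u)
  rw [covDeriv_eq hξ, covDeriv_eq hζ, pd_eq_pdV, e, nkMetric_add_left, nkMetric_add_right]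
  linarith

namespace SmoothOn

theorem sm_covDeriv (hf : SmoothOn f U) {ξ : Plane → Vec} (hξ : ∀ w ∈ U, Sm ξ w) (hu : u ∈ U)
    (i : Fin 2) : Sm (covDeriv f i ξ) u :=
  Sm.congr (((hξ u hu).pdV i).add ((hf.sm_frame hu i).bilin leviCivitaB (hξ u hu)))
    (hf.eventuallyEq hu fun w hw => covDeriv_eq (hξ w hw) i)

/-- The Maurer-Cartan equation contributes minus the bracket and the torsion-free connection plus
the bracket. This gives the symmetry of h and of the Christoffel symbols. -/
theorem covDeriv_frame_comm (hf : SmoothOn f U) (hu : u ∈ U) (i j : Fin 2) :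
    covDeriv f i (frame f j) u = covDeriv f j (frame f i) u := by
  have h1 := hf.frame_structure hu i j
  have h2 := leviCivita_torsionFree (frame f i u) (frame f j u)
  rw [covDeriv_eq (hf.sm_frame hu j), covDeriv_eq (hf.sm_frame hu i), ← sub_eq_zero]
  change leviCivita (frame f i u) (frame f j u) - leviCivita (frame f j u) (frame f i u)
    = bracket _ _ at h2
  rw [add_sub_add_comm, h1, h2, neg_add_cancel]

/-- The curvature of the connection along the surface is the ambient curvature. -/
theorem covDeriv_covDeriv_sub (hf : SmoothOn f U) {ξ : Plane → Vec} (hξ : ∀ w ∈ U, Sm ξ w)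
    (hu : u ∈ U) (i j : Fin 2) :
    covDeriv f i (covDeriv f j ξ) u - covDeriv f j (covDeriv f i ξ) u
      = ambientCurvature (frame f i u) (frame f j u) (ξ u) := by
  have key : ∀ k l, covDeriv f k (covDeriv f l ξ) u = pdV k (pdV l ξ) u
      + leviCivita (pdV k (frame f l) u) (ξ u) + leviCivita (frame f l u) (pdV k ξ u)
      + leviCivita (frame f k u) (pdV l ξ u)
      + leviCivita (frame f k u) (leviCivita (frame f l u) (ξ u)) := by
    intro k l
    have s := (hf.sm_frame hu l).bilin leviCivitaB (hξ u hu)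
    have e := pdV_bilin leviCivitaB k (hf.sm_frame hu l) (hξ u hu)
    rw [covDeriv_eq (hf.sm_covDeriv hξ hu l),
      pdV_congr k (hf.eventuallyEq hu fun w hw => covDeriv_eq (hξ w hw) l),
      covDeriv_eq (hξ u hu)]
    simp only [leviCivitaB_apply] at e s
    rw [pdV_add k ((hξ u hu).pdV l) s, e, leviCivita_add_right]
    abel
  -- After antisymmetrisation the terms with first derivatives of ξ cancel, and the derivatives of
  -- the frame combine into the bracket term of the curvature.
  have h1 := hf.frame_structure hu i j
  have h2 : leviCivita (bracket (frame f i u) (frame f j u)) (ξ u)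
      = -(leviCivita (pdV i (frame f j) u) (ξ u) - leviCivita (pdV j (frame f i) u) (ξ u)) := by
    rw [← leviCivita_sub_left, h1]
    have := leviCivitaB.map_neg₂ (bracket (frame f i u) (frame f j u)) (ξ u)
    simp only [leviCivitaB_apply] at this
    rw [this, neg_neg]
  rw [key, key, ambientCurvature, h2, pdV_comm (hξ u hu) i j]
  abel

end SmoothOn

end Connection

/-! ### Tangential and normal parts -/

/-- A smooth surface with nondegenerate induced metric on an open part of the plane. -/
structure NondegenerateOn (f : Plane → Ambient) (U : Set Plane) : Prop extends SmoothOn f U where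
  nondegenerate : ∀ u ∈ U, (inducedMetric f u).det ≠ 0

section Projection

open Filter Topology

variable {f : Plane → Ambient} {U : Set Plane} {u : Plane}

/-- `tangentCoeff` as a linear map. -/
def tangentCoeffL (f : Plane → Ambient) (u : Plane) : Vec →ₗ[ℝ] Fin 2 → ℝ :=
  (inducedMetric f u)⁻¹.mulVecLin ∘ₗ LinearMap.pi fun l => nkMetricB.flip (frame f l u)

theorem tangentCoeffL_apply (X : Vec) : tangentCoeffL f u X = tangentCoeff f u X := rfl

/-- `normalPart` as a linear map. -/
def normalPartL (f : Plane → Ambient) (u : Plane) : Vec →ₗ[ℝ] Vec :=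
  LinearMap.id - ∑ k, (LinearMap.proj k ∘ₗ tangentCoeffL f u).smulRight (frame f k u)

theorem normalPartL_apply (X : Vec) : normalPartL f u X = normalPart f u X := by
  simp [normalPartL, normalPart, tangentCoeffL_apply]

theorem normalPart_add (X Y : Vec) :
    normalPart f u (X + Y) = normalPart f u X + normalPart f u Y := by
  simp only [← normalPartL_apply, map_add]

theorem normalPart_sub (X Y : Vec) :
    normalPart f u (X - Y) = normalPart f u X - normalPart f u Y := by
  simp only [← normalPartL_apply, map_sub]

theorem normalPart_smul (c : ℝ) (X : Vec) :
    normalPart f u (c • X) = c • normalPart f u X := by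
  simp only [← normalPartL_apply, map_smul]

theorem eq_tangent_add_normal (X : Vec) :
    X = tangentCoeff f u X 0 • frame f 0 u + tangentCoeff f u X 1 • frame f 1 u
      + normalPart f u X := by
  simp only [normalPart, Fin.sum_univ_two]; abel

theorem tangentCoeff_spec (hd : (inducedMetric f u).det ≠ 0) (X : Vec) (l : Fin 2) :
    tangentCoeff f u X 0 * nkMetric (frame f 0 u) (frame f l u)
      + tangentCoeff f u X 1 * nkMetric (frame f 1 u) (frame f l u)
      = nkMetric X (frame f l u) := by
  have h : (inducedMetric f u).mulVec (tangentCoeff f u X) = fun l => nkMetric X (frame f l u) := by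
    rw [tangentCoeff, Matrix.mulVec_mulVec, Matrix.mul_nonsing_inv _ (Ne.isUnit hd),
      Matrix.one_mulVec]
  have h' := congrFun h l
  simp only [Matrix.mulVec, dotProduct, inducedMetric, Matrix.of_apply, Fin.sum_univ_two] at h'
  rw [nkMetric_comm (frame f 0 u), nkMetric_comm (frame f 1 u), ← h']
  ring

theorem normalPart_orthogonal (hd : (inducedMetric f u).det ≠ 0) (X : Vec) (l : Fin 2) :
    nkMetric (normalPart f u X) (frame f l u) = 0 := by
  have h := tangentCoeff_spec hd X l
  simp only [normalPart, Fin.sum_univ_two, nkMetric_sub_left, nkMetric_add_left,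
    nkMetric_smul_left]
  linarith

theorem normalPart_of_orthogonal {X : Vec} (h : ∀ l, nkMetric X (frame f l u) = 0) :
    normalPart f u X = X := by
  have : (fun l => nkMetric X (frame f l u)) = 0 := funext h
  simp [normalPart, tangentCoeff, this]

theorem inducedMetric_det :
    (inducedMetric f u).det = nkMetric (frame f 0 u) (frame f 0 u)
      * nkMetric (frame f 1 u) (frame f 1 u)
      - nkMetric (frame f 0 u) (frame f 1 u) * nkMetric (frame f 0 u) (frame f 1 u) := by
  simp only [Matrix.det_fin_two, inducedMetric, Matrix.of_apply,
    nkMetric_comm (frame f 1 u) (frame f 0 u)]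

theorem normalPart_frame (hd : (inducedMetric f u).det ≠ 0) (k : Fin 2) :
    normalPart f u (frame f k u) = 0 := by
  have h0 := tangentCoeff_spec hd (frame f k u) 0
  have h1 := tangentCoeff_spec hd (frame f k u) 1
  rw [inducedMetric_det] at hd
  rw [nkMetric_comm (frame f 1 u) (frame f 0 u)] at h0
  simp only [normalPart, Fin.sum_univ_two]
  generalize tangentCoeff f u (frame f k u) 0 = c0 at *
  generalize tangentCoeff f u (frame f k u) 1 = c1 at *
  fin_cases k
  -- Cramer's rule for the system whose matrix is the Gram matrix of the frame.
  · have e0 : c0 = 1 := by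
      refine mul_right_cancel₀ hd ?_
      simp only [Fin.zero_eta] at h0 h1
      linear_combination nkMetric (frame f 1 u) (frame f 1 u) * h0
        - nkMetric (frame f 0 u) (frame f 1 u) * h1
    have e1 : c1 = 0 := by
      refine mul_right_cancel₀ hd ?_
      simp only [Fin.zero_eta] at h0 h1
      linear_combination nkMetric (frame f 0 u) (frame f 0 u) * h1
        - nkMetric (frame f 0 u) (frame f 1 u) * h0
    simp [e0, e1]
  · simp only [Fin.mk_one] at h0 h1
    rw [nkMetric_comm (frame f 1 u) (frame f 0 u)] at h0
    have e0 : c0 = 0 := by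
      refine mul_right_cancel₀ hd ?_
      linear_combination nkMetric (frame f 1 u) (frame f 1 u) * h0
        - nkMetric (frame f 0 u) (frame f 1 u) * h1
    have e1 : c1 = 1 := by
      refine mul_right_cancel₀ hd ?_
      linear_combination nkMetric (frame f 0 u) (frame f 0 u) * h1
        - nkMetric (frame f 0 u) (frame f 1 u) * h0
    simp [e0, e1]

theorem normalPart_eq_zero_iff (hd : (inducedMetric f u).det ≠ 0) {X : Vec} :
    normalPart f u X = 0 ↔ X ∈ tangentPlane f u := by
  constructor
  · intro h
    rw [eq_tangent_add_normal (f := f) (u := u) X, h, add_zero]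
    exact add_mem (Submodule.smul_mem _ _ (Submodule.subset_span ⟨0, rfl⟩))
      (Submodule.smul_mem _ _ (Submodule.subset_span ⟨1, rfl⟩))
  · intro h
    have : tangentPlane f u ≤ LinearMap.ker (normalPartL f u) := by
      rw [tangentPlane, Submodule.span_le]
      rintro _ ⟨i, rfl⟩
      simp [normalPartL_apply, normalPart_frame hd i]
    have := this h
    rwa [LinearMap.mem_ker, normalPartL_apply] at this

theorem normalPart_normalPart (hd : (inducedMetric f u).det ≠ 0) (X : Vec) :
    normalPart f u (normalPart f u X) = normalPart f u X :=
  normalPart_of_orthogonal (normalPart_orthogonal hd X)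

namespace NondegenerateOn

theorem sm_inducedMetric (hf : NondegenerateOn f U) (hu : u ∈ U) (i j : Fin 2) :
    Sm (fun w => nkMetric (frame f i w) (frame f j w)) u :=
  (hf.sm_frame hu i).bilin nkMetricB (hf.sm_frame hu j)

theorem sm_det (hf : NondegenerateOn f U) (hu : u ∈ U) :
    Sm (fun w => (inducedMetric f w).det) u := by
  simp only [inducedMetric_det]
  exact ((hf.sm_inducedMetric hu 0 0).mul (hf.sm_inducedMetric hu 1 1)).sub
    ((hf.sm_inducedMetric hu 0 1).mul (hf.sm_inducedMetric hu 0 1))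

theorem sm_tangentCoeff (hf : NondegenerateOn f U) {ξ : Plane → Vec} (hu : u ∈ U) (hξ : Sm ξ u)
    (k : Fin 2) : Sm (fun w => tangentCoeff f w (ξ w) k) u := by
  have hm : ∀ l, Sm (fun w => nkMetric (ξ w) (frame f l w)) u := fun l =>
    hξ.bilin nkMetricB (hf.sm_frame hu l)
  have hd : Sm (fun w => (inducedMetric f w).det⁻¹) u :=
    (hf.sm_det hu).inv (hf.nondegenerate u hu)
  have g := hf.sm_inducedMetric hu
  have hi : ∀ a b, Sm (fun w => (inducedMetric f w)⁻¹ a b) u := by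
    intro a b
    simp only [Matrix.inv_def, Ring.inverse_eq_inv', Matrix.smul_apply, smul_eq_mul]
    refine hd.mul ?_
    fin_cases a <;> fin_cases b <;>
      simp [Matrix.adjugate_fin_two, inducedMetric]
    · exact g 1 1
    · exact (g 0 1).neg
    · exact (g 1 0).neg
    · exact g 0 0
  simp only [tangentCoeff, Matrix.mulVec, dotProduct, Fin.sum_univ_two]
  exact ((hi k 0).mul (hm 0)).add ((hi k 1).mul (hm 1))

theorem sm_normalPart (hf : NondegenerateOn f U) {ξ : Plane → Vec} (hu : u ∈ U) (hξ : Sm ξ u) :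
    Sm (fun w => normalPart f w (ξ w)) u := by
  simp only [normalPart, Fin.sum_univ_two]
  exact hξ.sub (((hf.sm_tangentCoeff hu hξ 0).fsmul (hf.sm_frame hu 0)).add
    ((hf.sm_tangentCoeff hu hξ 1).fsmul (hf.sm_frame hu 1)))

theorem sm_christoffel (hf : NondegenerateOn f U) (hu : u ∈ U) (i j k : Fin 2) :
    Sm (christoffel f i j k) u :=
  hf.sm_tangentCoeff hu (hf.sm_covDeriv (fun _ hw => hf.sm_frame hw j) hu i) k

theorem sm_secondForm (hf : NondegenerateOn f U) (hu : u ∈ U) (i j : Fin 2) :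
    Sm (secondForm f i j) u :=
  hf.sm_normalPart hu (hf.sm_covDeriv (fun _ hw => hf.sm_frame hw j) hu i)

theorem secondForm_comm (hf : NondegenerateOn f U) (hu : u ∈ U) (i j : Fin 2) :
    secondForm f i j u = secondForm f j i u := by
  rw [secondForm, hf.covDeriv_frame_comm hu, secondForm]

theorem christoffel_comm (hf : NondegenerateOn f U) (hu : u ∈ U) (i j k : Fin 2) :
    christoffel f i j k u = christoffel f j i k u := by
  rw [christoffel, hf.covDeriv_frame_comm hu, christoffel]

theorem secondForm_orthogonal (hf : NondegenerateOn f U) (hu : u ∈ U) (i j l : Fin 2) :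
    nkMetric (secondForm f i j u) (frame f l u) = 0 :=
  normalPart_orthogonal (hf.nondegenerate u hu) _ l

theorem normalPart_secondForm (hf : NondegenerateOn f U) (hu : u ∈ U) (i j : Fin 2) :
    normalPart f u (secondForm f i j u) = secondForm f i j u :=
  normalPart_normalPart (hf.nondegenerate u hu) _

theorem gauss_formula (i j : Fin 2) :
    covDeriv f i (frame f j) u = christoffel f i j 0 u • frame f 0 u
      + christoffel f i j 1 u • frame f 1 u + secondForm f i j u :=
  eq_tangent_add_normal _

/-- Differentiation of `a ξ₀ + b ξ₁ + ζ`. -/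
theorem covDeriv_combination {a b : Plane → ℝ} {ξ₀ ξ₁ ζ : Plane → Vec} (ha : Sm a u) (hb : Sm b u)
    (h₀ : Sm ξ₀ u) (h₁ : Sm ξ₁ u) (hζ : Sm ζ u) (i : Fin 2) :
    covDeriv f i (fun w => a w • ξ₀ w + b w • ξ₁ w + ζ w) u
      = pd i a u • ξ₀ u + a u • covDeriv f i ξ₀ u + (pd i b u • ξ₁ u + b u • covDeriv f i ξ₁ u)
        + covDeriv f i ζ u := by
  rw [covDeriv_add ((ha.fsmul h₀).add (hb.fsmul h₁)) hζ, covDeriv_add (ha.fsmul h₀) (hb.fsmul h₁),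
    covDeriv_smul ha h₀, covDeriv_smul hb h₁]

theorem covDeriv_covDeriv_frame (hf : NondegenerateOn f U) (hu : u ∈ U) (k i j : Fin 2) :
    covDeriv f k (covDeriv f i (frame f j)) u
      = pd k (christoffel f i j 0) u • frame f 0 u
        + christoffel f i j 0 u • covDeriv f k (frame f 0) u
        + (pd k (christoffel f i j 1) u • frame f 1 u
        + christoffel f i j 1 u • covDeriv f k (frame f 1) u)
        + covDeriv f k (secondForm f i j) u := by
  have e : covDeriv f i (frame f j) = fun w => christoffel f i j 0 w • frame f 0 w
      + christoffel f i j 1 w • frame f 1 w + secondForm f i j w :=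
    funext fun w => gauss_formula i j
  rw [e, covDeriv_combination (hf.sm_christoffel hu i j 0) (hf.sm_christoffel hu i j 1)
    (hf.sm_frame hu 0) (hf.sm_frame hu 1) (hf.sm_secondForm hu i j)]

/-- The Gauss and Codazzi equations in one vector identity. -/
theorem ambientCurvature_frame (hf : NondegenerateOn f U) (hu : u ∈ U) :
    ambientCurvature (frame f 0 u) (frame f 1 u) (frame f 1 u)
      = curvatureCoeff f 0 u • frame f 0 u + curvatureCoeff f 1 u • frame f 1 u
        + (christoffel f 1 1 0 u • secondForm f 0 0 u + christoffel f 1 1 1 u • secondForm f 0 1 u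
          - christoffel f 0 1 0 u • secondForm f 0 1 u - christoffel f 0 1 1 u • secondForm f 1 1 u)
        + (covDeriv f 0 (secondForm f 1 1) u - covDeriv f 1 (secondForm f 0 1) u) := by
  rw [← hf.covDeriv_covDeriv_sub (fun w hw => hf.sm_frame hw 1) hu 0 1,
    hf.covDeriv_covDeriv_frame hu, hf.covDeriv_covDeriv_frame hu]
  simp only [gauss_formula (f := f) (u := u), curvatureCoeff, Fin.sum_univ_two,
    hf.secondForm_comm hu 1 0]
  module

/-- The Weingarten formula: differentiate g(h(∂ᵢ,∂ⱼ), ∂ₗ) = 0 and use that the connection is metric.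
-/
theorem nkMetric_covDeriv_secondForm (hf : NondegenerateOn f U) (hu : u ∈ U) (k i j l : Fin 2) :
    nkMetric (covDeriv f k (secondForm f i j) u) (frame f l u)
      = -nkMetric (secondForm f i j u) (secondForm f k l u) := by
  have h := pd_nkMetric (f := f) (hf.sm_secondForm hu i j) (hf.sm_frame hu l) k
  have z : pd k (fun w => nkMetric (secondForm f i j w) (frame f l w)) u = 0 := by
    rw [pd_eq_pdV, pdV_congr k (hf.eventuallyEq hu fun w hw => hf.secondForm_orthogonal hw i j l),
      pdV_const]
  rw [z, gauss_formula k l, nkMetric_add_right, nkMetric_add_right, nkMetric_smul_right,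
    nkMetric_smul_right, hf.secondForm_orthogonal hu, hf.secondForm_orthogonal hu] at h
  linarith

/-- The Gauss equation. -/
theorem gauss_equation (hf : NondegenerateOn f U) (hu : u ∈ U) (l : Fin 2) :
    curvatureCoeff f 0 u * nkMetric (frame f 0 u) (frame f l u)
      + curvatureCoeff f 1 u * nkMetric (frame f 1 u) (frame f l u)
      = nkMetric (ambientCurvature (frame f 0 u) (frame f 1 u) (frame f 1 u)) (frame f l u)
        + nkMetric (secondForm f 1 1 u) (secondForm f 0 l u)
        - nkMetric (secondForm f 0 1 u) (secondForm f 1 l u) := by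
  rw [hf.ambientCurvature_frame hu]
  simp only [nkMetric_add_left, nkMetric_sub_left, nkMetric_smul_left,
    hf.secondForm_orthogonal hu, hf.nkMetric_covDeriv_secondForm hu]
  ring

theorem gaussCurvature_mul_det (hf : NondegenerateOn f U) (hu : u ∈ U) :
    gaussCurvature f u * (inducedMetric f u).det
      = curvatureCoeff f 0 u * nkMetric (frame f 0 u) (frame f 0 u)
      + curvatureCoeff f 1 u * nkMetric (frame f 1 u) (frame f 0 u) := by
  rw [gaussCurvature, div_mul_cancel₀ _ (hf.nondegenerate u hu), Fin.sum_univ_two]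
  rfl

end NondegenerateOn

end Projection

/-! ### Surfaces with parallel second fundamental form -/

/-- A surface with parallel second fundamental form on an open part of the plane. -/
structure ParallelOn (f : Plane → Ambient) (U : Set Plane) : Prop extends
    NondegenerateOn f U where
  parallel : ∀ u ∈ U, ∀ k i j, covDerivSecondForm f k i j u = 0

namespace ParallelOn

variable {f : Plane → Ambient} {U : Set Plane} {u : Plane}

theorem normalPart_covDeriv_secondForm (hf : ParallelOn f U) (hu : u ∈ U) (k i j : Fin 2) :
    normalPart f u (covDeriv f k (secondForm f i j) u)
      = christoffel f k i 0 u • secondForm f 0 j u + christoffel f k i 1 u • secondForm f 1 j u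
        + (christoffel f k j 0 u • secondForm f i 0 u
          + christoffel f k j 1 u • secondForm f i 1 u) := by
  have h := hf.parallel u hu k i j
  simp only [covDerivSecondForm, Fin.sum_univ_two] at h
  rw [sub_sub, sub_eq_zero] at h
  exact h

/-- The Codazzi equation. -/
theorem codazzi (hf : ParallelOn f U) (hu : u ∈ U) :
    normalPart f u (ambientCurvature (frame f 0 u) (frame f 1 u) (frame f 1 u)) = 0 := by
  have hn := hf.nondegenerate u hu
  rw [hf.ambientCurvature_frame hu]
  -- Since ∇h = 0, the normal derivatives of h are Christoffel combinations of h, and these cancel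
  -- the remaining Christoffel terms.
  simp only [normalPart_add, normalPart_sub, normalPart_smul, normalPart_frame hn,
    hf.normalPart_secondForm hu, hf.normalPart_covDeriv_secondForm hu, hf.secondForm_comm hu 1 0,
    hf.christoffel_comm hu 1 0]
  module

/-- The tangential part of the derivative of `h(∂₁, ∂₁)`. -/
abbrev shapeCoeff (f : Plane → Ambient) (k l : Fin 2) (u : Plane) : ℝ :=
  tangentCoeff f u (covDeriv f k (secondForm f 1 1) u) l

/-- The trailing `+ 0` gives the right-hand side the nested shape to which `covDeriv_combination`
applies twice in the Ricci equation. -/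
theorem covDeriv_secondForm (hf : ParallelOn f U) (hu : u ∈ U) (k : Fin 2) :
    covDeriv f k (secondForm f 1 1) u
      = (2 * christoffel f k 1 0 u) • secondForm f 0 1 u
        + (2 * christoffel f k 1 1 u) • secondForm f 1 1 u
        + (shapeCoeff f k 0 u • frame f 0 u + shapeCoeff f k 1 u • frame f 1 u + 0) := by
  rw [eq_tangent_add_normal (f := f) (u := u) (covDeriv f k (secondForm f 1 1) u),
    hf.normalPart_covDeriv_secondForm hu, hf.secondForm_comm hu 1 0]
  module

/-- The Ricci equation, for `h(∂₁, ∂₁)`. -/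
theorem ricci (hf : ParallelOn f U) (hu : u ∈ U) :
    normalPart f u (ambientCurvature (frame f 0 u) (frame f 1 u) (secondForm f 1 1 u))
      = (2 * curvatureCoeff f 0 u) • secondForm f 0 1 u
        + (2 * curvatureCoeff f 1 u) • secondForm f 1 1 u
        + (shapeCoeff f 1 0 u • secondForm f 0 0 u + shapeCoeff f 1 1 u • secondForm f 0 1 u)
        - (shapeCoeff f 0 0 u • secondForm f 0 1 u + shapeCoeff f 0 1 u • secondForm f 1 1 u) := by
  have hn := hf.nondegenerate u hu
  -- Differentiate the expansion of the derivative of h(∂₁,∂₁) once more and project: frame vectors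
  -- survive only through their second fundamental form. Antisymmetrising in i and k then collects
  -- the derivatives of the Christoffel symbols into the intrinsic curvature.
  have key : ∀ i k, normalPart f u (covDeriv f i (covDeriv f k (secondForm f 1 1)) u)
      = (2 * pd i (christoffel f k 1 0) u) • secondForm f 0 1 u
        + (2 * christoffel f k 1 0 u) • normalPart f u (covDeriv f i (secondForm f 0 1) u)
        + ((2 * pd i (christoffel f k 1 1) u) • secondForm f 1 1 u
        + (2 * christoffel f k 1 1 u) • normalPart f u (covDeriv f i (secondForm f 1 1) u))
        + (shapeCoeff f k 0 u • secondForm f i 0 u + shapeCoeff f k 1 u • secondForm f i 1 u) := by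
    intro i k
    have two : ∀ l, Sm (fun w => 2 * christoffel f k 1 l w) u := fun l =>
      contDiffAt_const.mul (hf.sm_christoffel hu k 1 l)
    have pd_two : ∀ l, pd i (fun w => 2 * christoffel f k 1 l w) u
        = 2 * pd i (christoffel f k 1 l) u := by
      intro l
      have := pdV_smul i (φ := fun _ => (2 : ℝ)) contDiffAt_const (hf.sm_christoffel hu k 1 l)
      simpa [pdV_const, pd_eq_pdV] using this
    have sh : ∀ l, Sm (shapeCoeff f k l) u := fun l =>
      hf.sm_tangentCoeff hu (hf.sm_covDeriv (fun w hw => hf.sm_secondForm hw 1 1) hu k) l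
    have s0 : Sm (fun w => shapeCoeff f k 0 w • frame f 0 w + shapeCoeff f k 1 w • frame f 1 w
        + (0 : Vec)) u :=
      (((sh 0).fsmul (hf.sm_frame hu 0)).add ((sh 1).fsmul (hf.sm_frame hu 1))).add contDiffAt_const
    have st := (((two 0).fsmul (hf.sm_secondForm hu 0 1)).add
      ((two 1).fsmul (hf.sm_secondForm hu 1 1))).add s0
    rw [covDeriv_congr st (hf.eventuallyEq hu fun w hw => hf.covDeriv_secondForm hw k),
      NondegenerateOn.covDeriv_combination (two 0) (two 1) (hf.sm_secondForm hu 0 1)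
        (hf.sm_secondForm hu 1 1) s0,
      NondegenerateOn.covDeriv_combination (sh 0) (sh 1) (hf.sm_frame hu 0) (hf.sm_frame hu 1)
        contDiffAt_const, pd_two, pd_two]
    have z : normalPart f u (covDeriv f i (fun _ => (0 : Vec)) u) = 0 := by
      rw [covDeriv_eq contDiffAt_const, pdV_const, ← leviCivitaB_apply, map_zero, add_zero,
        ← normalPartL_apply, map_zero]
    have sf : ∀ l, normalPart f u (covDeriv f i (frame f l) u) = secondForm f i l u :=
      fun _ => rfl
    simp only [normalPart_add, normalPart_smul, normalPart_frame hn,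
      hf.normalPart_secondForm hu, z, sf]
    module
  rw [← hf.covDeriv_covDeriv_sub (fun w hw => hf.sm_secondForm hw 1 1) hu 0 1, normalPart_sub,
    key, key]
  simp only [hf.normalPart_covDeriv_secondForm hu, curvatureCoeff, Fin.sum_univ_two,
    hf.secondForm_comm hu 1 0, hf.christoffel_comm hu 1 0]
  module

theorem shapeCoeff_spec (hf : ParallelOn f U) (hu : u ∈ U) (k l : Fin 2) :
    shapeCoeff f k 0 u * nkMetric (frame f 0 u) (frame f l u)
      + shapeCoeff f k 1 u * nkMetric (frame f 1 u) (frame f l u)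
      = -nkMetric (secondForm f 1 1 u) (secondForm f k l u) := by
  rw [tangentCoeff_spec (hf.nondegenerate u hu), hf.nkMetric_covDeriv_secondForm hu]

end ParallelOn

/-! ### Trace-free vectors -/

theorem TraceFree.add {X Y : Vec} (hX : TraceFree X) (hY : TraceFree Y) : TraceFree (X + Y) := by
  obtain ⟨h1, h2⟩ := hX
  obtain ⟨h3, h4⟩ := hY
  constructor
  · simp only [Prod.fst_add, Matrix.add_apply, h1, h3]; ring
  · simp only [Prod.snd_add, Matrix.add_apply, h2, h4]; ring

theorem TraceFree.smul {X : Vec} (hX : TraceFree X) (c : ℝ) : TraceFree (c • X) := by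
  obtain ⟨h1, h2⟩ := hX
  constructor
  · simp only [Prod.smul_fst, Matrix.smul_apply, h1, smul_neg]
  · simp only [Prod.smul_snd, Matrix.smul_apply, h2, smul_neg]

theorem TraceFree.sub {X Y : Vec} (hX : TraceFree X) (hY : TraceFree Y) : TraceFree (X - Y) := by
  simpa [sub_eq_add_neg] using hX.add (hY.smul (-1))

theorem TraceFree.nkJ {X : Vec} (hX : TraceFree X) : TraceFree (nkJ X) := by
  obtain ⟨h1, h2⟩ := hX
  constructor <;> simp only [NKSL2.nkJ, Matrix.smul_apply, Matrix.sub_apply, h1, h2, smul_eq_mul] <;>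
    ring

theorem leviCivita_traceFree (X Y : Vec) : TraceFree (leviCivita X Y) := by
  constructor <;> simp [leviCivita, cross, Matrix.mul_apply, Fin.sum_univ_two] <;> ring

/-- The traces of the two components. -/
def traceL : Vec →ₗ[ℝ] ℝ × ℝ where
  toFun X := (X.1 0 0 + X.1 1 1, X.2 0 0 + X.2 1 1)
  map_add' X Y := by ext <;> simp <;> ring
  map_smul' c X := by ext <;> simp <;> ring

theorem traceFree_iff {X : Vec} : TraceFree X ↔ traceL X = 0 := by
  simp only [TraceFree, traceL, LinearMap.coe_mk, AddHom.coe_mk, Prod.ext_iff, Prod.fst_zero,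
    Prod.snd_zero]
  constructor
  · rintro ⟨h1, h2⟩; exact ⟨by linarith, by linarith⟩
  · rintro ⟨h1, h2⟩; exact ⟨by linarith, by linarith⟩

/-! ### Curvature operator of the complex line spanned by X and JX. -/

/-- Skew-symmetry in the first two slots. With ∂₀ = cJX + dX and X = ∂₁ it replaces R(∂₀,∂₁) by
cR(JX,X). -/
theorem ambientCurvature_combination (c d : ℝ) (X Y Z : Vec) :
    ambientCurvature (c • X + d • Y) Y Z = c • ambientCurvature X Y Z := by
  have h : bracket (c • X + d • Y) Y = c • bracket X Y := by
    ext i j <;> simp [bracket, add_mul, mul_add] <;> ring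
  simp only [ambientCurvature, h, leviCivita_add_left, leviCivita_add_right, leviCivita_smul_left,
    leviCivita_smul_right, smul_sub]
  abel

/-- `g(PX, X)`. -/
abbrev pCoeff (X : Vec) : ℝ := nkMetric (nkP X) X

/-- `g(JPX, X)`. -/
abbrev qCoeff (X : Vec) : ℝ := nkMetric (nkJ (nkP X)) X

theorem nkP_nkJ (X : Vec) : nkP (nkJ X) = -nkJ (nkP X) := by rw [nkJ_nkP, neg_neg]

/-- The metric and `J` terms of the curvature add up to -(5/6 + 3/6) = -4/3 and stay in the complex
line of X; only the `P` terms can leave it. -/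
theorem ambientCurvature_nkJ_self {X : Vec} (hX : TraceFree X) :
    ambientCurvature (nkJ X) X X = (-(4 / 3) * nkMetric X X) • nkJ X
      - (4 / 3 : ℝ) • (qCoeff X • nkP X - pCoeff X • nkJ (nkP X)) := by
  have h0 : nkMetric (nkJ X) X = 0 := by rw [nkMetric_comm, nkMetric_nkJ_self]
  rw [ambientCurvature_eq hX.nkJ hX hX]
  simp only [nkP_nkJ, nkJ_neg, nkJ_nkJ, nkMetric_neg_left, h0, neg_neg]
  module

theorem nkMetric_ambientCurvature_self {X : Vec} (hX : TraceFree X) :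
    nkMetric (ambientCurvature (nkJ X) X X) X = 0 := by
  rw [ambientCurvature_nkJ_self hX]
  have h0 : nkMetric (nkJ X) X = 0 := by rw [nkMetric_comm, nkMetric_nkJ_self]
  simp only [nkMetric_sub_left, nkMetric_smul_left, h0]
  ring

theorem nkMetric_ambientCurvature_nkJ {X : Vec} (hX : TraceFree X) :
    nkMetric (ambientCurvature (nkJ X) X X) (nkJ X)
      = -(4 / 3) * nkMetric X X ^ 2 + (4 / 3) * (pCoeff X ^ 2 + qCoeff X ^ 2) := by
  have h1 : nkMetric (nkP X) (nkJ X) = -qCoeff X := by rw [qCoeff, nkMetric_nkJ_left, neg_neg]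
  rw [ambientCurvature_nkJ_self hX]
  simp only [nkMetric_sub_left, nkMetric_smul_left, nkMetric_nkJ_nkJ, h1]
  ring

/-- All terms pair a vector with η and vanish, except the last `J` term; its factor 2/6 is the 1/3.
-/
theorem ambientCurvature_normal {X η : Vec} (hX : TraceFree X) (hη : TraceFree η)
    (h1 : nkMetric X η = 0) (h2 : nkMetric (nkJ X) η = 0) (h3 : nkMetric (nkP X) η = 0)
    (h4 : nkMetric (nkJ (nkP X)) η = 0) :
    ambientCurvature (nkJ X) X η = (-(1 / 3) * nkMetric X X) • nkJ η := by
  rw [ambientCurvature_eq hX.nkJ hX hη]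
  simp only [nkP_nkJ, nkJ_neg, nkJ_nkJ, nkMetric_neg_left, h1, h2, h3, h4]
  module

/-! ### Almost complex surfaces -/

/-- An almost complex surface on an open part of the plane. -/
structure AlmostComplexOn (f : Plane → Ambient) (U : Set Plane) : Prop extends
    NondegenerateOn f U where
  almostComplex : ∀ u ∈ U, ∀ X ∈ tangentPlane f u, nkJ X ∈ tangentPlane f u

/-- `P` maps the tangent plane to the normal space. -/
def PNormalAt (f : Plane → Ambient) (u : Plane) : Prop :=
  ∀ X ∈ tangentPlane f u, ∀ Y ∈ tangentPlane f u, nkMetric (nkP X) Y = 0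

/-- `P` preserves the tangent plane. -/
def PTangentAt (f : Plane → Ambient) (u : Plane) : Prop :=
  ∀ X ∈ tangentPlane f u, nkP X ∈ tangentPlane f u

section Pointwise

variable {f : Plane → Ambient} {U : Set Plane} {u : Plane}

theorem frame_mem (i : Fin 2) : frame f i u ∈ tangentPlane f u :=
  Submodule.subset_span ⟨i, rfl⟩

theorem mem_tangentPlane {X : Vec} :
    X ∈ tangentPlane f u ↔ ∃ a b : ℝ, X = a • frame f 0 u + b • frame f 1 u := by
  rw [tangentPlane, Submodule.mem_span_range_iff_exists_fun]
  simp only [Fin.sum_univ_two]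
  constructor
  · rintro ⟨c, hc⟩; exact ⟨c 0, c 1, hc.symm⟩
  · rintro ⟨a, b, h⟩; exact ⟨![a, b], by simp [h]⟩

namespace NondegenerateOn

theorem covDeriv_traceFree (hf : NondegenerateOn f U) {ξ : Plane → Vec} (hu : u ∈ U)
    (hξ : ∀ w ∈ U, Sm ξ w) (ht : ∀ w ∈ U, TraceFree (ξ w)) (i : Fin 2) :
    TraceFree (covDeriv f i ξ u) := by
  rw [covDeriv_eq (hξ u hu)]
  refine TraceFree.add ?_ (leviCivita_traceFree _ _)
  rw [traceFree_iff, ← pdV_linear traceL i (hξ u hu),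
    pdV_congr i (hf.eventuallyEq hu fun w hw => traceFree_iff.1 (ht w hw)), pdV_const]

theorem secondForm_traceFree (hf : NondegenerateOn f U) (hu : u ∈ U) (i j : Fin 2) :
    TraceFree (secondForm f i j u) := by
  have h := hf.covDeriv_traceFree hu (fun w hw => hf.sm_frame hw j)
    (fun w hw => hf.frame_traceFree hw j) i
  simp only [secondForm, normalPart, Fin.sum_univ_two]
  exact h.sub (((hf.frame_traceFree hu 0).smul _).add ((hf.frame_traceFree hu 1).smul _))

end NondegenerateOn

namespace AlmostComplexOn

/-- Expanding G(Y,JY) = 0 leaves a G(Y,X) = 0. -/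
theorem covJ_frame_aux {X Y : Vec} {a b : ℝ} (ha : a ≠ 0) (h : nkJ Y = a • X + b • Y) :
    covJ X Y = 0 := by
  have h1 := covJ_nkJ_self Y
  rw [h, covJ_add_right, covJ_smul_right, covJ_smul_right, covJ_self, smul_zero, add_zero,
    covJ_swap, smul_neg, neg_eq_zero, smul_eq_zero] at h1
  exact h1.resolve_left ha

theorem frame_one_ne_zero (hf : NondegenerateOn f U) (hu : u ∈ U) : frame f 1 u ≠ 0 := by
  intro h
  have := hf.nondegenerate u hu
  rw [inducedMetric_det, h] at this
  simp [nkMetric_zero_right] at this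

/-- The tangent plane is spanned by `∂₁` and `J ∂₁`, and `h` is `J`-linear. -/
theorem exists_coeff (hf : AlmostComplexOn f U) (hu : u ∈ U) : ∃ c d : ℝ, c ≠ 0 ∧
    frame f 0 u = c • nkJ (frame f 1 u) + d • frame f 1 u ∧
    secondForm f 0 1 u = c • nkJ (secondForm f 1 1 u) + d • secondForm f 1 1 u ∧
    secondForm f 0 0 u = c • nkJ (secondForm f 0 1 u) + d • secondForm f 0 1 u := by
  set a : Plane → ℝ := fun w => tangentCoeff f w (nkJ (frame f 1 w)) 0 with ha
  set b : Plane → ℝ := fun w => tangentCoeff f w (nkJ (frame f 1 w)) 1 with hb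
  have hn := hf.nondegenerate u hu
  have hab : ∀ w ∈ U, nkJ (frame f 1 w) = a w • frame f 0 w + b w • frame f 1 w + 0 := by
    intro w hw
    have h1 := hf.almostComplex w hw _ (frame_mem 1)
    rw [← normalPart_eq_zero_iff (hf.nondegenerate w hw)] at h1
    rw [← h1]
    exact eq_tangent_add_normal _
  have hJ : ∀ w ∈ U, Sm (fun w => nkJ (frame f 1 w)) w := fun w hw =>
    (hf.sm_frame hw 1).linear nkJL
  have sa : Sm a u := hf.sm_tangentCoeff hu (hJ u hu) 0
  have sb : Sm b u := hf.sm_tangentCoeff hu (hJ u hu) 1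
  -- Otherwise J∂₁ = b∂₁, and J² = -1 would give b² = -1.
  have ha0 : a u ≠ 0 := by
    intro h
    have h1 := hab u hu
    rw [h, zero_smul, zero_add, add_zero] at h1
    have h2 := congrArg nkJ h1
    rw [nkJ_nkJ, nkJ_smul, h1, smul_smul] at h2
    have h3 : (1 + b u * b u) • frame f 1 u = 0 := by
      rw [add_smul, ← h2, one_smul, add_neg_cancel]
    rcases smul_eq_zero.1 h3 with h4 | h4
    · nlinarith
    · exact frame_one_ne_zero hf.toNondegenerateOn hu h4
  have hcov : ∀ i, covJ (frame f i u) (frame f 1 u) = 0 := by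
    intro i
    fin_cases i
    · exact covJ_frame_aux ha0 ((hab u hu).trans (add_zero _))
    · exact covJ_self _
  -- Differentiate J∂₁ = a∂₀ + b∂₁ and take normal parts. The term G(∂ᵢ,∂₁) vanishes and `J`
  -- respects the tangent and normal spaces, which yields the complex linearity of h.
  have hrel : ∀ i, a u • secondForm f i 0 u + b u • secondForm f i 1 u
      = nkJ (secondForm f i 1 u) := by
    intro i
    have s0 : Sm (fun w => a w • frame f 0 w + b w • frame f 1 w + (0 : Vec)) u :=
      ((sa.fsmul (hf.sm_frame hu 0)).add (sb.fsmul (hf.sm_frame hu 1))).add contDiffAt_const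
    have h1 := covDeriv_congr (f := f) s0 (hf.eventuallyEq hu hab) i
    have z : covDeriv f i (fun _ => (0 : Vec)) u = 0 := by
      rw [covDeriv_eq contDiffAt_const, pdV_const, ← leviCivitaB_apply, map_zero, add_zero]
    rw [covDeriv_nkJ (hf.sm_frame hu 1), hcov, add_zero,
      NondegenerateOn.covDeriv_combination sa sb (hf.sm_frame hu 0) (hf.sm_frame hu 1)
        contDiffAt_const, z, NondegenerateOn.gauss_formula i 1] at h1
    have h2 := congrArg (normalPart f u) h1
    have hJt : ∀ k, normalPart f u (nkJ (frame f k u)) = 0 := fun k =>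
      (normalPart_eq_zero_iff hn).2 (hf.almostComplex u hu _ (frame_mem k))
    have hJn : normalPart f u (nkJ (secondForm f i 1 u)) = nkJ (secondForm f i 1 u) := by
      refine normalPart_of_orthogonal fun l => ?_
      obtain ⟨x, y, hxy⟩ := mem_tangentPlane.1 (hf.almostComplex u hu _ (frame_mem l))
      rw [nkMetric_nkJ_left, hxy, nkMetric_add_right, nkMetric_smul_right, nkMetric_smul_right,
        hf.secondForm_orthogonal hu, hf.secondForm_orthogonal hu]
      ring
    simp only [nkJ_add, nkJ_smul, normalPart_add, normalPart_smul, hJt, hJn,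
      normalPart_frame hn, smul_zero, add_zero, zero_add] at h2
    rw [h2, hf.normalPart_secondForm hu]
    rfl
  refine ⟨(a u)⁻¹, -((a u)⁻¹ * b u), inv_ne_zero ha0, ?_, ?_, ?_⟩
  · rw [hab u hu, add_zero, smul_add, smul_smul, inv_mul_cancel₀ ha0, smul_smul, neg_smul]
    module
  · rw [← hrel 1, hf.secondForm_comm hu 1 0, smul_add, smul_smul, inv_mul_cancel₀ ha0, smul_smul,
      neg_smul]
    module
  · rw [← hrel 0, smul_add, smul_smul, inv_mul_cancel₀ ha0, smul_smul, neg_smul]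
    module

end AlmostComplexOn
end Pointwise

/-! ### The pointwise dichotomy -/

section Dichotomy

open Filter Topology

variable {f : Plane → Ambient} {U : Set Plane} {u : Plane}

namespace AlmostComplexOn

/-- In the basis JX, X the Gram determinant is c²E², so a null ∂₁ would make the metric degenerate.
-/
theorem tangentCoeff_frame_ne_zero (hf : AlmostComplexOn f U) (hu : u ∈ U) :
    nkMetric (frame f 1 u) (frame f 1 u) ≠ 0 := by
  obtain ⟨c, d, hc, hX, -, -⟩ := hf.exists_coeff hu
  have hn := hf.nondegenerate u hu
  intro h
  rw [inducedMetric_det, hX] at hn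
  apply hn
  have h0 := nkMetric_nkJ_self (frame f 1 u)
  simp only [nkMetric_add_left, nkMetric_smul_left, h, nkMetric_comm (nkJ _) (frame f 1 u), h0]
  ring

/-- Since `P` anticommutes with `J`, its effect on ∂₁ decides its effect on the whole complex line.
-/
theorem pTangentAt_iff (hf : AlmostComplexOn f U) (hu : u ∈ U) :
    PTangentAt f u ↔ normalPart f u (nkP (frame f 1 u)) = 0 := by
  rw [normalPart_eq_zero_iff (hf.nondegenerate u hu)]
  refine ⟨fun h => h _ (frame_mem 1), fun h X hX => ?_⟩
  obtain ⟨c, d, hc, hX0, -, -⟩ := hf.exists_coeff hu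
  obtain ⟨a, b, rfl⟩ := mem_tangentPlane.1 hX
  have h1 : nkP (nkJ (frame f 1 u)) ∈ tangentPlane f u := by
    rw [nkP_nkJ]; exact neg_mem (hf.almostComplex u hu _ h)
  rw [hX0, nkP_add, nkP_smul, nkP_smul, nkP_add, nkP_smul, nkP_smul]
  exact add_mem (Submodule.smul_mem _ _ (add_mem (Submodule.smul_mem _ _ h1)
    (Submodule.smul_mem _ _ h))) (Submodule.smul_mem _ _ h)

theorem pNormalAt_of_coeff (hf : AlmostComplexOn f U) (hu : u ∈ U)
    (hp : pCoeff (frame f 1 u) = 0) (hq : qCoeff (frame f 1 u) = 0) : PNormalAt f u := by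
  obtain ⟨c, d, hc, hX0, -, -⟩ := hf.exists_coeff hu
  have h1 : nkMetric (nkP (frame f 1 u)) (nkJ (frame f 1 u)) = 0 := by
    have := nkMetric_nkJ_left (nkP (frame f 1 u)) (frame f 1 u)
    rw [show nkMetric (nkJ (nkP (frame f 1 u))) (frame f 1 u) = 0 from hq] at this
    linarith
  have hp' : nkMetric (nkP (frame f 1 u)) (frame f 1 u) = 0 := hp
  have hq' : nkMetric (nkJ (nkP (frame f 1 u))) (frame f 1 u) = 0 := hq
  intro X hX Y hY
  obtain ⟨a, b, rfl⟩ := mem_tangentPlane.1 hX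
  obtain ⟨a', b', rfl⟩ := mem_tangentPlane.1 hY
  simp only [hX0, nkP_add, nkP_smul, nkP_nkJ, nkMetric_add_left, nkMetric_add_right,
    nkMetric_smul_left, nkMetric_smul_right, nkMetric_neg_left, nkMetric_nkJ_nkJ, hp', hq', h1]
  ring

/-- P∂₁ would be both tangent and normal, hence zero, although P² = 1. -/
theorem not_pNormalAt_and_pTangentAt (hf : AlmostComplexOn f U) (hu : u ∈ U)
    (h1 : PNormalAt f u) (h2 : PTangentAt f u) : False := by
  have hn := hf.nondegenerate u hu
  have h3 := h2 _ (frame_mem 1)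
  have h4 := normalPart_of_orthogonal (f := f) (u := u) (X := nkP (frame f 1 u))
    fun l => h1 _ (frame_mem 1) _ (frame_mem l)
  rw [(normalPart_eq_zero_iff hn).2 h3] at h4
  apply frame_one_ne_zero hf.toNondegenerateOn hu
  rw [← nkP_nkP (frame f 1 u), ← h4]; rfl

/-- The Gauss equation of an almost complex surface. -/
theorem gaussCurvature_eq (hf : AlmostComplexOn f U) (hu : u ∈ U) :
    gaussCurvature f u * nkMetric (frame f 1 u) (frame f 1 u) ^ 2
      = -(4 / 3) * nkMetric (frame f 1 u) (frame f 1 u) ^ 2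
        + (4 / 3) * (pCoeff (frame f 1 u) ^ 2 + qCoeff (frame f 1 u) ^ 2)
        - 2 * nkMetric (secondForm f 1 1 u) (secondForm f 1 1 u) := by
  obtain ⟨c, d, hc, hX, h01, h00⟩ := hf.exists_coeff hu
  have ht := hf.frame_traceFree hu 1
  have h1 := hf.gaussCurvature_mul_det hu
  rw [hf.gauss_equation hu 0, hf.secondForm_comm hu 1 0, inducedMetric_det, h00, h01, hX, ambientCurvature_combination] at h1
  have z := nkMetric_nkJ_self (frame f 1 u)
  have y := nkMetric_nkJ_self (secondForm f 1 1 u)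
  simp only [nkMetric_smul_left, nkMetric_add_right, nkMetric_add_left, nkMetric_smul_right,
    nkMetric_ambientCurvature_self ht, nkMetric_ambientCurvature_nkJ ht, nkMetric_nkJ_nkJ,
    nkJ_add, nkJ_smul, nkJ_nkJ, nkMetric_neg_right,
    nkMetric_comm (nkJ (frame f 1 u)) (frame f 1 u),
    nkMetric_comm (nkJ (secondForm f 1 1 u)) (secondForm f 1 1 u), z, y] at h1
  refine mul_left_cancel₀ (pow_ne_zero 2 hc) ?_
  linear_combination h1

/-- If the second fundamental form is parallel, `P` maps the tangent plane to the normal space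
or preserves it. -/
theorem pNormalAt_or_pTangentAt (hf : AlmostComplexOn f U) (hp : ParallelOn f U) (hu : u ∈ U) :
    PNormalAt f u ∨ PTangentAt f u := by
  obtain ⟨c, d, hc, hX, -, -⟩ := hf.exists_coeff hu
  have hn := hf.nondegenerate u hu
  have h1 := hp.codazzi hu
  rw [hX, ambientCurvature_combination, normalPart_smul, smul_eq_zero] at h1
  have h2 := h1.resolve_left hc
  rw [ambientCurvature_nkJ_self (hf.frame_traceFree hu 1), normalPart_sub, normalPart_smul,
    normalPart_smul, (normalPart_eq_zero_iff hn).2 (hf.almostComplex u hu _ (frame_mem 1)),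
    smul_zero, zero_sub, neg_eq_zero, smul_eq_zero] at h2
  have h3 := (normalPart_eq_zero_iff hn).1 (h2.resolve_left (by norm_num))
  set p := pCoeff (frame f 1 u) with hp
  set q := qCoeff (frame f 1 u) with hq
  by_cases hpq : q ^ 2 + p ^ 2 = 0
  · left
    exact hf.pNormalAt_of_coeff hu (by nlinarith) (by nlinarith)
  · right
    rw [hf.pTangentAt_iff hu, normalPart_eq_zero_iff hn]
    -- Applying q + pJ, which preserves the tangent plane, turns q PX - p JPX into (q² + p²)PX.
    have h4 : q • (q • nkP (frame f 1 u) - p • nkJ (nkP (frame f 1 u)))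
        + p • nkJ (q • nkP (frame f 1 u) - p • nkJ (nkP (frame f 1 u))) ∈ tangentPlane f u :=
      add_mem (Submodule.smul_mem _ _ h3)
        (Submodule.smul_mem _ _ (hf.almostComplex u hu _ h3))
    have h5 : q • (q • nkP (frame f 1 u) - p • nkJ (nkP (frame f 1 u)))
        + p • nkJ (q • nkP (frame f 1 u) - p • nkJ (nkP (frame f 1 u)))
        = (q ^ 2 + p ^ 2) • nkP (frame f 1 u) := by
      rw [nkJ_sub, nkJ_smul, nkJ_smul, nkJ_nkJ]
      module
    rw [h5] at h4
    exact (Submodule.smul_mem_iff _ hpq).1 h4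

/-- By the dichotomy, this alternative means that the normal part of P∂₁ is nonzero, an open
condition. -/
theorem eventually_pNormalAt (hf : AlmostComplexOn f U) (hp : ParallelOn f U) (hu : u ∈ U)
    (h : PNormalAt f u) : ∀ᶠ w in 𝓝 u, PNormalAt f w := by
  have h1 : normalPart f u (nkP (frame f 1 u)) ≠ 0 := fun h2 =>
    hf.not_pNormalAt_and_pTangentAt hu h ((hf.pTangentAt_iff hu).2 h2)
  have s : Sm (fun w => normalPart f w (nkP (frame f 1 w))) u :=
    hf.sm_normalPart hu ((hf.sm_frame hu 1).linear nkPL)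
  filter_upwards [s.continuousAt.eventually_ne h1, hf.isOpen.mem_nhds hu] with w h2 hw
  exact (hf.pNormalAt_or_pTangentAt hp hw).resolve_right fun h3 =>
    h2 ((hf.pTangentAt_iff hw).1 h3)

/-- By the dichotomy, this alternative means that (p, q) ≠ (0, 0), again an open condition. -/
theorem eventually_pTangentAt (hf : AlmostComplexOn f U) (hp : ParallelOn f U) (hu : u ∈ U)
    (h : PTangentAt f u) : ∀ᶠ w in 𝓝 u, PTangentAt f w := by
  have s0 := hf.sm_frame hu 1
  have s1 : Sm (fun w => pCoeff (frame f 1 w)) u := (s0.linear nkPL).bilin nkMetricB s0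
  have s2 : Sm (fun w => qCoeff (frame f 1 w)) u :=
    ((s0.linear nkPL).linear nkJL).bilin nkMetricB s0
  have s : Sm (fun w => (pCoeff (frame f 1 w), qCoeff (frame f 1 w))) u := s1.prodMk s2
  have h1 : (pCoeff (frame f 1 u), qCoeff (frame f 1 u)) ≠ 0 := by
    intro h2
    rw [Prod.ext_iff] at h2
    exact hf.not_pNormalAt_and_pTangentAt hu (hf.pNormalAt_of_coeff hu h2.1 h2.2) h
  filter_upwards [s.continuousAt.eventually_ne h1, hf.isOpen.mem_nhds hu] with w h2 hw
  refine (hf.pNormalAt_or_pTangentAt hp hw).resolve_left fun h3 => h2 ?_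
  exact Prod.ext (h3 _ (frame_mem 1) _ (frame_mem 1)) (by
    rw [qCoeff, nkMetric_nkJ_left, h3 _ (frame_mem 1) _ (hf.almostComplex w hw _ (frame_mem 1))]
    exact neg_zero)

/-! ### The case in which `P` maps the tangent planes to the normal spaces -/

theorem covJ_tangent (hf : AlmostComplexOn f U) (hu : u ∈ U) (i j : Fin 2) :
    covJ (frame f i u) (frame f j u) = 0 := by
  obtain ⟨c, d, hc, hX, -, -⟩ := hf.exists_coeff hu
  have h : covJ (frame f 0 u) (frame f 1 u) = 0 := by
    rw [hX, covJ_swap, covJ_add_right, covJ_smul_right, covJ_smul_right, covJ_nkJ_self, covJ_self]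
    simp
  fin_cases i <;> fin_cases j
  · exact covJ_self _
  · exact h
  · rw [covJ_swap, neg_eq_zero]; exact h
  · exact covJ_self _

theorem nkMetric_covP_tangent (hf : AlmostComplexOn f U) (hu : u ∈ U) (i j k : Fin 2) :
    nkMetric (covP (frame f i u) (frame f j u)) (frame f k u) = 0 := by
  rw [covP_eq, hf.covJ_tangent hu, nkMetric_smul_left, nkMetric_nkJ_left]
  have : nkP 0 = 0 := rfl
  rw [this, add_zero, nkMetric_covJ, covJ_nkJ_right, hf.covJ_tangent hu, nkJ_zero, neg_zero,
    nkMetric_zero_right]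
  simp

/-- Differentiate g(P∂ⱼ,∂ₖ) = 0; the ∇̃P term has no tangential part. Being also symmetric in i and
j, the form g(h(∂ᵢ,∂ⱼ), P∂ₖ) has to vanish. -/
theorem secondForm_nkP_skew (hf : AlmostComplexOn f U) (hP : ∀ w ∈ U, PNormalAt f w) (hu : u ∈ U)
    (i j k : Fin 2) : nkMetric (secondForm f i j u) (nkP (frame f k u))
      + nkMetric (secondForm f i k u) (nkP (frame f j u)) = 0 := by
  have z : pd i (fun w => nkMetric (nkP (frame f j w)) (frame f k w)) u = 0 := by
    rw [pd_eq_pdV, pdV_congr i (hf.eventuallyEq hu fun w hw =>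
      hP w hw _ (frame_mem j) _ (frame_mem k)), pdV_const]
  have hm : ∀ a b, nkMetric (nkP (frame f a u)) (frame f b u) = 0 := fun a b =>
    hP u hu _ (frame_mem a) _ (frame_mem b)
  have h := pd_nkMetric (f := f) ((hf.sm_frame hu j).linear nkPL) (hf.sm_frame hu k) i
  simp only [nkPL_apply] at h
  rw [z, covDeriv_nkP (hf.sm_frame hu j), NondegenerateOn.gauss_formula i j,
    NondegenerateOn.gauss_formula i k] at h
  simp only [nkMetric_add_left, nkMetric_add_right, nkP_add, nkP_smul, nkMetric_smul_left,
    nkMetric_smul_right, hm, hf.nkMetric_covP_tangent hu] at h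
  rw [← nkMetric_nkP_left, nkMetric_comm (secondForm f i k u)]
  linarith

theorem curvature_of_pNormal (hf : AlmostComplexOn f U) (hp : ParallelOn f U)
    (hP : ∀ w ∈ U, PNormalAt f w) (hu : u ∈ U) :
    secondForm f 1 1 u = 0 ∨ gaussCurvature f u = -5 / 9 := by
  obtain ⟨c, d, hc, hX, h01, h00⟩ := hf.exists_coeff hu
  set X := frame f 1 u with hXdef
  set η := secondForm f 1 1 u with hη
  by_cases hη0 : η = 0
  · exact Or.inl hη0
  right
  have hE := hf.tangentCoeff_frame_ne_zero hu
  rw [← hXdef] at hE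
  set E := nkMetric X X with hEdef
  have hG := hf.gaussCurvature_eq hu
  have p0 : pCoeff X = 0 := hP u hu _ (frame_mem 1) _ (frame_mem 1)
  have q0 : qCoeff X = 0 := by
    rw [qCoeff, nkMetric_nkJ_left,
      hP u hu _ (frame_mem 1) _ (hf.almostComplex u hu _ (frame_mem 1)), neg_zero]
  rw [← hXdef, ← hη, p0, q0, ← hEdef] at hG
  set K := gaussCurvature f u with hK
  -- normality of `η`
  have o1 : nkMetric X η = 0 := by
    rw [nkMetric_comm]; exact hf.secondForm_orthogonal hu 1 1 1
  have o2 : nkMetric (nkJ X) η = 0 := by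
    have := hf.secondForm_orthogonal hu 1 1 0
    rw [hX, ← hη, nkMetric_add_right, nkMetric_smul_right, nkMetric_smul_right,
      nkMetric_comm η X, o1, mul_zero, add_zero] at this
    rw [nkMetric_comm]
    exact (mul_eq_zero.1 this).resolve_left hc
  have o3 : nkMetric (nkP X) η = 0 := by
    have := hf.secondForm_nkP_skew hP hu 1 1 1
    rw [nkMetric_comm]
    rw [← hη, ← hXdef] at this
    linarith
  have o4 : nkMetric (nkJ (nkP X)) η = 0 := by
    have a1 := hf.secondForm_nkP_skew hP hu 1 1 0
    have a2 := hf.secondForm_nkP_skew hP hu 0 1 1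
    rw [hf.secondForm_comm hu 1 0] at a1
    have a3 : nkMetric η (nkP (frame f 0 u)) = 0 := by linarith
    rw [hX, nkP_add, nkP_smul, nkP_smul, nkP_nkJ, nkMetric_add_right, nkMetric_smul_right,
      nkMetric_smul_right, nkMetric_neg_right, nkMetric_comm η (nkP X), o3, mul_zero, add_zero,
      mul_neg, neg_eq_zero] at a3
    rw [nkMetric_comm]
    exact (mul_eq_zero.1 a3).resolve_left hc
  -- the Ricci equation
  have hR := hp.ricci hu
  have jn : normalPart f u (nkJ η) = nkJ η := by
    refine normalPart_of_orthogonal fun l => ?_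
    have h1 : nkMetric (nkJ η) X = 0 := by
      rw [nkMetric_nkJ_left, nkMetric_comm, o2, neg_zero]
    have h0 : nkMetric (nkJ η) (frame f 0 u) = 0 := by
      rw [hX, nkMetric_add_right, nkMetric_smul_right, nkMetric_smul_right, nkMetric_nkJ_nkJ,
        h1, nkMetric_comm, o1]
      ring
    fin_cases l
    · exact h0
    · exact h1
  rw [← hXdef, ← hη, h00, h01, hX, ambientCurvature_combination,
    ambientCurvature_normal (hf.frame_traceFree hu 1) (hf.secondForm_traceFree hu 1 1) o1 o2 o3 o4,
    normalPart_smul, normalPart_smul, jn] at hR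
  -- the coefficients in the Ricci equation
  have z := nkMetric_nkJ_self X
  have y := nkMetric_nkJ_self η
  set N := nkMetric η η with hN
  have c0 := hf.gaussCurvature_mul_det hu
  have c1 := hf.gauss_equation hu 1
  have s00 := hp.shapeCoeff_spec hu 0 0
  have s01 := hp.shapeCoeff_spec hu 0 1
  have s10 := hp.shapeCoeff_spec hu 1 0
  have s11 := hp.shapeCoeff_spec hu 1 1
  rw [inducedMetric_det] at c0
  rw [hf.secondForm_comm hu 1 0] at s10
  rw [nkMetric_comm (secondForm f 0 1 u)] at c1
  rw [add_sub_cancel_right, hX, ← hXdef, ambientCurvature_combination, nkMetric_smul_left,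
    nkMetric_ambientCurvature_self (hf.frame_traceFree hu 1), mul_zero] at c1
  rw [← hXdef, ← hη] at *
  rw [h00, h01] at s00
  rw [h01] at s01 s10
  rw [hX] at c0 s00 s01 s10 s11
  simp only [nkMetric_smul_left, nkMetric_add_right, nkMetric_add_left, nkMetric_smul_right,
    nkMetric_nkJ_nkJ, nkJ_add, nkJ_smul, nkJ_nkJ, nkMetric_neg_right,
    nkMetric_comm (nkJ X) X, z, y, ← hEdef, ← hN] at c0 c1 s00 s01 s10 s11
  -- Writing N = nE makes the shape coefficients polynomial in n and d, so that no quotients remain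
  -- in the Ricci equation.
  obtain ⟨n, hn⟩ : ∃ n, N = n * E := ⟨N / E, by rw [div_mul_cancel₀ _ hE]⟩
  rw [hn] at hG s00 s01 s10 s11
  generalize curvatureCoeff f 0 u = k0 at *
  generalize curvatureCoeff f 1 u = k1 at *
  generalize ParallelOn.shapeCoeff f 0 0 u = t00 at *
  generalize ParallelOn.shapeCoeff f 0 1 u = t01 at *
  generalize ParallelOn.shapeCoeff f 1 0 u = t10 at *
  generalize ParallelOn.shapeCoeff f 1 1 u = t11 at *
  rw [← hK] at c0
  have hc2 : c ^ 2 * E ≠ 0 := mul_ne_zero (pow_ne_zero 2 hc) hE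
  -- The Gauss and Weingarten relations are linear in the curvature and shape coefficients; their
  -- Gram determinant is c²E², so they can be solved.
  have e0 : k0 = K * E := mul_right_cancel₀ hc2 (by linear_combination -d * c1 - c0)
  have e1 : k1 = -(d * (K * E)) := mul_right_cancel₀ hE (by rw [e0] at c1; linear_combination c1)
  have f10 : t10 = 0 := mul_right_cancel₀ hc2 (by linear_combination s10 - d * s11)
  have f11 : t11 = -n := mul_right_cancel₀ hE (by rw [f10] at s11; linear_combination s11)
  have f00 : t00 = n := mul_right_cancel₀ hc2 (by linear_combination s00 - d * s01)
  have f01 : t01 = -(2 * d * n) :=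
    mul_right_cancel₀ hE (by rw [f00] at s01; linear_combination s01)
  rw [e0, e1, f10, f11, f00, f01, ← hEdef] at hR
  have hfin : (c * (2 * K * E - 2 * n + 1 / 3 * E)) • nkJ η = 0 := by
    rw [← sub_eq_zero] at hR
    rw [← neg_eq_zero, ← hR]
    module
  -- Only η ≠ 0 is needed here; in the indefinite metric g(η,η) ≠ 0 is not yet known.
  have hJη : nkJ η ≠ 0 := by
    intro h
    apply hη0
    rw [← neg_eq_zero, ← nkJ_nkJ, h, nkJ_zero]
  have h6 := (mul_eq_zero.1 ((smul_eq_zero.1 hfin).resolve_right hJη)).resolve_left hc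
  -- Elimination of n between KE = -(4/3)E - 2n and 2KE - 2n + E/3 = 0 gives 3K = -5/3.
  refine mul_right_cancel₀ (pow_ne_zero 2 hE) ?_
  linear_combination (1 / 3) * hG + (1 / 3) * E * h6

theorem totallyGeodesic_of_secondForm (hf : AlmostComplexOn f U) (hu : u ∈ U)
    (h : secondForm f 1 1 u = 0) (i j : Fin 2) : secondForm f i j u = 0 := by
  obtain ⟨c, d, -, -, h01, h00⟩ := hf.exists_coeff hu
  rw [h, nkJ_zero, smul_zero, smul_zero, add_zero] at h01
  rw [h01, nkJ_zero, smul_zero, smul_zero, add_zero] at h00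
  fin_cases i <;> fin_cases j
  · exact h00
  · exact h01
  · exact (hf.secondForm_comm hu 1 0).trans h01
  · exact h

theorem gaussCurvature_of_pNormal_of_totallyGeodesic (hf : AlmostComplexOn f U)
    (hP : PNormalAt f u) (hu : u ∈ U) (h : secondForm f 1 1 u = 0) :
    gaussCurvature f u = -4 / 3 := by
  have hG := hf.gaussCurvature_eq hu
  have hE := hf.tangentCoeff_frame_ne_zero hu
  have p0 : pCoeff (frame f 1 u) = 0 := hP _ (frame_mem 1) _ (frame_mem 1)
  have q0 : qCoeff (frame f 1 u) = 0 := by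
    rw [qCoeff, nkMetric_nkJ_left,
      hP _ (frame_mem 1) _ (hf.almostComplex u hu _ (frame_mem 1)), neg_zero]
  rw [p0, q0, h, nkMetric_zero_right] at hG
  refine mul_right_cancel₀ (pow_ne_zero 2 hE) ?_
  linear_combination hG

/-- Where K = -5/9 the Gauss equation reads 7E² + 18N = 0. At a zero of h this expression is 7E² ≠
0, so it stays nonzero nearby and excludes the second alternative of `curvature_of_pNormal`. -/
theorem eventually_secondForm_eq_zero (hf : AlmostComplexOn f U) (hp : ParallelOn f U)
    (hP : ∀ w ∈ U, PNormalAt f w) (hu : u ∈ U) (h : secondForm f 1 1 u = 0) :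
    ∀ᶠ w in 𝓝 u, secondForm f 1 1 w = 0 := by
  have sE : Sm (fun w => nkMetric (frame f 1 w) (frame f 1 w)) u := hf.sm_inducedMetric hu 1 1
  have sN : Sm (fun w => nkMetric (secondForm f 1 1 w) (secondForm f 1 1 w)) u :=
    (hf.sm_secondForm hu 1 1).bilin nkMetricB (hf.sm_secondForm hu 1 1)
  have s : Sm (fun w => 7 * nkMetric (frame f 1 w) (frame f 1 w) ^ 2
      + 18 * nkMetric (secondForm f 1 1 w) (secondForm f 1 1 w)) u :=
    (contDiffAt_const.mul (sE.pow 2)).add (contDiffAt_const.mul sN)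
  have hE := hf.tangentCoeff_frame_ne_zero hu
  have h0 : 7 * nkMetric (frame f 1 u) (frame f 1 u) ^ 2
      + 18 * nkMetric (secondForm f 1 1 u) (secondForm f 1 1 u) ≠ 0 := by
    rw [h, nkMetric_zero_left, mul_zero, add_zero]
    positivity
  filter_upwards [s.continuousAt.eventually_ne h0, hf.isOpen.mem_nhds hu] with w h2 hw
  refine (hf.curvature_of_pNormal hp hP hw).resolve_right fun h3 => h2 ?_
  have hG := hf.gaussCurvature_eq hw
  have p0 : pCoeff (frame f 1 w) = 0 := hP w hw _ (frame_mem 1) _ (frame_mem 1)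
  have q0 : qCoeff (frame f 1 w) = 0 := by
    rw [qCoeff, nkMetric_nkJ_left,
      hP w hw _ (frame_mem 1) _ (hf.almostComplex w hw _ (frame_mem 1)), neg_zero]
  rw [p0, q0, h3] at hG
  linear_combination (9 : ℝ) * hG

theorem eventually_secondForm_ne_zero (hf : AlmostComplexOn f U) (hu : u ∈ U)
    (h : secondForm f 1 1 u ≠ 0) : ∀ᶠ w in 𝓝 u, secondForm f 1 1 w ≠ 0 :=
  (hf.sm_secondForm hu 1 1).continuousAt.eventually_ne h

end AlmostComplexOn
end Dichotomy

/-! ### The case in which `P` preserves the tangent planes -/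

/-- The pairs `(sα, tα)`. -/
def lineProd (α : Mat2) : Submodule ℝ Vec where
  carrier := {X | ∃ s t : ℝ, X = (s • α, t • α)}
  add_mem' := by
    rintro _ _ ⟨s, t, rfl⟩ ⟨s', t', rfl⟩
    exact ⟨s + s', t + t', by simp [add_smul]⟩
  zero_mem' := ⟨0, 0, by simp [Prod.zero_eq_mk]⟩
  smul_mem' := by
    rintro c _ ⟨s, t, rfl⟩
    exact ⟨c * s, c * t, by simp [mul_smul]⟩

theorem mem_lineProd {α : Mat2} {X : Vec} :
    X ∈ lineProd α ↔ ∃ s t : ℝ, X = (s • α, t • α) := Iff.rfl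

theorem lineProd_smul {c : ℝ} (hc : c ≠ 0) (α : Mat2) : lineProd (c • α) = lineProd α := by
  ext X
  simp only [mem_lineProd]
  constructor
  · rintro ⟨s, t, rfl⟩; exact ⟨s * c, t * c, by simp [mul_smul]⟩
  · rintro ⟨s, t, rfl⟩
    exact ⟨s * c⁻¹, t * c⁻¹, by simp [smul_smul, mul_assoc, inv_mul_cancel₀ hc]⟩

/-- Multiples of a single matrix commute, so every cross product in the connection vanishes. -/
theorem leviCivita_lineProd {α : Mat2} {X Y : Vec} (hX : X ∈ lineProd α) (hY : Y ∈ lineProd α) :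
    leviCivita X Y = 0 := by
  obtain ⟨s, t, rfl⟩ := hX
  obtain ⟨s', t', rfl⟩ := hY
  have : ∀ x y : ℝ, cross (x • α) (y • α) = 0 := by
    intro x y
    rw [cross, smul_mul_smul_comm, smul_mul_smul_comm, mul_comm y x, sub_self, smul_zero]
  simp [leviCivita, this]

theorem bracket_lineProd {α : Mat2} {X Y : Vec} (hX : X ∈ lineProd α) (hY : Y ∈ lineProd α) :
    bracket X Y = 0 := by
  obtain ⟨s, t, rfl⟩ := hX
  obtain ⟨s', t', rfl⟩ := hY
  simp only [bracket, smul_mul_smul_comm]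
  rw [mul_comm s s', mul_comm t t', sub_self, sub_self]; rfl

/-- `matInner` as a bilinear form. -/
def matInnerB : Mat2 →ₗ[ℝ] Mat2 →ₗ[ℝ] ℝ :=
  LinearMap.mk₂ ℝ matInner
    (fun X Y Z => by simp [matInner_eq]; ring)
    (fun c X Y => by simp [matInner_eq]; ring)
    (fun X Y Z => by simp [matInner_eq]; ring)
    (fun c X Y => by simp [matInner_eq]; ring)

theorem matInnerB_apply (a b : Mat2) : matInnerB a b = matInner a b := rfl

theorem matInner_smul_left (c : ℝ) (a b : Mat2) : matInner (c • a) b = c * matInner a b :=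
  matInnerB.map_smul₂ c a b

theorem matInner_smul_right (c : ℝ) (a b : Mat2) : matInner a (c • b) = c * matInner a b :=
  (matInnerB a).map_smul c b

theorem nkMetric_lineProd {α : Mat2} {X Y : Vec} (hX : X ∈ lineProd α) (hY : Y ∈ lineProd α)
    (h : matInner α α = 0) : nkMetric X Y = 0 := by
  obtain ⟨s, t, rfl⟩ := hX
  obtain ⟨s', t', rfl⟩ := hY
  simp [nkMetric, matInner_smul_left, matInner_smul_right, h]

theorem finrank_lineProd {α : Mat2} (h : α ≠ 0) : Module.finrank ℝ (lineProd α) = 2 := by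
  let L : (ℝ × ℝ) →ₗ[ℝ] Vec :=
    (LinearMap.toSpanSingleton ℝ Mat2 α).prodMap (LinearMap.toSpanSingleton ℝ Mat2 α)
  have hr : lineProd α = LinearMap.range L := by
    ext X
    simp only [mem_lineProd, LinearMap.mem_range, Prod.exists]
    exact ⟨fun ⟨s, t, e⟩ => ⟨s, t, e.symm⟩, fun ⟨s, t, e⟩ => ⟨s, t, e.symm⟩⟩
  have hi : Function.Injective L := by
    rintro ⟨s, t⟩ ⟨s', t'⟩ e
    have e' : (s • α, t • α) = (s' • α, t' • α) := e
    rw [Prod.ext_iff] at e'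
    exact Prod.ext (smul_left_injective ℝ h e'.1) (smul_left_injective ℝ h e'.2)
  rw [hr, LinearMap.finrank_range_of_inj hi]
  simp

section Constancy

open Filter Topology

theorem const_of_pdV_eq_zero {V : Type*} [NormedAddCommGroup V] [NormedSpace ℝ V]
    {φ : Plane → V} {U : Set Plane} {u : Plane} (hU : IsOpen U) (hu : u ∈ U)
    (hs : ∀ w ∈ U, Sm φ w) (h0 : ∀ w ∈ U, ∀ i, pdV i φ w = 0) : ∀ᶠ w in 𝓝 u, φ w = φ u := by
  obtain ⟨r, hr, hb⟩ := Metric.isOpen_iff.1 hU u hu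
  filter_upwards [Metric.ball_mem_nhds u hr] with w hw
  refine Metric.isOpen_ball.is_const_of_fderiv_eq_zero (𝕜 := ℝ)
    (convex_ball u r).isPreconnected
    (fun x hx => (hs x (hb hx)).diff.differentiableWithinAt) (fun x hx => ?_) hw
    (Metric.mem_ball_self hr)
  ext v
  have hv : v = v 0 • EuclideanSpace.single 0 (1 : ℝ) + v 1 • EuclideanSpace.single 1 (1 : ℝ) := by
    ext i; fin_cases i <;> simp
  rw [hv, map_add, map_smul, map_smul]
  have e0 : fderiv ℝ φ x (EuclideanSpace.single 0 1) = 0 := h0 x (hb hx) 0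
  have e1 : fderiv ℝ φ x (EuclideanSpace.single 1 1) = 0 := h0 x (hb hx) 1
  simp [e0, e1]

variable {f : Plane → Ambient} {U : Set Plane} {u : Plane}

theorem AlmostComplexOn.mono {V : Set Plane} (hf : AlmostComplexOn f U) (hV : IsOpen V)
    (h : V ⊆ U) : AlmostComplexOn f V where
  isOpen := hV
  fst u hu := hf.fst u (h hu)
  snd u hu := hf.snd u (h hu)
  nondegenerate u hu := hf.nondegenerate u (h hu)
  almostComplex u hu := hf.almostComplex u (h hu)

/-- If the plane contains (y,y), it contains √3 J(y,y) = (-y,y), hence (2y,0) and (0,2y), and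
dimension two leaves no room for more. A vector (y,y) arises as X + PX or, if this is zero, as √3
JX. A null α would make the metric vanish on the plane. -/
theorem AlmostComplexOn.exists_lineProd (hf : AlmostComplexOn f U) (hu : u ∈ U)
    (hP : PTangentAt f u) : ∃ α, matInner α α ≠ 0 ∧ tangentPlane f u = lineProd α := by
  obtain ⟨c, d, -, hX, -, -⟩ := hf.exists_coeff hu
  have hE := hf.tangentCoeff_frame_ne_zero hu
  have key : ∀ α : Mat2, α ≠ 0 → (α, (0 : Mat2)) ∈ tangentPlane f u →
      ((0 : Mat2), α) ∈ tangentPlane f u →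
      ∃ α, matInner α α ≠ 0 ∧ tangentPlane f u = lineProd α := by
    intro α h0 h1 h2
    have hle : lineProd α ≤ tangentPlane f u := by
      rintro _ ⟨s, t, rfl⟩
      have : (s • α, t • α) = s • (α, (0 : Mat2)) + t • ((0 : Mat2), α) := by simp
      rw [this]
      exact add_mem (Submodule.smul_mem _ _ h1) (Submodule.smul_mem _ _ h2)
    have heq : tangentPlane f u = lineProd α := by
      refine (Submodule.eq_of_le_of_finrank_le hle ?_).symm
      rw [finrank_lineProd h0]
      exact (finrank_range_le_card (R := ℝ) fun i => frame f i u).trans (by simp)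
    refine ⟨α, fun h => hE ?_, heq⟩
    have := frame_mem (f := f) (u := u) 1
    rw [heq] at this
    exact nkMetric_lineProd this this h
  have hT := frame_mem (f := f) (u := u) 1
  have hs3 : (√3 : ℝ) * (1 / √3) = 1 := by
    rw [mul_one_div, div_self (by positivity)]
  have diag : ∀ y : Mat2, y ≠ 0 → (y, y) ∈ tangentPlane f u →
      ∃ α, matInner α α ≠ 0 ∧ tangentPlane f u = lineProd α := by
    intro y hy h1
    have h2 : (√3 : ℝ) • nkJ (y, y) = (-y, y) := by
      ext i j <;> simp only [nkJ, Prod.smul_fst, Prod.smul_snd,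
        Matrix.smul_apply, Matrix.sub_apply, Matrix.neg_apply, smul_eq_mul, ← mul_assoc, hs3] <;>
        ring
    have h3 : (-y, y) ∈ tangentPlane f u := by
      rw [← h2]; exact Submodule.smul_mem _ _ (hf.almostComplex u hu _ h1)
    refine key ((2 : ℝ) • y) (smul_ne_zero two_ne_zero hy) ?_ ?_
    · have : ((2 : ℝ) • y, (0 : Mat2)) = (y, y) - (-y, y) := by
        simp [two_smul]
      rw [this]; exact sub_mem h1 h3
    · have : ((0 : Mat2), (2 : ℝ) • y) = (y, y) + (-y, y) := by
        simp [two_smul]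
      rw [this]; exact add_mem h1 h3
  by_cases hy : (frame f 1 u).1 + (frame f 1 u).2 = 0
  · have hX1 : frame f 1 u = ((frame f 1 u).1, -(frame f 1 u).1) :=
      Prod.ext rfl (eq_neg_of_add_eq_zero_right hy)
    set z := (frame f 1 u).1 with hz
    have h1 : (√3 : ℝ) • nkJ (frame f 1 u) = ((3 : ℝ) • z, (3 : ℝ) • z) := by
      rw [hX1]
      ext i j <;> simp only [nkJ, Prod.smul_fst, Prod.smul_snd,
        Matrix.smul_apply, Matrix.sub_apply, Matrix.neg_apply, smul_eq_mul, ← mul_assoc, hs3] <;>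
        ring
    refine diag ((3 : ℝ) • z) (smul_ne_zero three_ne_zero fun h => ?_) ?_
    · rw [hX1, h] at hE
      simp [nkMetric, matInner_eq] at hE
    · rw [← h1]; exact Submodule.smul_mem _ _ (hf.almostComplex u hu _ hT)
  · refine diag _ hy ?_
    have : ((frame f 1 u).1 + (frame f 1 u).2, (frame f 1 u).1 + (frame f 1 u).2)
        = frame f 1 u + nkP (frame f 1 u) := Prod.ext rfl (add_comm _ _)
    rw [this]
    exact add_mem hT (hP _ hT)

/-- If the tangent planes are `{(sα, tα)}`, then the derivatives of `α` are proportional to `α`,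
and the surface is totally geodesic. -/
theorem NondegenerateOn.lineProd_parallel (hf : NondegenerateOn f U) {a : Plane → Mat2}
    (ha : ∀ w ∈ U, Sm a w) (h0 : ∀ w ∈ U, matInner (a w) (a w) ≠ 0)
    (hT : ∀ w ∈ U, tangentPlane f w = lineProd (a w)) (hu : u ∈ U) (i : Fin 2) :
    (∃ r : ℝ, pdV i a u = r • a u) ∧ ∀ j, covDeriv f i (frame f j) u ∈ tangentPlane f u := by
  set x : Fin 2 → Plane → ℝ :=
    fun i w => matInner (frame f i w).1 (a w) * (matInner (a w) (a w))⁻¹ with hx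
  set y : Fin 2 → Plane → ℝ :=
    fun i w => matInner (frame f i w).2 (a w) * (matInner (a w) (a w))⁻¹ with hy
  have hinv : Sm (fun w => (matInner (a w) (a w))⁻¹) u :=
    ContDiffAt.inv ((ha u hu).bilin matInnerB (ha u hu)) (h0 u hu)
  have sx : ∀ i, Sm (x i) u := fun i => ContDiffAt.mul
    (((hf.sm_frame hu i).linear (LinearMap.fst ℝ Mat2 Mat2)).bilin matInnerB (ha u hu)) hinv
  have sy : ∀ i, Sm (y i) u := fun i => ContDiffAt.mul
    (((hf.sm_frame hu i).linear (LinearMap.snd ℝ Mat2 Mat2)).bilin matInnerB (ha u hu)) hinv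
  have hfr : ∀ w ∈ U, ∀ i, frame f i w = (x i w • a w, y i w • a w) := by
    intro w hw i
    have hm := frame_mem (f := f) (u := w) i
    rw [hT w hw] at hm
    obtain ⟨s, t, e⟩ := hm
    simp only [hx, hy, e, matInner_smul_left, mul_assoc, mul_inv_cancel₀ (h0 w hw), mul_one]
  have ha0 : a u ≠ 0 := fun h => h0 u hu (by rw [h]; simp [matInner_eq])
  have hpd : ∀ k j, pdV k (frame f j) u = (pdV k (x j) u • a u + x j u • pdV k a u,
      pdV k (y j) u • a u + y j u • pdV k a u) := by
    intro k j
    have s1 := (sx j).fsmul (ha u hu)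
    have s2 := (sy j).fsmul (ha u hu)
    rw [pdV_congr k (hf.eventuallyEq hu fun w hw => hfr w hw j), ← pdV_smul k (sx j) (ha u hu),
      ← pdV_smul k (sy j) (ha u hu)]
    exact Prod.ext (pdV_linear (LinearMap.fst ℝ Mat2 Mat2) k (s1.prodMk s2)).symm
      (pdV_linear (LinearMap.snd ℝ Mat2 Mat2) k (s1.prodMk s2)).symm
  have hmem : ∀ j, frame f j u ∈ lineProd (a u) := fun j => ⟨_, _, hfr u hu j⟩
  have hst := hf.frame_structure hu 0 1
  rw [bracket_lineProd (hmem 0) (hmem 1), neg_zero, hpd, hpd, Prod.mk_sub_mk,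
    Prod.mk_eq_zero] at hst
  obtain ⟨e1, e2⟩ := hst
  -- The form (2/3)(x² + y²) - (2/3)xy has determinant 1/3, so the Gram determinant is (1/3)⟨a,a⟩²
  -- times the square of this one.
  have hdet : x 0 u * y 1 u - x 1 u * y 0 u ≠ 0 := by
    intro h
    apply hf.nondegenerate u hu
    rw [inducedMetric_det, hfr u hu 0, hfr u hu 1]
    simp only [nkMetric, matInner_smul_left, matInner_smul_right]
    linear_combination (1 / 3) * matInner (a u) (a u) ^ 2 * (x 0 u * y 1 u - x 1 u * y 0 u) * h
  have hr : ∃ r : ℝ, pdV i a u = r • a u := by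
    have solve : ∀ (D : ℝ) (A B : Mat2), D ≠ 0 → (∃ r : ℝ, D • A = r • B) → ∃ r : ℝ, A = r • B := by
      rintro D A B hD ⟨r, h⟩
      exact ⟨D⁻¹ * r, by rw [mul_smul, ← h, smul_smul, inv_mul_cancel₀ hD, one_smul]⟩
    refine solve _ _ _ hdet ?_
    fin_cases i
    · refine ⟨(pdV 0 (x 1) u - pdV 1 (x 0) u) * y 0 u - (pdV 0 (y 1) u - pdV 1 (y 0) u) * x 0 u, ?_⟩
      -- The combination x₀e₂ - y₀e₁ of the two structure equations eliminates ∂₁a and leaves ∂₀a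
      -- with the determinant as coefficient.
      have := congrArg₂ (fun p q => x 0 u • q - y 0 u • p) e1 e2
      simp only [smul_zero, sub_zero] at this
      rw [← sub_eq_zero, ← this]
      simp only [Fin.zero_eta]
      module
    · refine ⟨(pdV 0 (x 1) u - pdV 1 (x 0) u) * y 1 u - (pdV 0 (y 1) u - pdV 1 (y 0) u) * x 1 u, ?_⟩
      have := congrArg₂ (fun p q => x 1 u • q - y 1 u • p) e1 e2
      simp only [smul_zero, sub_zero] at this
      rw [← sub_eq_zero, ← this]
      simp only [Fin.mk_one]
      module
  refine ⟨hr, fun j => ?_⟩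
  obtain ⟨r, hr⟩ := hr
  rw [covDeriv_eq (hf.sm_frame hu j), leviCivita_lineProd (hmem i) (hmem j), add_zero, hpd, hr,
    hT u hu]
  exact ⟨pdV i (x j) u + x j u * r, pdV i (y j) u + y j u * r, by simp [add_smul, mul_smul]⟩

/-- A smooth choice of the generator is the first component of a coordinate vector. Some first
component is non-null because the plane contains (α,0), and it stays so nearby. -/
theorem AlmostComplexOn.exists_local_line (hf : AlmostComplexOn f U)
    (hP : ∀ w ∈ U, PTangentAt f w) (hu : u ∈ U) :
    ∃ (V : Set Plane) (a : Plane → Mat2), u ∈ V ∧ AlmostComplexOn f V ∧ (∀ w ∈ V, Sm a w) ∧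
      (∀ w ∈ V, matInner (a w) (a w) ≠ 0) ∧ ∀ w ∈ V, tangentPlane f w = lineProd (a w) := by
  have hj : ∃ j, matInner (frame f j u).1 (frame f j u).1 ≠ 0 := by
    obtain ⟨α, hα, hT⟩ := hf.exists_lineProd hu (hP u hu)
    by_contra! hc
    have h1 : ∀ j, (frame f j u).1 = 0 := by
      intro j
      have hm := frame_mem (f := f) (u := u) j
      rw [hT] at hm
      obtain ⟨s, t, e⟩ := hm
      have h2 := hc j
      rw [e] at h2 ⊢
      simp only [matInner_smul_left, matInner_smul_right, mul_eq_zero, hα, or_false, or_self] at h2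
      simp [h2]
    have h3 : (α, (0 : Mat2)) ∈ tangentPlane f u := by
      rw [hT]; exact ⟨1, 0, by simp⟩
    obtain ⟨s, t, e⟩ := mem_tangentPlane.1 h3
    have h4 := congrArg Prod.fst e
    simp only [Prod.fst_add, Prod.smul_fst, h1, smul_zero, add_zero] at h4
    rw [h4] at hα
    simp [matInner_eq] at hα
  obtain ⟨j, hj⟩ := hj
  have sa : ∀ w ∈ U, Sm (fun w => (frame f j w).1) w := fun w hw =>
    (hf.sm_frame hw j).linear (LinearMap.fst ℝ Mat2 Mat2)
  have hc : ContinuousOn (fun w => matInner (frame f j w).1 (frame f j w).1) U := fun w hw =>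
    (((sa w hw).bilin matInnerB (sa w hw)).continuousAt).continuousWithinAt
  refine ⟨U ∩ (fun w => matInner (frame f j w).1 (frame f j w).1) ⁻¹' {0}ᶜ,
    fun w => (frame f j w).1, ⟨hu, hj⟩,
    hf.mono (hc.isOpen_inter_preimage hf.isOpen isOpen_compl_singleton) Set.inter_subset_left,
    fun w hw => sa w hw.1, fun w hw => hw.2, fun w hw => ?_⟩
  obtain ⟨α, hα, hT⟩ := hf.exists_lineProd hw.1 (hP w hw.1)
  have hm := frame_mem (f := f) (u := w) j
  rw [hT] at hm
  obtain ⟨s, t, e⟩ := hm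
  have hs : s ≠ 0 := by
    intro h
    apply hw.2
    simp [e, h, matInner_eq]
  simp only [e]
  rw [lineProd_smul hs, hT]

theorem AlmostComplexOn.totallyGeodesic_of_pTangent (hf : AlmostComplexOn f U)
    (hP : ∀ w ∈ U, PTangentAt f w) (hu : u ∈ U) (i j : Fin 2) : secondForm f i j u = 0 := by
  obtain ⟨V, a, huV, hV, ha, h0, hT⟩ := hf.exists_local_line hP hu
  exact (normalPart_eq_zero_iff (hf.nondegenerate u hu)).2
    ((hV.lineProd_parallel ha h0 hT huV i).2 j)

theorem AlmostComplexOn.gaussCurvature_of_pTangent (hf : AlmostComplexOn f U)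
    (hP : ∀ w ∈ U, PTangentAt f w) (hu : u ∈ U) : gaussCurvature f u = 0 := by
  have hG := hf.gaussCurvature_mul_det hu
  simp only [hf.gauss_equation hu 0, hf.totallyGeodesic_of_pTangent hP hu,
    nkMetric_zero_left] at hG
  obtain ⟨α, -, hT⟩ := hf.exists_lineProd hu (hP u hu)
  have hm : ∀ j, frame f j u ∈ lineProd α := fun j => hT ▸ frame_mem j
  have h0 : ambientCurvature (frame f 0 u) (frame f 1 u) (frame f 1 u) = 0 := by
    rw [ambientCurvature, leviCivita_lineProd (hm 1) (hm 1), leviCivita_lineProd (hm 0) (hm 1),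
      bracket_lineProd (hm 0) (hm 1)]
    simp [leviCivita, cross]
  rw [h0, nkMetric_zero_left, add_zero, sub_zero] at hG
  exact (mul_eq_zero.1 hG).resolve_right (hf.nondegenerate u hu)

/-- The tangent plane is locally constant. -/
theorem AlmostComplexOn.eventually_tangentPlane_eq (hf : AlmostComplexOn f U)
    (hP : ∀ w ∈ U, PTangentAt f w) (hu : u ∈ U) :
    ∀ᶠ w in 𝓝 u, tangentPlane f w = tangentPlane f u := by
  obtain ⟨V, a, huV, hV, ha, h0, hT⟩ := hf.exists_local_line hP hu
  set W : Set Plane := V ∩ (fun w => matInner (a w) (a u)) ⁻¹' {0}ᶜ with hW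
  have sm : ∀ w ∈ V, Sm (fun w => matInner (a w) (a u)) w := fun w hw =>
    (ha w hw).linear (matInnerB.flip (a u))
  have hWo : IsOpen W := ContinuousOn.isOpen_inter_preimage
    (fun w hw => (sm w hw).continuousAt.continuousWithinAt) hV.isOpen isOpen_compl_singleton
  have huW : u ∈ W := ⟨huV, h0 u huV⟩
  have sinv : ∀ w ∈ W, Sm (fun w => (matInner (a w) (a u))⁻¹) w := fun w hw =>
    ContDiffAt.inv (sm w hw.1) hw.2
  -- Since ∂a = ra, the pairing ⟨a,a(u)⟩ is multiplied by the same r under differentiation, so the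
  -- quotient a/⟨a,a(u)⟩ has zero derivative. It spans the same line as a.
  have hconst := const_of_pdV_eq_zero (φ := fun w => (matInner (a w) (a u))⁻¹ • a w) hWo huW
    (fun w hw => (sinv w hw).fsmul (ha w hw.1)) (fun w hw i => by
      rw [pdV_smul i (sinv w hw) (ha w hw.1)]
      obtain ⟨r, hr⟩ := (hV.lineProd_parallel ha h0 hT hw.1 i).1
      have hm : matInner (a w) (a u) ≠ 0 := hw.2
      have h1 := pdV_linear (matInnerB.flip (a u)) i (ha w hw.1)
      simp only [LinearMap.flip_apply, matInnerB_apply] at h1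
      rw [hr, matInner_smul_left] at h1
      have h2 := pdV_bilin (LinearMap.mul ℝ ℝ) i (sinv w hw) (sm w hw.1)
      have h3 : pdV i (fun w => (matInner (a w) (a u))⁻¹ * matInner (a w) (a u)) w = 0 := by
        have he : (fun w => (matInner (a w) (a u))⁻¹ * matInner (a w) (a u)) =ᶠ[𝓝 w]
            fun _ => (1 : ℝ) :=
          eventually_of_mem (hWo.mem_nhds hw) fun w' hw' => inv_mul_cancel₀ hw'.2
        rw [pdV_congr i he, pdV_const]
      simp only [LinearMap.mul_apply', h3, h1] at h2
      rw [hr, smul_smul, ← add_smul]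
      refine smul_eq_zero_of_left (mul_right_cancel₀ hm ?_) _
      linear_combination -h2)
  filter_upwards [hconst, hWo.mem_nhds huW] with w hw hwW
  rw [hT w hwW.1, hT u huV, ← lineProd_smul (inv_ne_zero hwW.2) (a w), hw,
    lineProd_smul (inv_ne_zero (h0 u huV))]

end Constancy

/-! ### Change of coordinates -/

section Reparametrization

open Filter Topology

/-- A coordinate of the plane as a linear map. -/
def coordL (k : Fin 2) : Plane →ₗ[ℝ] ℝ where
  toFun v := v k
  map_add' _ _ := rfl
  map_smul' _ _ := rfl

theorem plane_eq_sum (v : Plane) :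
    v = v 0 • EuclideanSpace.single 0 (1 : ℝ) + v 1 • EuclideanSpace.single 1 (1 : ℝ) := by
  ext i; fin_cases i <;> simp

theorem pdV_comp {V : Type*} [NormedAddCommGroup V] [NormedSpace ℝ V] {ψ : Plane → V}
    {φ : Plane → Plane} {u : Plane} (hψ : Sm ψ (φ u)) (hφ : Sm φ u) (i : Fin 2) :
    pdV i (fun w => ψ (φ w)) u = pd i (fun w => φ w 0) u • pdV 0 ψ (φ u)
      + pd i (fun w => φ w 1) u • pdV 1 ψ (φ u) := by
  have h : ∀ k, pd i (fun w => φ w k) u = pdV i φ u k := fun k => pdV_linear (coordL k) i hφ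
  rw [h, h]
  have e := (hψ.diff.hasFDerivAt.comp u hφ.diff.hasFDerivAt).fderiv
  change fderiv ℝ (ψ ∘ φ) u _ = _
  rw [e]
  change fderiv ℝ ψ (φ u) (pdV i φ u) = _
  conv_lhs => rw [plane_eq_sum (pdV i φ u)]
  rw [map_add, map_smul, map_smul]
  rfl

/-- `f = f' ∘ φ` for a smooth change of coordinates `φ`. -/
structure Reparam (f f' : Plane → Ambient) (φ : Plane → Plane) (U U' : Set Plane) : Prop where
  source : SmoothOn f U
  target : SmoothOn f' U'
  mapsTo : Set.MapsTo φ U U'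
  smooth : ∀ u ∈ U, Sm φ u
  comp : ∀ u ∈ U, f u = f' (φ u)

variable {f f' : Plane → Ambient} {φ : Plane → Plane} {U U' : Set Plane} {u : Plane}

namespace Reparam

theorem maurer_comp {C C' : Plane → SL2} (hφ : Sm φ u)
    (hC' : Sm (fun w => (C' w : Mat2)) (φ u)) (h : ∀ᶠ w in 𝓝 u, C w = C' (φ w)) (i : Fin 2) :
    maurer C i u = pd i (fun w => φ w 0) u • maurer C' 0 (φ u)
      + pd i (fun w => φ w 1) u • maurer C' 1 (φ u) := by
  have h1 : (fun w => (C w : Mat2)) =ᶠ[𝓝 u] fun w => (C' (φ w) : Mat2) :=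
    h.mono fun w hw => by simp only [hw]
  have h2 := pdV_comp (φ := φ) hC' hφ i
  rw [maurer, pdV_congr i h1, h2, h.self_of_nhds, mul_add, mul_smul_comm, mul_smul_comm]
  rfl

theorem frame_comp (h : Reparam f f' φ U U') (hu : u ∈ U) (i : Fin 2) :
    frame f i u = pd i (fun w => φ w 0) u • frame f' 0 (φ u)
      + pd i (fun w => φ w 1) u • frame f' 1 (φ u) := by
  have hu' := h.mapsTo hu
  have he : ∀ᶠ w in 𝓝 u, f w = f' (φ w) :=
    eventually_of_mem (h.source.isOpen.mem_nhds hu) h.comp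
  rw [h.source.frame_eq hu, h.target.frame_eq hu', h.target.frame_eq hu',
    maurer_comp (C' := fun w => (f' w).1) (h.smooth u hu) (h.target.fst _ hu')
      (he.mono fun w hw => by rw [hw]),
    maurer_comp (C' := fun w => (f' w).2) (h.smooth u hu) (h.target.snd _ hu')
      (he.mono fun w hw => by rw [hw])]
  rfl

theorem tangentPlane_le (h : Reparam f f' φ U U') (hu : u ∈ U) :
    tangentPlane f u ≤ tangentPlane f' (φ u) := by
  rw [tangentPlane, Submodule.span_le]
  rintro _ ⟨i, rfl⟩
  simp only [SetLike.mem_coe]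
  rw [h.frame_comp hu]
  exact add_mem (Submodule.smul_mem _ _ (frame_mem 0)) (Submodule.smul_mem _ _ (frame_mem 1))

theorem covDeriv_comp (h : Reparam f f' φ U U') (hu : u ∈ U) {ξ : Plane → Vec}
    (hξ : Sm ξ (φ u)) (i : Fin 2) :
    covDeriv f i (fun w => ξ (φ w)) u = pd i (fun w => φ w 0) u • covDeriv f' 0 ξ (φ u)
      + pd i (fun w => φ w 1) u • covDeriv f' 1 ξ (φ u) := by
  have hs : Sm (fun w => ξ (φ w)) u := ContDiffAt.comp u hξ (h.smooth u hu)
  rw [covDeriv_eq hs, covDeriv_eq hξ, covDeriv_eq hξ, pdV_comp hξ (h.smooth u hu),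
    h.frame_comp hu, leviCivita_add_left, leviCivita_smul_left, leviCivita_smul_left]
  module

theorem sm_jacobian (h : Reparam f f' φ U U') (hu : u ∈ U) (i k : Fin 2) :
    Sm (pd i (fun w => φ w k)) u :=
  Sm.pdV ((h.smooth u hu).linear (coordL k)) i

/-- Vanishing of h means that derivatives of tangent fields stay tangent. In this form only the
first-order chain rule is needed to change coordinates. -/
theorem covDeriv_frame_mem (h : Reparam f f' φ U U') (hu : u ∈ U)
    (hg : ∀ i j, covDeriv f' i (frame f' j) (φ u) ∈ tangentPlane f' (φ u)) (i j : Fin 2) :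
    covDeriv f i (frame f j) u ∈ tangentPlane f' (φ u) := by
  have hs : ∀ k, Sm (fun w => frame f' k (φ w)) u := fun k =>
    ContDiffAt.comp u (h.target.sm_frame (h.mapsTo hu) k) (h.smooth u hu)
  have j0 := h.sm_jacobian hu j 0
  have j1 := h.sm_jacobian hu j 1
  have hm : ∀ k, covDeriv f i (fun w => frame f' k (φ w)) u ∈ tangentPlane f' (φ u) := by
    intro k
    rw [h.covDeriv_comp hu (h.target.sm_frame (h.mapsTo hu) k)]
    exact add_mem (Submodule.smul_mem _ _ (hg 0 k)) (Submodule.smul_mem _ _ (hg 1 k))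
  rw [covDeriv_congr ((j0.fsmul (hs 0)).add (j1.fsmul (hs 1)))
      (h.source.eventuallyEq hu fun w hw => h.frame_comp hw j),
    covDeriv_add (j0.fsmul (hs 0)) (j1.fsmul (hs 1)), covDeriv_smul j0 (hs 0),
    covDeriv_smul j1 (hs 1)]
  exact add_mem
    (add_mem (Submodule.smul_mem _ _ (frame_mem 0)) (Submodule.smul_mem _ _ (hm 0)))
    (add_mem (Submodule.smul_mem _ _ (frame_mem 1)) (Submodule.smul_mem _ _ (hm 1)))

end Reparam

end Reparametrization

/-! ### Surfaces in charts -/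

section Charts

open Filter Topology

variable {M : Type*} [TopologicalSpace M] [ChartedSpace (EuclideanSpace ℝ (Fin 2)) M]
  [IsManifold (𝓡 2) ∞ M] {F : M → Ambient}

theorem sm_matrix {φ : Plane → Mat2} {u : Plane} (h : ∀ i j, Sm (fun w => φ w i j) u) : Sm φ u :=
  contDiffAt_pi.2 fun i => contDiffAt_pi.2 fun j => h i j

omit [IsManifold (𝓡 2) ∞ M] in
theorem sm_comp_symm {φ : M → ℝ} (hφ : ContMDiff (𝓡 2) 𝓘(ℝ, ℝ) ∞ φ)
    {e : OpenPartialHomeomorph M (EuclideanSpace ℝ (Fin 2))}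
    (he : e ∈ IsManifold.maximalAtlas (𝓡 2) ∞ M) {u : Plane} (hu : u ∈ e.target) :
    Sm (fun w => φ (e.symm w)) u := by
  have h1 := hφ.comp_contMDiffOn (contMDiffOn_symm_of_mem_maximalAtlas he)
  exact (contMDiffOn_iff_contDiffOn.1 h1).contDiffAt (e.open_target.mem_nhds hu)

omit [IsManifold (𝓡 2) ∞ M] in
theorem IsAlmostComplexSurface.almostComplexOn (hF : IsAlmostComplexSurface F)
    {e : OpenPartialHomeomorph M (EuclideanSpace ℝ (Fin 2))}
    (he : e ∈ IsManifold.maximalAtlas (𝓡 2) ∞ M) : AlmostComplexOn (F ∘ e.symm) e.target where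
  isOpen := e.open_target
  fst _ hu := sm_matrix fun i j => sm_comp_symm (hF.smooth₁ i j) he hu
  snd _ hu := sm_matrix fun i j => sm_comp_symm (hF.smooth₂ i j) he hu
  nondegenerate := hF.nondegenerate e he
  almostComplex := hF.almostComplex e he

omit [IsManifold (𝓡 2) ∞ M] in
theorem parallelOn (hF : IsAlmostComplexSurface F) (hp : HasParallelSecondForm F)
    {e : OpenPartialHomeomorph M (EuclideanSpace ℝ (Fin 2))}
    (he : e ∈ IsManifold.maximalAtlas (𝓡 2) ∞ M) : ParallelOn (F ∘ e.symm) e.target where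
  toNondegenerateOn := (hF.almostComplexOn he).toNondegenerateOn
  parallel := hp e he

omit [IsManifold (𝓡 2) ∞ M] in
theorem reparam (hF : IsAlmostComplexSurface F)
    {e e' : OpenPartialHomeomorph M (EuclideanSpace ℝ (Fin 2))}
    (he : e ∈ IsManifold.maximalAtlas (𝓡 2) ∞ M) (he' : e' ∈ IsManifold.maximalAtlas (𝓡 2) ∞ M) :
    Reparam (F ∘ e.symm) (F ∘ e'.symm) (fun w => e' (e.symm w)) (e.target ∩ e.symm ⁻¹' e'.source)
      e'.target where
  source :=
    { isOpen := e.symm.isOpen_inter_preimage e'.open_source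
      fst := fun _ hu => (hF.almostComplexOn he).fst _ hu.1
      snd := fun _ hu => (hF.almostComplexOn he).snd _ hu.1 }
  target := (hF.almostComplexOn he').toSmoothOn
  mapsTo u hu := e'.map_source hu.2
  smooth u hu := by
    have h1 := (contMDiffOn_of_mem_maximalAtlas he').comp'
      (contMDiffOn_symm_of_mem_maximalAtlas he)
    exact (contMDiffOn_iff_contDiffOn.1 h1).contDiffAt
      ((e.symm.isOpen_inter_preimage e'.open_source).mem_nhds hu)
  comp u hu := by simp [e'.left_inv hu.2]

omit [ChartedSpace (EuclideanSpace ℝ (Fin 2)) M] [IsManifold (𝓡 2) ∞ M] in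
theorem mem_overlap {e e' : OpenPartialHomeomorph M (EuclideanSpace ℝ (Fin 2))} {p : M}
    (hp : p ∈ e.source) (hp' : p ∈ e'.source) : e p ∈ e.target ∩ e.symm ⁻¹' e'.source :=
  ⟨e.map_source hp, by simpa [e.left_inv hp] using hp'⟩

omit [IsManifold (𝓡 2) ∞ M] in
theorem tangentPlane_eq (hF : IsAlmostComplexSurface F)
    {e e' : OpenPartialHomeomorph M (EuclideanSpace ℝ (Fin 2))}
    (he : e ∈ IsManifold.maximalAtlas (𝓡 2) ∞ M) (he' : e' ∈ IsManifold.maximalAtlas (𝓡 2) ∞ M)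
    {p : M} (hp : p ∈ e.source) (hp' : p ∈ e'.source) :
    tangentPlane (F ∘ e.symm) (e p) = tangentPlane (F ∘ e'.symm) (e' p) := by
  apply le_antisymm
  · simpa [e.left_inv hp] using (reparam hF he he').tangentPlane_le (mem_overlap hp hp')
  · simpa [e'.left_inv hp'] using (reparam hF he' he).tangentPlane_le (mem_overlap hp' hp)

omit [IsManifold (𝓡 2) ∞ M] in
/-- The property `h = 0` at a point does not depend on the chart. -/
theorem secondForm_eq_zero_change (hF : IsAlmostComplexSurface F)
    {e e' : OpenPartialHomeomorph M (EuclideanSpace ℝ (Fin 2))}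
    (he : e ∈ IsManifold.maximalAtlas (𝓡 2) ∞ M) (he' : e' ∈ IsManifold.maximalAtlas (𝓡 2) ∞ M)
    {p : M} (hp : p ∈ e.source) (hp' : p ∈ e'.source)
    (h : ∀ i j, secondForm (F ∘ e'.symm) i j (e' p) = 0) (i j : Fin 2) :
    secondForm (F ∘ e.symm) i j (e p) = 0 := by
  have hn := hF.nondegenerate e he _ (e.map_source hp)
  have hn' := hF.nondegenerate e' he' _ (e'.map_source hp')
  have h1 := (reparam hF he he').covDeriv_frame_mem (mem_overlap hp hp') (by
    simp only [e.left_inv hp]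
    exact fun i j => (normalPart_eq_zero_iff hn').1 (h i j)) i j
  simp only [e.left_inv hp] at h1
  rw [← tangentPlane_eq hF he he' hp hp'] at h1
  exact (normalPart_eq_zero_iff hn).2 h1

/-- Two complementary open properties of points, one of which holds on a connected surface. -/
theorem inCharts_or [ConnectedSpace M] {Q₁ Q₂ : (Plane → Ambient) → Plane → Prop}
    (hQ₁ : ∀ e ∈ IsManifold.maximalAtlas (𝓡 2) ∞ M, ∀ e' ∈ IsManifold.maximalAtlas (𝓡 2) ∞ M,
      ∀ p ∈ e.source, p ∈ e'.source → Q₁ (F ∘ e.symm) (e p) → Q₁ (F ∘ e'.symm) (e' p))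
    (hor : InCharts F fun f u => Q₁ f u ∨ Q₂ f u)
    (hnot : InCharts F fun f u => Q₁ f u → Q₂ f u → False)
    (ho₁ : InCharts F fun f u => Q₁ f u → ∀ᶠ w in 𝓝 u, Q₁ f w)
    (ho₂ : InCharts F fun f u => Q₂ f u → ∀ᶠ w in 𝓝 u, Q₂ f w) :
    InCharts F Q₁ ∨ InCharts F Q₂ := by
  have hc : ∀ p, chartAt (EuclideanSpace ℝ (Fin 2)) p ∈ IsManifold.maximalAtlas (𝓡 2) ∞ M :=
    fun p => IsManifold.chart_mem_maximalAtlas p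
  -- Membership is tested in the preferred chart; `hQ₁` makes it independent of the chart.
  set S : Set M := {p | Q₁ (F ∘ (chartAt (EuclideanSpace ℝ (Fin 2)) p).symm)
    (chartAt (EuclideanSpace ℝ (Fin 2)) p p)} with hS
  have hmem : ∀ e ∈ IsManifold.maximalAtlas (𝓡 2) ∞ M, ∀ p ∈ e.source,
      (p ∈ S ↔ Q₁ (F ∘ e.symm) (e p)) := fun e he p hp =>
    ⟨hQ₁ _ (hc p) e he p (mem_chart_source _ p) hp, hQ₁ e he _ (hc p) p hp (mem_chart_source _ p)⟩
  have hopen : IsOpen S := by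
    rw [isOpen_iff_mem_nhds]
    intro p hp
    set e := chartAt (EuclideanSpace ℝ (Fin 2)) p
    have hps : p ∈ e.source := mem_chart_source _ p
    have h1 := (e.continuousAt hps).eventually (ho₁ e (hc p) (e p) (e.map_source hps) hp)
    filter_upwards [h1, e.open_source.mem_nhds hps] with q hq hqs
    exact (hmem e (hc p) q hqs).2 hq
  have hclosed : IsClosed S := by
    rw [← isOpen_compl_iff, isOpen_iff_mem_nhds]
    intro p hp
    set e := chartAt (EuclideanSpace ℝ (Fin 2)) p
    have hps : p ∈ e.source := mem_chart_source _ p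
    have h2 := (hor e (hc p) (e p) (e.map_source hps)).resolve_left hp
    have h1 := (e.continuousAt hps).eventually (ho₂ e (hc p) (e p) (e.map_source hps) h2)
    filter_upwards [h1, e.open_source.mem_nhds hps] with q hq hqs
    exact fun hqS => hnot e (hc p) (e q) (e.map_source hqs) ((hmem e (hc p) q hqs).1 hqS) hq
  rcases isClopen_iff.1 ⟨hclosed, hopen⟩ with h | h
  · right
    intro e he u hu
    refine (hor e he u hu).resolve_left fun h1 => ?_
    have h2 := (hmem e he (e.symm u) (e.map_target hu)).2 (by rwa [e.right_inv hu])
    rw [h] at h2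
    exact h2
  · left
    intro e he u hu
    have h2 := (hmem e he (e.symm u) (e.map_target hu)).1 (by rw [h]; trivial)
    rwa [e.right_inv hu] at h2

variable [ConnectedSpace M]

theorem pMapsTangentToNormal_or_pPreservesTangent (hF : IsAlmostComplexSurface F)
    (hp : HasParallelSecondForm F) : PMapsTangentToNormal F ∨ PPreservesTangent F := by
  refine inCharts_or (Q₁ := PNormalAt) (Q₂ := PTangentAt) ?_ ?_ ?_ ?_ ?_
  · intro e he e' he' p h1 h2 h
    rw [PNormalAt, tangentPlane_eq hF he he' h1 h2] at h
    exact h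
  · exact fun e he u hu => (hF.almostComplexOn he).pNormalAt_or_pTangentAt (parallelOn hF hp he) hu
  · exact fun e he u hu => (hF.almostComplexOn he).not_pNormalAt_and_pTangentAt hu
  · exact fun e he u hu => (hF.almostComplexOn he).eventually_pNormalAt (parallelOn hF hp he) hu
  · exact fun e he u hu => (hF.almostComplexOn he).eventually_pTangentAt (parallelOn hF hp he) hu

theorem curvature_of_pMapsTangentToNormal (hF : IsAlmostComplexSurface F)
    (hp : HasParallelSecondForm F) (hP : PMapsTangentToNormal F) :
    (IsTotallyGeodesic F ∧ HasConstantCurvature F (-4 / 3)) ∨ HasConstantCurvature F (-5 / 9) := by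
  have key : IsTotallyGeodesic F ∨ InCharts F fun f u => ¬ ∀ i j, secondForm f i j u = 0 := by
    refine inCharts_or ?_ ?_ ?_ ?_ ?_
    · exact fun e he e' he' p h1 h2 h => secondForm_eq_zero_change hF he' he h2 h1 h
    · exact fun e he u hu => em _
    · exact fun e he u hu h1 h2 => h2 h1
    · intro e he u hu h
      have ha := hF.almostComplexOn he
      filter_upwards [ha.eventually_secondForm_eq_zero (parallelOn hF hp he) (hP e he) hu (h 1 1),
        e.open_target.mem_nhds hu] with w h1 hw
      exact ha.totallyGeodesic_of_secondForm hw h1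
    · intro e he u hu h
      have ha := hF.almostComplexOn he
      have h1 : secondForm (F ∘ e.symm) 1 1 u ≠ 0 := fun h1 =>
        h (ha.totallyGeodesic_of_secondForm hu h1)
      filter_upwards [ha.eventually_secondForm_ne_zero hu h1] with w h2 h3
      exact h2 (h3 1 1)
  rcases key with h | h
  · exact Or.inl ⟨h, fun e he u hu => (hF.almostComplexOn he
      ).gaussCurvature_of_pNormal_of_totallyGeodesic (hP e he u hu) hu (h e he u hu 1 1)⟩
  · refine Or.inr fun e he u hu => ?_
    have ha := hF.almostComplexOn he
    exact (ha.curvature_of_pNormal (parallelOn hF hp he) (hP e he) hu).resolve_left fun h1 =>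
      h e he u hu (ha.totallyGeodesic_of_secondForm hu h1)

/-- If `P` preserves the tangent planes, they are all the same plane `{(sα, tα)}`. -/
theorem exists_constant_line (hF : IsAlmostComplexSurface F) (hP : PPreservesTangent F) :
    ∃ α : Mat2, matInner α α ≠ 0 ∧ α 1 1 = -α 0 0 ∧
      InCharts F fun f u => tangentPlane f u = lineProd α := by
  have hc : ∀ p, chartAt (EuclideanSpace ℝ (Fin 2)) p ∈ IsManifold.maximalAtlas (𝓡 2) ∞ M :=
    fun p => IsManifold.chart_mem_maximalAtlas p
  -- Left trivialisation puts all tangent planes in one vector space, so they can be compared at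
  -- different points.
  set T : M → Submodule ℝ Vec := fun p =>
    tangentPlane (F ∘ (chartAt (EuclideanSpace ℝ (Fin 2)) p).symm)
      (chartAt (EuclideanSpace ℝ (Fin 2)) p p) with hT
  have hTe : ∀ e ∈ IsManifold.maximalAtlas (𝓡 2) ∞ M, ∀ p ∈ e.source,
      tangentPlane (F ∘ e.symm) (e p) = T p := fun e he p hp =>
    tangentPlane_eq hF he (hc p) hp (mem_chart_source _ p)
  have hloc : IsLocallyConstant T := by
    rw [IsLocallyConstant.iff_eventually_eq]
    intro p
    set e := chartAt (EuclideanSpace ℝ (Fin 2)) p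
    have hps : p ∈ e.source := mem_chart_source _ p
    have h1 := (e.continuousAt hps).eventually ((hF.almostComplexOn (hc p)
      ).eventually_tangentPlane_eq (hP e (hc p)) (e.map_source hps))
    filter_upwards [h1, e.open_source.mem_nhds hps] with q hq hqs
    rw [← hTe e (hc p) q hqs, hq]
  obtain ⟨p⟩ := (inferInstance : Nonempty M)
  set e := chartAt (EuclideanSpace ℝ (Fin 2)) p
  have hps : e p ∈ e.target := e.map_source (mem_chart_source _ p)
  have ha := hF.almostComplexOn (hc p)
  obtain ⟨α, h1, h2⟩ := ha.exists_lineProd hps (hP e (hc p) _ hps)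
  refine ⟨α, h1, ?_, fun e' he' u hu => ?_⟩
  · have h3 : ((α, 0) : Vec) ∈ tangentPlane (F ∘ e.symm) (e p) := by
      rw [h2]; exact ⟨1, 0, by simp⟩
    obtain ⟨a, b, h4⟩ := mem_tangentPlane.1 h3
    have h5 : TraceFree (α, 0) := by
      rw [h4]
      exact ((ha.frame_traceFree hps 0).smul a).add ((ha.frame_traceFree hps 1).smul b)
    exact h5.1
  · have h3 := hTe e' he' (e'.symm u) (e'.map_target hu)
    rw [e'.right_inv hu] at h3
    change tangentPlane _ _ = _
    rw [h3, hloc.apply_eq_of_isPreconnected isPreconnected_univ (Set.mem_univ _) (Set.mem_univ p),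
      ← h2]

end Charts

/-! ### Adapted coordinates -/

section Coordinates

open Filter Topology

/-- The map with coordinates `s` and `t`. -/
def pairMap (s t : Plane → ℝ) (w : Plane) : Plane :=
  s w • EuclideanSpace.single 0 1 + t w • EuclideanSpace.single 1 1

theorem pairMap_zero (s t : Plane → ℝ) (w : Plane) : pairMap s t w 0 = s w := by simp [pairMap]

theorem pairMap_one (s t : Plane → ℝ) (w : Plane) : pairMap s t w 1 = t w := by simp [pairMap]

theorem sm_pairMap {s t : Plane → ℝ} {u : Plane} (hs : Sm s u) (ht : Sm t u) :
    Sm (pairMap s t) u :=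
  (hs.fsmul contDiffAt_const).add (ht.fsmul contDiffAt_const)

variable {M : Type*} [TopologicalSpace M] [ChartedSpace (EuclideanSpace ℝ (Fin 2)) M]
  [IsManifold (𝓡 2) ∞ M]

/-- Functions with independent differentials are the coordinates of a chart. -/
theorem exists_chart {e : OpenPartialHomeomorph M (EuclideanSpace ℝ (Fin 2))}
    (he : e ∈ IsManifold.maximalAtlas (𝓡 2) ∞ M) {p : M} (hp : p ∈ e.source) {V : Set Plane}
    (hV : IsOpen V) (hpV : e p ∈ V) {s t : Plane → ℝ} (hs : ∀ w ∈ V, Sm s w)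
    (ht : ∀ w ∈ V, Sm t w)
    (hi : ∀ w ∈ V, ∀ a b : ℝ, a * pd 0 s w + b * pd 1 s w = 0 → a * pd 0 t w + b * pd 1 t w = 0 →
      a = 0 ∧ b = 0) :
    ∃ e' ∈ IsManifold.maximalAtlas (𝓡 2) ∞ M, p ∈ e'.source ∧ e'.source ⊆ e.source ∧
      ∀ q ∈ e'.source, e q ∈ V ∧ e' q 0 = s (e q) ∧ e' q 1 = t (e q) := by
  have hsm : ∀ w ∈ V, Sm (pairMap s t) w := fun w hw => sm_pairMap (hs w hw) (ht w hw)
  have hinj : ∀ w ∈ V, Function.Injective (fderiv ℝ (pairMap s t) w).toLinearMap := by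
    intro w hw
    rw [← LinearMap.ker_eq_bot, LinearMap.ker_eq_bot']
    intro v hv
    have hv' : v 0 • pdV 0 (pairMap s t) w + v 1 • pdV 1 (pairMap s t) w = 0 := by
      rw [plane_eq_sum v] at hv
      simpa [pdV] using hv
    have hc0 : ∀ i, coordL 0 (pdV i (pairMap s t) w) = pd i s w := fun i => by
      rw [← pdV_linear (coordL 0) i (hsm w hw), pd_eq_pdV]
      exact congrArg (pdV i · w) (funext fun w => pairMap_zero s t w)
    have hc1 : ∀ i, coordL 1 (pdV i (pairMap s t) w) = pd i t w := fun i => by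
      rw [← pdV_linear (coordL 1) i (hsm w hw), pd_eq_pdV]
      exact congrArg (pdV i · w) (funext fun w => pairMap_one s t w)
    have h0 := congrArg (coordL 0) hv'
    have h1 := congrArg (coordL 1) hv'
    simp only [map_add, map_smul, map_zero, smul_eq_mul, hc0, hc1] at h0 h1
    obtain ⟨a0, b0⟩ := hi w hw _ _ h0 h1
    rw [plane_eq_sum v, a0, b0]; simp
  -- Invertibility is needed at all points of V, not just at the centre, since the inverse has to be
  -- smooth on its whole domain.
  have hequiv : ∀ w ∈ V, ∃ L : Plane ≃L[ℝ] Plane,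
      HasFDerivAt (pairMap s t) (L : Plane →L[ℝ] Plane) w := by
    intro w hw
    refine ⟨(LinearEquiv.ofInjectiveEndo _ (hinj w hw)).toContinuousLinearEquiv, ?_⟩
    have h : ((LinearEquiv.ofInjectiveEndo _ (hinj w hw)).toContinuousLinearEquiv :
        Plane →L[ℝ] Plane) = fderiv ℝ (pairMap s t) w := by
      ext v : 1; rfl
    rw [h]
    exact (hsm w hw).diff.hasFDerivAt
  obtain ⟨L, hL⟩ := hequiv _ hpV
  set ψ := ((hsm _ hpV).toOpenPartialHomeomorph (pairMap s t) hL (by simp)).restrOpen V hV with hψ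
  have hψsrc : ψ.source ⊆ V := fun w hw => hw.2
  have hψp : e p ∈ ψ.source :=
    ⟨(hsm _ hpV).mem_toOpenPartialHomeomorph_source hL (by simp), hpV⟩
  have hψc : ∀ w, ψ w = pairMap s t w := fun w => rfl
  refine ⟨e.trans ψ, ?_, ?_, ?_, ?_⟩
  · apply OpenPartialHomeomorph.mem_maximalAtlas_of_contMDiffOn
    · have h1 : ContMDiffOn (𝓡 2) (𝓡 2) ∞ ψ ψ.source := contMDiffOn_iff_contDiffOn.2
        fun w hw => ContDiffAt.contDiffWithinAt (hsm w (hψsrc hw))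
      exact h1.comp' (contMDiffOn_of_mem_maximalAtlas he)
    · have h1 : ContMDiffOn (𝓡 2) (𝓡 2) ∞ ψ.symm ψ.target := by
        refine contMDiffOn_iff_contDiffOn.2 fun w hw => ContDiffAt.contDiffWithinAt ?_
        have hw' := hψsrc (ψ.map_target hw)
        obtain ⟨L', hL'⟩ := hequiv _ hw'
        exact ψ.contDiffAt_symm hw hL' (hsm _ hw')
      exact (contMDiffOn_symm_of_mem_maximalAtlas he).comp' h1
  · exact ⟨hp, hψp⟩
  · exact fun q hq => hq.1
  · intro q hq
    refine ⟨hψsrc hq.2, ?_, ?_⟩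
    · change pairMap s t (e q) 0 = _
      rw [pairMap_zero]
    · change pairMap s t (e q) 1 = _
      rw [pairMap_one]

/-- A map on a connected surface with vanishing derivatives is constant. -/
theorem const_of_pdV_eq_zero_inCharts [ConnectedSpace M] {V : Type*} [NormedAddCommGroup V]
    [NormedSpace ℝ V] {φ : M → V}
    (h : ∀ e ∈ IsManifold.maximalAtlas (𝓡 2) ∞ M, ∀ u ∈ e.target,
      Sm (fun w => φ (e.symm w)) u ∧ ∀ i, pdV i (fun w => φ (e.symm w)) u = 0) (p q : M) :
    φ p = φ q := by
  have hloc : IsLocallyConstant φ := by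
    rw [IsLocallyConstant.iff_eventually_eq]
    intro p
    set e := chartAt (EuclideanSpace ℝ (Fin 2)) p
    have he : e ∈ IsManifold.maximalAtlas (𝓡 2) ∞ M := IsManifold.chart_mem_maximalAtlas p
    have hps : p ∈ e.source := mem_chart_source _ p
    have h1 := (e.continuousAt hps).eventually (const_of_pdV_eq_zero e.open_target
      (e.map_source hps) (fun w hw => (h e he w hw).1) fun w hw => (h e he w hw).2)
    filter_upwards [h1, e.open_source.mem_nhds hps] with r hr hrs
    simpa [e.left_inv hrs, e.left_inv hps] using hr
  exact hloc.apply_eq_of_isPreconnected isPreconnected_univ (Set.mem_univ _) (Set.mem_univ _)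

end Coordinates

/-! ### One-parameter groups -/

section OneParameter

open Filter Topology

/-- A constant left factor disappears from C⁻¹∂C and a constant right factor conjugates it. -/
theorem maurer_mul_const {C : Plane → SL2} {u : Plane} (h : Sm (fun w => (C w : Mat2)) u)
    (a c : SL2) (i : Fin 2) :
    maurer (fun w => a * C w * c) i u = adjL (c : Mat2) * maurer C i u * (c : Mat2) := by
  have h1 := pdV_linear (LinearMap.mulLeft ℝ (a : Mat2) ∘ₗ LinearMap.mulRight ℝ (c : Mat2)) i h
  simp only [LinearMap.comp_apply, LinearMap.mulLeft_apply, LinearMap.mulRight_apply] at h1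
  have h2 : adjL ((a * C u * c : SL2) : Mat2)
      = adjL (c : Mat2) * (adjL (C u : Mat2) * adjL (a : Mat2)) := by
    rw [← coe_inv_eq_adjL, mul_inv_rev, mul_inv_rev, Matrix.SpecialLinearGroup.coe_mul,
      Matrix.SpecialLinearGroup.coe_mul, coe_inv_eq_adjL, coe_inv_eq_adjL, coe_inv_eq_adjL]
  have h3 : (fun w => ((a * C w * c : SL2) : Mat2)) = fun w => (a : Mat2) * ((C w : Mat2) * c) := by
    funext w
    rw [Matrix.SpecialLinearGroup.coe_mul, Matrix.SpecialLinearGroup.coe_mul, mul_assoc]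
  rw [maurer, h2, h3, h1, maurer]
  simp only [mul_assoc]
  rw [← mul_assoc (adjL (a : Mat2)) (a : Mat2), adjL_mul_coe, one_mul]

theorem sm_mul_const {C : Plane → SL2} {u : Plane} (h : Sm (fun w => (C w : Mat2)) u)
    (a c : SL2) : Sm (fun w => ((a * C w * c : SL2) : Mat2)) u := by
  have h1 := h.linear (LinearMap.mulLeft ℝ (a : Mat2) ∘ₗ LinearMap.mulRight ℝ (c : Mat2))
  refine h1.congr (Eventually.of_forall fun w => ?_)
  simp [mul_assoc]

/-- The properties of the one-parameter group `E` with generator `ε` that are used below. -/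
structure OneParam (E : ℝ → SL2) (ε : Mat2) : Prop where
  maurer_comp : ∀ (x : Plane → ℝ) (u : Plane) (i : Fin 2), Sm x u →
    maurer (fun w => E (x w)) i u = pd i x u • ε
  exists_lift : ∀ (g : Plane → SL2) (U : Set Plane), IsOpen U →
    (∀ w ∈ U, Sm (fun w => (g w : Mat2)) w) → (∀ w ∈ U, g w ∈ Set.range E) → ∀ u ∈ U,
    ∃ V ⊆ U, IsOpen V ∧ u ∈ V ∧ ∃ x : Plane → ℝ, ∀ w ∈ V, Sm x w ∧ g w = E (x w)
  -- Connectedness serves the hyperbolic case, where the centraliser of ε also contains the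
  -- component of -1.
  mem_range : ∀ S : Set SL2, IsPreconnected ((fun A : SL2 => (A : Mat2)) '' S) → 1 ∈ S →
    (∀ A ∈ S, (A : Mat2) * ε = ε * (A : Mat2)) → S ⊆ Set.range E

theorem maurer_comp_of_hasDerivAt {E : ℝ → SL2} {ε : Mat2}
    (hsm : ∀ a b, ContDiff ℝ ∞ fun r => (E r : Mat2) a b)
    (hd : ∀ r a b, HasDerivAt (fun r => (E r : Mat2) a b) (((E r : Mat2) * ε) a b) r)
    (x : Plane → ℝ) (u : Plane) (i : Fin 2) (hx : Sm x u) :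
    maurer (fun w => E (x w)) i u = pd i x u • ε := by
  have hs : Sm (fun w => (E (x w) : Mat2)) u :=
    sm_matrix fun a b => (hsm a b).contDiffAt.comp u hx
  have h1 : pdV i (fun w => (E (x w) : Mat2)) u = pd i x u • ((E (x u) : Mat2) * ε) := by
    rw [← pdMat_eq_pdV i hs]
    ext a b
    have := ((hd (x u) a b).comp_hasFDerivAt u hx.diff.hasFDerivAt).fderiv
    simp only [pdMat, pd, Matrix.of_apply]
    change fderiv ℝ ((fun r => (E r : Mat2) a b) ∘ x) u _ = _
    rw [this]
    simp [mul_comm]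
  rw [maurer, h1, mul_smul_comm, ← mul_assoc, adjL_mul_coe, one_mul]

theorem oneParam_hyperbolic : OneParam hyperbolicElt !![1, 0; 0, -1] where
  maurer_comp := by
    refine maurer_comp_of_hasDerivAt (fun a b => ?_) (fun r a b => ?_)
    · fin_cases a <;> fin_cases b <;> simp [hyperbolicElt] <;> fun_prop
    · fin_cases a <;> fin_cases b <;>
        simp [hyperbolicElt, Matrix.mul_apply, Fin.sum_univ_two]
      · exact Real.hasDerivAt_exp r
      · exact hasDerivAt_const _ _
      · exact hasDerivAt_const _ _
      · simpa using (hasDerivAt_neg r).exp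
  exists_lift g U hU hg hr u hu := by
    have hpos : ∀ w ∈ U, 0 < (g w : Mat2) 0 0 := by
      intro w hw
      obtain ⟨x, hx⟩ := hr w hw
      rw [← hx]; simp [hyperbolicElt, Real.exp_pos]
    refine ⟨U, subset_rfl, hU, hu, fun w => Real.log ((g w : Mat2) 0 0), fun w hw => ⟨?_, ?_⟩⟩
    · exact ContDiffAt.log ((hg w hw).linear (entryL 0 0)) (hpos w hw).ne'
    · obtain ⟨x, hx⟩ := hr w hw
      have h00 : (g w : Mat2) 0 0 = Real.exp x := by rw [← hx]; simp [hyperbolicElt]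
      have hlog : Real.log ((g w : Mat2) 0 0) = x := by rw [h00, Real.log_exp]
      exact hx.symm.trans (congrArg hyperbolicElt hlog.symm)
  mem_range S hconn h1 hcomm A hA := by
    have e : ∀ A ∈ S, (A : Mat2) 0 1 = 0 ∧ (A : Mat2) 1 0 = 0 := by
      intro A hA
      have h01 := congrFun (congrFun (hcomm A hA) 0) 1
      have h10 := congrFun (congrFun (hcomm A hA) 1) 0
      simp [Matrix.mul_apply, Fin.sum_univ_two] at h01 h10
      exact ⟨by linarith, by linarith⟩
    have hdet : ∀ A ∈ S, (A : Mat2) 0 0 * (A : Mat2) 1 1 = 1 := by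
      intro A hA
      have := A.det_coe
      rw [Matrix.det_fin_two, (e A hA).1, zero_mul, sub_zero] at this
      exact this
    -- The upper left entries form an interval containing 1. If one were nonpositive, 0 would occur
    -- among them, against determinant 1.
    have hpos : 0 < (A : Mat2) 0 0 := by
      by_contra! hle
      have hc : Continuous fun m : Mat2 => m 0 0 := continuous_id.matrix_elem 0 0
      have hI := (hconn.image _ hc.continuousOn).ordConnected.out
        (Set.mem_image_of_mem _ (Set.mem_image_of_mem _ hA))
        (Set.mem_image_of_mem _ (Set.mem_image_of_mem _ h1))
      obtain ⟨_, ⟨B, hB, rfl⟩, hB0⟩ := hI (show (0 : ℝ) ∈ _ from ⟨hle, by simp⟩)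
      have := hdet B hB
      rw [show (B : Mat2) 0 0 = 0 from hB0, zero_mul] at this
      exact zero_ne_one this
    refine ⟨Real.log ((A : Mat2) 0 0), ?_⟩
    ext a b
    have h11 : ((A : Mat2) 0 0)⁻¹ = (A : Mat2) 1 1 := inv_eq_of_mul_eq_one_right (hdet A hA)
    fin_cases a <;> fin_cases b <;>
      simp [hyperbolicElt, Real.exp_log hpos, Real.exp_neg, e A hA, h11]

theorem oneParam_elliptic : OneParam ellipticElt !![0, 1; -1, 0] where
  maurer_comp := by
    refine maurer_comp_of_hasDerivAt (fun a b => ?_) (fun r a b => ?_)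
    · fin_cases a <;> fin_cases b <;> simp [ellipticElt] <;> fun_prop
    · fin_cases a <;> fin_cases b <;>
        simp [ellipticElt, Matrix.mul_apply, Fin.sum_univ_two]
      · exact Real.hasDerivAt_cos r
      · exact Real.hasDerivAt_sin r
      · exact (Real.hasDerivAt_sin r).neg
      · exact Real.hasDerivAt_cos r
  exists_lift g U hU hg hr u hu := by
    obtain ⟨θ, hθ⟩ := hr u hu
    -- Sine and cosine of the angle measured from θ. Where this cosine is positive, θ plus the
    -- arcsine is a smooth angle.
    set S : Plane → ℝ := fun w =>
      Real.cos θ * (g w : Mat2) 0 1 - Real.sin θ * (g w : Mat2) 0 0 with hS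
    set C : Plane → ℝ := fun w =>
      Real.cos θ * (g w : Mat2) 0 0 + Real.sin θ * (g w : Mat2) 0 1 with hC
    have sS : ∀ w ∈ U, Sm S w := fun w hw =>
      (contDiffAt_const.mul ((hg w hw).linear (entryL 0 1))).sub
        (contDiffAt_const.mul ((hg w hw).linear (entryL 0 0)))
    have sC : ∀ w ∈ U, Sm C w := fun w hw =>
      (contDiffAt_const.mul ((hg w hw).linear (entryL 0 0))).add
        (contDiffAt_const.mul ((hg w hw).linear (entryL 0 1)))
    have hSC : ∀ w ∈ U, ∃ x, g w = ellipticElt x ∧ S w = Real.sin (x - θ) ∧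
        C w = Real.cos (x - θ) := by
      intro w hw
      obtain ⟨x, hx⟩ := hr w hw
      refine ⟨x, hx.symm, ?_, ?_⟩
      · simp [hS, ← hx, ellipticElt, Real.sin_sub]; ring
      · simp [hC, ← hx, ellipticElt, Real.cos_sub]; ring
    refine ⟨U ∩ C ⁻¹' Set.Ioi 0, Set.inter_subset_left, ContinuousOn.isOpen_inter_preimage
      (fun w hw => (sC w hw).continuousAt.continuousWithinAt) hU isOpen_Ioi, ⟨hu, ?_⟩,
      fun w => θ + Real.arcsin (S w), ?_⟩
    · simp [hC, ← hθ, ellipticElt]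
      nlinarith [Real.sin_sq_add_cos_sq θ]
    · rintro w ⟨hw, hCw⟩
      obtain ⟨x, hx, h1, h2⟩ := hSC w hw
      have hCw' : 0 < C w := hCw
      have hsq : S w ^ 2 + C w ^ 2 = 1 := by rw [h1, h2, Real.sin_sq_add_cos_sq]
      have n1 : S w ≠ -1 := by intro h; rw [h] at hsq; nlinarith
      have n2 : S w ≠ 1 := by intro h; rw [h] at hsq; nlinarith
      refine ⟨contDiffAt_const.add ((Real.contDiffAt_arcsin n1 n2).comp w (sS w hw)), ?_⟩
      have hb : -1 ≤ S w ∧ S w ≤ 1 := by constructor <;> nlinarith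
      have c1 : Real.cos (Real.arcsin (S w)) = C w := by
        rw [Real.cos_arcsin, show 1 - S w ^ 2 = C w ^ 2 by linarith, Real.sqrt_sq hCw'.le]
      have s1 : Real.sin (Real.arcsin (S w)) = S w := Real.sin_arcsin hb.1 hb.2
      have hc : Real.cos (θ + Real.arcsin (S w)) = Real.cos x := by
        rw [Real.cos_add, c1, s1, h1, h2, ← Real.cos_add]; congr 1; ring
      have hs : Real.sin (θ + Real.arcsin (S w)) = Real.sin x := by
        rw [Real.sin_add, c1, s1, h1, h2, ← Real.sin_add]; congr 1; ring
      rw [hx]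
      ext a b
      fin_cases a <;> fin_cases b <;> simp [ellipticElt, hc, hs]
  mem_range S _ _ hcomm A hA := by
    have h01 := congrFun (congrFun (hcomm A hA) 0) 1
    have h00 := congrFun (congrFun (hcomm A hA) 0) 0
    simp [Matrix.mul_apply, Fin.sum_univ_two] at h01 h00
    have hdet := A.det_coe
    rw [Matrix.det_fin_two] at hdet
    have hcirc : (A : Mat2) 0 0 ^ 2 + (A : Mat2) 0 1 ^ 2 = 1 := by
      rw [← h01, ← h00] at hdet
      linarith
    have hn : ‖(⟨(A : Mat2) 0 0, (A : Mat2) 0 1⟩ : ℂ)‖ = 1 := by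
      rw [← sq_eq_sq₀ (norm_nonneg _) zero_le_one, Complex.sq_norm, Complex.normSq_mk]
      linarith
    refine ⟨Complex.arg ⟨(A : Mat2) 0 0, (A : Mat2) 0 1⟩, ?_⟩
    have hne : (⟨(A : Mat2) 0 0, (A : Mat2) 0 1⟩ : ℂ) ≠ 0 := by
      intro h; rw [h, norm_zero] at hn; exact zero_ne_one hn
    have hcos := Complex.cos_arg hne
    have hsin := Complex.sin_arg (⟨(A : Mat2) 0 0, (A : Mat2) 0 1⟩ : ℂ)
    rw [hn, div_one] at hcos hsin
    ext a b
    fin_cases a <;> fin_cases b <;> simp [ellipticElt, hcos, hsin]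
    · linarith
    · linarith

end OneParameter

/-! ### Normal forms of trace-free matrices -/

/-- The eigenvalues are ±k. For v = (x,y) the vectors (α + k)v and (α - k)v are eigenvectors and
serve as columns of c, the first divided by 2kD to make the determinant 1. -/
theorem exists_conj_hyperbolic {α : Mat2} (ht : α 1 1 = -α 0 0) (h : 0 < matInner α α) :
    ∃ (c : SL2) (k : ℝ), k ≠ 0 ∧
      α = k • ((c : Mat2) * !![1, 0; 0, -1] * adjL (c : Mat2)) := by
  rw [matInner_eq, ht] at h
  set p := α 0 0 with hp
  set q := α 0 1 with hq
  set r := α 1 0 with hr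
  set k := √(p ^ 2 + q * r) with hk
  have hk2 : k ^ 2 = p ^ 2 + q * r := Real.sq_sqrt (by linarith)
  have hk0 : k ≠ 0 := by intro h0; rw [h0] at hk2; nlinarith
  -- D = det(v, αv) is nonzero exactly when v is not an eigenvector.
  obtain ⟨x, y, hD⟩ : ∃ x y : ℝ, r * x ^ 2 - 2 * p * x * y - q * y ^ 2 ≠ 0 := by
    by_cases hr0 : r = 0
    · by_cases hq0 : q = 0
      · refine ⟨1, 1, ?_⟩
        intro h0
        rw [hr0, hq0] at h0
        have : p = 0 := by linarith
        rw [this, hq0] at h; norm_num at h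
      · exact ⟨0, 1, by simpa using hq0⟩
    · exact ⟨1, 0, by simpa using hr0⟩
  set D := r * x ^ 2 - 2 * p * x * y - q * y ^ 2 with hDdef
  have hdet : Matrix.det !![(p * x + q * y + k * x) / (2 * k * D), p * x + q * y - k * x;
      (r * x - p * y + k * y) / (2 * k * D), r * x - p * y - k * y] = 1 := by
    rw [Matrix.det_fin_two_of]
    field_simp
    rw [hDdef]; ring
  refine ⟨⟨_, hdet⟩, k, hk0, ?_⟩
  ext i j
  fin_cases i <;> fin_cases j <;>
    simp [adjL, Matrix.adjugate_fin_two, ← hp, ← hq, ← hr, ht]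
  · field_simp
    rw [hDdef]
    linear_combination (2 * x * y) * hk2
  · field_simp
    rw [hDdef]
    linear_combination (-2 * x ^ 2) * hk2
  · field_simp
    rw [hDdef]
    linear_combination (2 * y ^ 2) * hk2
  · field_simp
    rw [hDdef]
    linear_combination (-2 * x * y) * hk2

/-- Here α² = -k². The columns of c are v = (t,0) and w = -(1/k)αv, so that αv = -kw and αw = kv. -/
theorem exists_conj_elliptic {α : Mat2} (ht : α 1 1 = -α 0 0) (h : matInner α α < 0) :
    ∃ (c : SL2) (k : ℝ), k ≠ 0 ∧
      α = k • ((c : Mat2) * !![0, 1; -1, 0] * adjL (c : Mat2)) := by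
  rw [matInner_eq, ht] at h
  set p := α 0 0 with hp
  set q := α 0 1 with hq
  set r := α 1 0 with hr
  have hr0 : r ≠ 0 := by intro h0; rw [h0] at h; nlinarith [sq_nonneg p]
  -- Determinant 1 requires t² = -k/r, which fixes the sign of k: conjugation by SL(2,ℝ) cannot
  -- reverse the sense of a rotation.
  obtain ⟨k, hk2, hkr⟩ : ∃ k : ℝ, k ^ 2 = -(p ^ 2 + q * r) ∧ k * r < 0 := by
    have hs : √(-(p ^ 2 + q * r)) ^ 2 = -(p ^ 2 + q * r) := Real.sq_sqrt (by linarith)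
    have hs0 : 0 < √(-(p ^ 2 + q * r)) := Real.sqrt_pos.2 (by linarith)
    rcases lt_or_gt_of_ne hr0 with h1 | h1
    · exact ⟨_, hs, mul_neg_of_pos_of_neg hs0 h1⟩
    · exact ⟨_, (neg_sq _).trans hs, mul_neg_of_neg_of_pos (neg_neg_of_pos hs0) h1⟩
  have hk0 : k ≠ 0 := by intro h0; rw [h0] at hkr; simp at hkr
  set t := √(-(k / r)) with htdef
  have ht2 : t ^ 2 = -(k / r) := Real.sq_sqrt (by
    have : k / r = k * r / r ^ 2 := by field_simp
    rw [this, neg_nonneg]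
    exact div_nonpos_of_nonpos_of_nonneg hkr.le (sq_nonneg r))
  have ht2' : t ^ 2 * r = -k := by rw [ht2]; field_simp
  have hdet : Matrix.det !![t, -(t / k) * p; 0, -(t / k) * r] = 1 := by
    rw [Matrix.det_fin_two_of]
    field_simp
    linear_combination -ht2'
  refine ⟨⟨_, hdet⟩, k, hk0, ?_⟩
  ext i j
  fin_cases i <;> fin_cases j <;>
    simp [adjL, Matrix.adjugate_fin_two, ← hp, ← hq, ← hr, ht]
  · field_simp
    linear_combination p * ht2'
  · field_simp
    refine mul_right_cancel₀ hr0 ?_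
    linear_combination k * hk2 - (p ^ 2 + k ^ 2) * ht2'
  · field_simp
    linear_combination ht2'
  · field_simp
    linear_combination -p * ht2'

/-! ### The flat surfaces -/

section Flat

open Filter Topology

variable {f : Plane → Ambient} {U : Set Plane} {u : Plane}

theorem frame_independent (hd : (inducedMetric f u).det ≠ 0) {a b : ℝ}
    (h : a • frame f 0 u + b • frame f 1 u = 0) : a = 0 ∧ b = 0 := by
  have h0 := congrArg (nkMetric · (frame f 0 u)) h
  have h1 := congrArg (nkMetric · (frame f 1 u)) h
  simp only [nkMetric_add_left, nkMetric_smul_left, nkMetric_zero_left] at h0 h1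
  rw [nkMetric_comm (frame f 1 u) (frame f 0 u)] at h0
  rw [inducedMetric_det] at hd
  constructor
  · refine mul_right_cancel₀ hd ?_
    linear_combination nkMetric (frame f 1 u) (frame f 1 u) * h0
      - nkMetric (frame f 0 u) (frame f 1 u) * h1
  · refine mul_right_cancel₀ hd ?_
    linear_combination nkMetric (frame f 0 u) (frame f 0 u) * h1
      - nkMetric (frame f 0 u) (frame f 1 u) * h0

/-- If `C⁻¹ ∂ᵢC` is proportional to `α`, then `C α C⁻¹` has vanishing derivatives. -/
theorem pdV_conj_eq_zero {C : Plane → SL2} (h : Sm (fun w => (C w : Mat2)) u) {α : Mat2}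
    {i : Fin 2} {r : ℝ} (hr : maurer C i u = r • α) :
    pdV i (fun w => (C w : Mat2) * α * adjL (C w : Mat2)) u = 0 := by
  have h1 := pdV_bilin mulB i (h.linear (LinearMap.mulRight ℝ α)) (h.linear adjL)
  have h2 := pdV_linear (LinearMap.mulRight ℝ α) i h
  simp only [LinearMap.mulRight_apply, LinearMap.mul_apply'] at h1 h2
  have h3 : pdV i (fun w => (C w : Mat2)) u = (C u : Mat2) * maurer C i u := by
    rw [maurer, ← mul_assoc, coe_mul_adjL, one_mul]
  rw [h1, h2, pdV_adjL h, h3, hr]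
  simp only [mul_smul_comm, smul_mul_assoc, mul_neg, mul_assoc, add_neg_cancel]

theorem commute_of_conj_eq {A B c : SL2} {ε : Mat2}
    (h : (A : Mat2) * ((c : Mat2) * ε * adjL (c : Mat2)) * adjL (A : Mat2)
      = (B : Mat2) * ((c : Mat2) * ε * adjL (c : Mat2)) * adjL (B : Mat2)) :
    (((B * c)⁻¹ * A * c : SL2) : Mat2) * ε = ε * (((B * c)⁻¹ * A * c : SL2) : Mat2) := by
  have hA := adjL_mul_coe A
  have hB := adjL_mul_coe B
  have hc := adjL_mul_coe c
  have h1 := congrArg (fun m => adjL (c : Mat2) * adjL (B : Mat2) * m * (A : Mat2) * (c : Mat2)) h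
  simp only [mul_assoc] at h1
  rw [← mul_assoc (adjL (B : Mat2)) (B : Mat2), hB, one_mul, ← mul_assoc (adjL (c : Mat2)) (c : Mat2),
    hc, one_mul, ← mul_assoc (adjL (A : Mat2)) (A : Mat2), hA, one_mul, hc, mul_one] at h1
  simp only [mul_inv_rev, Matrix.SpecialLinearGroup.coe_mul, coe_inv_eq_adjL, mul_assoc]
  exact h1

variable {M : Type*} [TopologicalSpace M] [ChartedSpace (EuclideanSpace ℝ (Fin 2)) M]
  [IsManifold (𝓡 2) ∞ M] [ConnectedSpace M] {F : M → Ambient}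

/-- A map `C` with `C⁻¹ dC` proportional to `c ε c⁻¹` is a translate of the one-parameter group
generated by `ε`. -/
theorem OneParam.exists_translate {E : ℝ → SL2} {ε : Mat2} (hE : OneParam E ε) {C : M → SL2}
    (hcont : Continuous fun p => (C p : Mat2)) {c : SL2}
    (hs : ∀ e ∈ IsManifold.maximalAtlas (𝓡 2) ∞ M, ∀ u ∈ e.target,
      Sm (fun w => (C (e.symm w) : Mat2)) u)
    (hm : ∀ e ∈ IsManifold.maximalAtlas (𝓡 2) ∞ M, ∀ u ∈ e.target, ∀ i, ∃ r : ℝ,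
      maurer (fun w => C (e.symm w)) i u = r • ((c : Mat2) * ε * adjL (c : Mat2))) :
    ∃ a : SL2, ∀ p, a * C p * c ∈ Set.range E := by
  obtain ⟨p₀⟩ := (inferInstance : Nonempty M)
  -- The left factor is (C(p₀)c)⁻¹, which sends p₀ to the identity. As C cεc⁻¹ C⁻¹ is constant, the
  -- translated map takes values in the centraliser of ε.
  have hsub := hE.mem_range (Set.range fun p => (C p₀ * c)⁻¹ * C p * c) ?_ ?_ ?_
  · exact ⟨_, fun p => hsub ⟨p, rfl⟩⟩
  · rw [← Set.range_comp]
    refine isPreconnected_range ?_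
    simp only [Function.comp_def, Matrix.SpecialLinearGroup.coe_mul]
    exact (continuous_const.matrix_mul hcont).matrix_mul continuous_const
  · exact ⟨p₀, by group⟩
  · rintro _ ⟨p, rfl⟩
    refine commute_of_conj_eq ?_
    refine const_of_pdV_eq_zero_inCharts
      (φ := fun p => (C p : Mat2) * ((c : Mat2) * ε * adjL (c : Mat2)) * adjL (C p : Mat2))
      (fun e he u hu => ⟨?_, fun i => ?_⟩) p p₀
    · exact ((hs e he u hu).linear (LinearMap.mulRight ℝ _)).bilin mulB ((hs e he u hu).linear adjL)
    · obtain ⟨r, hr⟩ := hm e he u hu i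
      exact pdV_conj_eq_zero (hs e he u hu) hr

omit [TopologicalSpace M] [ChartedSpace (EuclideanSpace ℝ (Fin 2)) M] [IsManifold (𝓡 2) ∞ M]
  [ConnectedSpace M] in
-- Expresses the frame through the differentials of the group parameters, so that nondegeneracy of
-- the metric makes dx and dy independent.
theorem OneParam.maurer_of_translate {E : ℝ → SL2} {ε : Mat2} (hE : OneParam E ε)
    {C : Plane → SL2} {a c : SL2} {x : Plane → ℝ} {V : Set Plane} (hV : IsOpen V) (hu : u ∈ V)
    (hC : Sm (fun w => (C w : Mat2)) u) (hx : ∀ w ∈ V, Sm x w ∧ a * C w * c = E (x w))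
    (i : Fin 2) : maurer C i u = pd i x u • ((c : Mat2) * ε * adjL (c : Mat2)) := by
  have h1 := hE.maurer_comp x u i (hx u hu).1
  have h3 : maurer (fun w => a * C w * c) i u = maurer (fun w => E (x w)) i u := by
    have heq : (fun w => ((a * C w * c : SL2) : Mat2)) =ᶠ[𝓝 u] fun w => (E (x w) : Mat2) :=
      eventually_of_mem (hV.mem_nhds hu) fun w hw =>
        congrArg (fun A : SL2 => (A : Mat2)) (hx w hw).2
    rw [maurer, maurer, pdV_congr i heq, (hx u hu).2]
  rw [← h3, maurer_mul_const hC a c i] at h1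
  have h4 := congrArg (fun m => (c : Mat2) * m * adjL (c : Mat2)) h1
  simp only [mul_smul_comm, smul_mul_assoc] at h4
  rw [← h4]
  simp only [mul_assoc, coe_mul_adjL, mul_one]
  rw [← mul_assoc, coe_mul_adjL, one_mul]

theorem isCongruentTo_of_oneParam (hF : IsAlmostComplexSurface F) {E : ℝ → SL2} {ε α : Mat2}
    (hE : OneParam E ε) {c : SL2} {k : ℝ}
    (hα : α = k • ((c : Mat2) * ε * adjL (c : Mat2)))
    (hT : InCharts F fun f u => tangentPlane f u = lineProd α) :
    IsCongruentTo F fun s t => (E ((1 / √2) * (√3 * s - t)), E ((1 / √2) * (√3 * s + t))) := by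
  have hframe : ∀ e ∈ IsManifold.maximalAtlas (𝓡 2) ∞ M, ∀ u ∈ e.target, ∀ i, ∃ r r' : ℝ,
      maurer (fun w => (F (e.symm w)).1) i u = r • ((c : Mat2) * ε * adjL (c : Mat2)) ∧
      maurer (fun w => (F (e.symm w)).2) i u = r' • ((c : Mat2) * ε * adjL (c : Mat2)) := by
    intro e he u hu i
    have h1 := frame_mem (f := F ∘ e.symm) (u := u) i
    rw [show tangentPlane (F ∘ e.symm) u = lineProd α from hT e he u hu,
      (hF.almostComplexOn he).frame_eq hu] at h1
    obtain ⟨s, t, h2⟩ := h1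
    rw [Prod.ext_iff] at h2
    refine ⟨s * k, t * k, ?_, ?_⟩
    · rw [mul_smul, ← hα]; exact h2.1
    · rw [mul_smul, ← hα]; exact h2.2
  have hc1 : Continuous fun p => ((F p).1 : Mat2) :=
    continuous_matrix fun i j => (hF.smooth₁ i j).continuous
  have hc2 : Continuous fun p => ((F p).2 : Mat2) :=
    continuous_matrix fun i j => (hF.smooth₂ i j).continuous
  -- Both components of the tangent vectors are multiples of the same α, so one c serves both
  -- factors while a and b are chosen separately.
  obtain ⟨a, ha⟩ := hE.exists_translate (C := fun p => (F p).1) (c := c) hc1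
    (fun e he u hu => (hF.almostComplexOn he).fst u hu)
    (fun e he u hu i => by obtain ⟨r, -, h, -⟩ := hframe e he u hu i; exact ⟨r, h⟩)
  obtain ⟨b, hb⟩ := hE.exists_translate (C := fun p => (F p).2) (c := c) hc2
    (fun e he u hu => (hF.almostComplexOn he).snd u hu)
    (fun e he u hu i => by obtain ⟨-, r, -, h⟩ := hframe e he u hu i; exact ⟨r, h⟩)
  refine ⟨a, b, c, fun p => ?_⟩
  set e := chartAt (EuclideanSpace ℝ (Fin 2)) p
  have he : e ∈ IsManifold.maximalAtlas (𝓡 2) ∞ M := IsManifold.chart_mem_maximalAtlas p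
  have hps : p ∈ e.source := mem_chart_source _ p
  have hS := hF.almostComplexOn he
  obtain ⟨V₁, hV₁, hV₁o, hpV₁, x, hx⟩ := hE.exists_lift (fun w => a * (F (e.symm w)).1 * c) e.target
    e.open_target (fun w hw => sm_mul_const (hS.fst w hw) a c) (fun w _ => ha _) _
    (e.map_source hps)
  obtain ⟨V₂, hV₂, hV₂o, hpV₂, y, hy⟩ := hE.exists_lift (fun w => b * (F (e.symm w)).2 * c) e.target
    e.open_target (fun w hw => sm_mul_const (hS.snd w hw) b c) (fun w _ => hb _) _
    (e.map_source hps)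
  have q2 : √2 * √2 = (2 : ℝ) := Real.mul_self_sqrt (by norm_num)
  have q3 : √3 * √3 = (3 : ℝ) := Real.mul_self_sqrt (by norm_num)
  have n2 : √2 ≠ (0 : ℝ) := by positivity
  have n3 : √3 ≠ (0 : ℝ) := by positivity
  -- From x + y = √2 √3 s and y - x = √2 t, these are the factors that recover s and t.
  set k₁ : ℝ := 1 / (√2 * √3) with hk₁
  set k₂ : ℝ := 1 / √2 with hk₂
  have hk₁0 : k₁ ≠ 0 := by positivity
  have hk₂0 : k₂ ≠ 0 := by positivity
  have hneg : ∀ w ∈ V₁ ∩ V₂, Sm (fun w => (-1 : ℝ) • x w) w := fun w hw =>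
    Sm.fsmul contDiffAt_const (hx w hw.1).1
  have hp1 : ∀ w ∈ V₁ ∩ V₂, ∀ i, pd i (fun w => k₁ • (x w + y w)) w
      = k₁ * (pd i x w + pd i y w) := by
    intro w hw i
    rw [pd_eq_pdV, pdV_smul i contDiffAt_const ((hx w hw.1).1.add (hy w hw.2).1), pdV_const,
      pdV_add i (hx w hw.1).1 (hy w hw.2).1]
    simp [pd_eq_pdV]
  have hp2 : ∀ w ∈ V₁ ∩ V₂, ∀ i, pd i (fun w => k₂ • (y w + (-1 : ℝ) • x w)) w
      = k₂ * (pd i y w - pd i x w) := by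
    intro w hw i
    rw [pd_eq_pdV, pdV_smul i contDiffAt_const ((hy w hw.2).1.add (hneg w hw)), pdV_const,
      pdV_add i (hy w hw.2).1 (hneg w hw), pdV_smul i contDiffAt_const (hx w hw.1).1, pdV_const]
    simp [pd_eq_pdV, sub_eq_add_neg]
  have hmx : ∀ w ∈ V₁ ∩ V₂, ∀ i, frame (F ∘ e.symm) i w
      = (pd i x w • ((c : Mat2) * ε * adjL (c : Mat2)),
        pd i y w • ((c : Mat2) * ε * adjL (c : Mat2))) := by
    intro w hw i
    have hwt := hV₁ hw.1
    rw [hS.frame_eq hwt]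
    exact Prod.ext (hE.maurer_of_translate hV₁o hw.1 (hS.fst w hwt) hx i)
      (hE.maurer_of_translate hV₂o hw.2 (hS.snd w hwt) hy i)
  obtain ⟨e', he', hp', hsub, hcoord⟩ := exists_chart he hps (hV₁o.inter hV₂o) ⟨hpV₁, hpV₂⟩
    (s := fun w => k₁ • (x w + y w)) (t := fun w => k₂ • (y w + (-1 : ℝ) • x w))
    (fun w hw => Sm.fsmul contDiffAt_const ((hx w hw.1).1.add (hy w hw.2).1))
    (fun w hw => Sm.fsmul contDiffAt_const ((hy w hw.2).1.add (hneg w hw)))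
    (fun w hw A B h1 h2 => by
      rw [hp1 w hw, hp1 w hw] at h1
      rw [hp2 w hw, hp2 w hw] at h2
      have h3 : A * (pd 0 x w + pd 0 y w) + B * (pd 1 x w + pd 1 y w) = 0 :=
        mul_left_cancel₀ hk₁0 (by linear_combination h1)
      have h4 : A * (pd 0 y w - pd 0 x w) + B * (pd 1 y w - pd 1 x w) = 0 :=
        mul_left_cancel₀ hk₂0 (by linear_combination h2)
      refine frame_independent (hS.nondegenerate w (hV₁ hw.1)) ?_
      have h5 : A * pd 0 x w + B * pd 1 x w = 0 := by linarith
      have h6 : A * pd 0 y w + B * pd 1 y w = 0 := by linarith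
      rw [hmx w hw, hmx w hw, Prod.smul_mk, Prod.smul_mk, Prod.mk_add_mk, smul_smul, smul_smul,
        smul_smul, smul_smul, ← add_smul, ← add_smul, h5, h6, zero_smul]
      rfl)
  refine ⟨e', he', hp', fun q hq => ?_⟩
  obtain ⟨hqV, hs, ht⟩ := hcoord q hq
  have h1 := (hx _ hqV.1).2
  have h2 := (hy _ hqV.2).2
  rw [e.left_inv (hsub hq)] at h1 h2
  have ex : k₂ * (√3 * e' q 0 - e' q 1) = x (e q) := by
    rw [hs, ht, hk₁, hk₂, smul_eq_mul, smul_eq_mul, smul_eq_mul]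
    field_simp
    linear_combination (-x (e q)) * q2
  have ey : k₂ * (√3 * e' q 0 + e' q 1) = y (e q) := by
    rw [hs, ht, hk₁, hk₂, smul_eq_mul, smul_eq_mul, smul_eq_mul]
    field_simp
    linear_combination (-y (e q)) * q2
  simp only [ex, ey]
  exact Prod.ext h1 h2

/-- The sign of ⟨α,α⟩ selects the example; the nilpotent case is excluded because α is not null. -/
theorem isCongruentTo_example (hF : IsAlmostComplexSurface F) (hP : PPreservesTangent F) :
    IsCongruentTo F positiveExample ∨ IsCongruentTo F negativeExample := by
  obtain ⟨α, hα, ht, hT⟩ := exists_constant_line hF hP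
  rcases lt_or_gt_of_ne hα with h | h
  · obtain ⟨c, k, -, hc⟩ := exists_conj_elliptic ht h
    exact Or.inr (isCongruentTo_of_oneParam hF oneParam_elliptic hc hT)
  · obtain ⟨c, k, -, hc⟩ := exists_conj_hyperbolic ht h
    exact Or.inl (isCongruentTo_of_oneParam hF oneParam_hyperbolic hc hT)

end Flat

end NKSL2

end

/-! ### The classification. -/

theorem mainTheorem3 {M : Type*} [TopologicalSpace M]
    [ChartedSpace (EuclideanSpace ℝ (Fin 2)) M] [IsManifold (𝓡 2) ∞ M] [ConnectedSpace M]
    (F : M → NKSL2.Ambient) (hF : NKSL2.IsAlmostComplexSurface F)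
    (hpar : NKSL2.HasParallelSecondForm F) :
    (NKSL2.PMapsTangentToNormal F ∧
      ((NKSL2.IsTotallyGeodesic F ∧ NKSL2.HasConstantCurvature F (-4 / 3)) ∨
        NKSL2.HasConstantCurvature F (-5 / 9))) ∨
    (NKSL2.PPreservesTangent F ∧ NKSL2.HasConstantCurvature F 0 ∧ NKSL2.IsTotallyGeodesic F ∧
      (NKSL2.IsCongruentTo F NKSL2.positiveExample ∨
        NKSL2.IsCongruentTo F NKSL2.negativeExample)) := by
  rcases NKSL2.pMapsTangentToNormal_or_pPreservesTangent hF hpar with hP | hP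
  · exact Or.inl ⟨hP, NKSL2.curvature_of_pMapsTangentToNormal hF hpar hP⟩
  · exact Or.inr ⟨hP,
      fun e he u hu => (hF.almostComplexOn he).gaussCurvature_of_pTangent (hP e he) hu,
      fun e he u hu => (hF.almostComplexOn he).totallyGeodesic_of_pTangent (hP e he) hu,
      NKSL2.isCongruentTo_example hF hP⟩
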